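/- Let $N\ge 1$, $q\in\mathbb C^\times$, $\beta=-q-q^{-1}$, and let $\mathsf{aTL}_N=\mathsf{aTL}_N(\beta)$ be the affine Temperley-Lieb algebra, with generators $e_i$ ($i$ modulo $N$; none if $N=1$) and $\Omega^{\pm1}$, where $\Omega e_i=e_{i-1}\Omega$. For a sign $\pm$ and $z\in\mathbb C^\times$ let $\mathsf X^{\pm}_{N;z}$ be the $\mathsf{aTL}_N$-module $(\mathbb C^2)^{\otimes N}$ on which, for $1\le i\le N$ and with site $N+1$ identified with site $1$, $$e_i=w_i\,\sigma_i^-\sigma_{i+1}^+ + w_i^{-1}\sigma_i^+\sigma_{i+1}^-+(q+q^{-1})\sigma_i^+\sigma_i^-\sigma_{i+1}^+\sigma_{i+1}^- -q^{\pm1}\sigma_i^+\sigma_i^- -q^{\mp1}\sigma_{i+1}^+\sigma_{i+1}^-,$$ with $w_i=1$ for $i<N$ and $w_N=z^2$ (no $e_i$ if $N=1$), and $\Omega=t\,z^{-\sigma_1^z}$ with $t|x_1x_2\dots x_N\rangle=|x_2\dots x_Nx_1\rangle$. Let $\mathsf X^{\pm}_{N;d,z}$ ($d\in\mathbb Z$)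 be the submodule of vectors $v$ with $S^zv=\frac d2v$, where $S^z=\frac12\sum_i\sigma_i^z$. Let $\dagger$ be the anti-automorphism of $\mathsf{aTL}_N$ with $e_i^\dagger=e_i$, $\Omega^\dagger=\Omega^{-1}$, and $\Phi$ the automorphism with $\Phi(e_i)=e_{N-i}$, $\Phi(\Omega)=\Omega^{-1}$. For a module $\mathsf M$ let $\mathsf M^\star=\mathrm{Hom}_{\mathbb C}(\mathsf M,\mathbb C)$ with $(a f)(m)=f(a^\dagger m)$, and let $\mathsf M^\circ$ be $\mathsf M$ with $a$ acting as $\Phi(a)$. For $0\le d\le N$ with $d\equiv N$ mod $2$ and $z\in\mathbb C^\times$, let $\mathsf C_{N;d,z}$ be the cellular module: the span of the planar $(N,d)$-diagrams on the annulus (with $N$ points on one boundary and $d$ on the other, up to isotopy fixing the boundary, a contractible loop being replaced by the factor $\beta$), with $\mathsf{aTL}_N$ acting by composition of diagrams, modulo the diagrams with fewer than $d$ through lines and modulo $v\,\Omega_d=z\,v$ if $d>0$, respectively $v\,\Omega_0=(z+z^{-1})v$ if $d=0$, where $\Omega_d$ is the elementary translation diagram of the $d$ points and $\Omega_0$ the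 non-contractible loop. Let $\mathsf I_{N;d,z}$ be the quotient of $\mathsf C_{N;d,z}$ by the intersection of its maximal submodules. Then: 1. For all $d\in\mathbb Z$ and $z\in\mathbb C^\times$, the spin flip $|x_1\dots x_N\rangle\mapsto|(-x_1)\dots(-x_N)\rangle$ restricts to $\mathsf{aTL}_N$-linear isomorphisms $\mathsf X^{\pm}_{N;d,z}\simeq\mathsf X^{\mp}_{N;-d,z^{-1}}$, and there are isomorphisms $(\mathsf X^{\pm}_{N;d,z})^\star\simeq\mathsf X^{\pm}_{N;d,z^{-1}}$ and $(\mathsf X^{\pm}_{N;d,z})^\circ\simeq\mathsf X^{\mp}_{N;d,z^{-1}}$ of $\mathsf{aTL}_N$-modules. 2. For $0\le d\le N$ with $d\equiv N$ mod $2$ and $z\in\mathbb C^\times$, except when $d=0$, $q+q^{-1}=0$ and $z\in\{q,q^{-1}\}$, one has $(\mathsf I_{N;d,z}^{\,\star})^\circ\simeq\mathsf I_{N;d,z}$. 3. For all $d\in\mathbb Z$ and $z\in\mathbb C^\times$, the Loewy diagram of $\mathsf X^-_{N;d,z}$ is obtained from that of $\mathsf X^+_{N;d,z}$ by flipping all arrows,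 without changing the composition factors. Here the nodes of the Loewy diagram of a module $\mathsf M$ are its composition factors; put $S\to T$ if every submodule of $\mathsf M$ that contains $S$ as a composition factor also contains $T$ (with all its occurrences in $\mathsf M$, i.e. $T$ is not a composition factor of the quotient of $\mathsf M$ by the submodule). The arrows drawn are the relations $S\to T$ between non-isomorphic factors that have no intermediate factor $S\to R\to T$ with $R\not\simeq S,T$. The statement is that there is a bijection between the factors of composition series of $\mathsf X^+_{N;d,z}$ and $\mathsf X^-_{N;d,z}$ that preserves isomorphism classes and reverses both the relation $\to$ and the drawn arrows. -/

import Mathlib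

namespace AffineTL

/-! ### The affine Temperley-Lieb algebra -/

/-- The generators `e i` (indices modulo `N`, only for `N ≥ 2`), `Ω` and `Ω⁻¹`. -/
inductive Gen (N : ℕ) : Type
  | e (h : 2 ≤ N) (i : ZMod N)
  | om
  | omInv

/-- The defining relations of the affine Temperley-Lieb algebra, for elements `e i`, `o`, `oi`
of an algebra.  All indices are taken modulo `N`. -/
structure Rels (N : ℕ) (β : ℂ) {A : Type*} [Ring A] [Algebra ℂ A]
    (e : 2 ≤ N → ZMod N → A) (o oi : A) : Prop where
  mul_inv : o * oi = 1
  inv_mul : oi * o = 1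
  rot : ∀ h i, o * e h i = e h (i - 1) * o
  sq : ∀ h i, e h i * e h i = β • e h i
  up : ∀ h, 3 ≤ N → ∀ i, e h i * e h (i + 1) * e h i = e h i
  down : ∀ h, 3 ≤ N → ∀ i, e h i * e h (i - 1) * e h i = e h i
  comm : ∀ h, 3 ≤ N → ∀ i j, i ≠ j → j ≠ i + 1 → j ≠ i - 1 → e h i * e h j = e h j * e h i
  pow : ∀ h, 3 ≤ N → (o * e h 0) ^ (N - 1) = o ^ N * (o * e h 0)
  powInv : ∀ h, 3 ≤ N → (oi * e h 0) ^ (N - 1) = oi ^ N * (oi * e h 0)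
  two_left : ∀ h, N = 2 → o ^ 2 * e h 1 = e h 1
  two_right : ∀ h, N = 2 → e h 1 * o ^ 2 = e h 1

/-- The relations `Rels` between the generators, as pairs of elements of the free algebra. -/
inductive Rel (N : ℕ) (β : ℂ) : FreeAlgebra ℂ (Gen N) → FreeAlgebra ℂ (Gen N) → Prop
  | mul_inv : Rel N β (.ι ℂ .om * .ι ℂ .omInv) 1
  | inv_mul : Rel N β (.ι ℂ .omInv * .ι ℂ .om) 1
  | rot (h i) : Rel N β (.ι ℂ .om * .ι ℂ (.e h i)) (.ι ℂ (.e h (i - 1)) * .ι ℂ .om)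
  | sq (h i) : Rel N β (.ι ℂ (.e h i) * .ι ℂ (.e h i)) (β • .ι ℂ (.e h i))
  | up (h) (_ : 3 ≤ N) (i) :
      Rel N β (.ι ℂ (.e h i) * .ι ℂ (.e h (i + 1)) * .ι ℂ (.e h i)) (.ι ℂ (.e h i))
  | down (h) (_ : 3 ≤ N) (i) :
      Rel N β (.ι ℂ (.e h i) * .ι ℂ (.e h (i - 1)) * .ι ℂ (.e h i)) (.ι ℂ (.e h i))
  | comm (h) (_ : 3 ≤ N) (i j) (_ : i ≠ j) (_ : j ≠ i + 1) (_ : j ≠ i - 1) :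
      Rel N β (.ι ℂ (.e h i) * .ι ℂ (.e h j)) (.ι ℂ (.e h j) * .ι ℂ (.e h i))
  | pow (h) (_ : 3 ≤ N) : Rel N β ((.ι ℂ .om * .ι ℂ (.e h 0)) ^ (N - 1))
      (.ι ℂ .om ^ N * (.ι ℂ .om * .ι ℂ (.e h 0)))
  | powInv (h) (_ : 3 ≤ N) : Rel N β ((.ι ℂ .omInv * .ι ℂ (.e h 0)) ^ (N - 1))
      (.ι ℂ .omInv ^ N * (.ι ℂ .omInv * .ι ℂ (.e h 0)))
  | two_left (h) (_ : N = 2) : Rel N β (.ι ℂ .om ^ 2 * .ι ℂ (.e h 1)) (.ι ℂ (.e h 1))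
  | two_right (h) (_ : N = 2) : Rel N β (.ι ℂ (.e h 1) * .ι ℂ .om ^ 2) (.ι ℂ (.e h 1))

/-- The affine Temperley-Lieb algebra `aTL_N(β)`. -/
def ATL (N : ℕ) (β : ℂ) : Type := RingQuot (Rel N β)

noncomputable instance (N : ℕ) (β : ℂ) : Ring (ATL N β) := inferInstanceAs (Ring (RingQuot (Rel N β)))

noncomputable instance (N : ℕ) (β : ℂ) : Algebra ℂ (ATL N β) :=
  inferInstanceAs (Algebra ℂ (RingQuot (Rel N β)))

namespace ATL

variable {N : ℕ} {β : ℂ}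

/-- The quotient map from the free algebra. -/
noncomputable def mk (N : ℕ) (β : ℂ) : FreeAlgebra ℂ (Gen N) →ₐ[ℂ] ATL N β :=
  RingQuot.mkAlgHom ℂ (Rel N β)

theorem mk_rel {x y : FreeAlgebra ℂ (Gen N)} (h : Rel N β x y) : mk N β x = mk N β y :=
  RingQuot.mkAlgHom_rel ℂ h

theorem mk_surjective (N : ℕ) (β : ℂ) : Function.Surjective (mk N β) :=
  RingQuot.mkAlgHom_surjective ℂ (Rel N β)

noncomputable def gen (N : ℕ) (β : ℂ) (g : Gen N) : ATL N β := mk N β (.ι ℂ g)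

theorem gen_rels (N : ℕ) (β : ℂ) :
    Rels N β (fun h i => gen N β (.e h i)) (gen N β .om) (gen N β .omInv) := by
  constructor <;> intros <;> simp only [gen, ← map_mul, ← map_pow, ← map_smul] <;>
    first
    | exact (mk_rel (by constructor <;> assumption)).trans (map_one _)
    | exact mk_rel (by constructor <;> assumption)

variable {A : Type*} [Ring A] [Algebra ℂ A]

/-- Elements of an algebra that satisfy the defining relations give a representation. -/
noncomputable def lift {e : 2 ≤ N → ZMod N → A} {o oi : A} (H : Rels N β e o oi) :
    ATL N β →ₐ[ℂ] A :=
  RingQuot.liftAlgHom ℂ ⟨FreeAlgebra.lift ℂ fun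
    | .e h i => e h i
    | .om => o
    | .omInv => oi, by
    intro x y hxy
    cases hxy <;> simp only [map_mul, map_pow, map_smul, map_one, FreeAlgebra.lift_ι_apply]
    · exact H.mul_inv
    · exact H.inv_mul
    · exact H.rot _ _
    · exact H.sq _ _
    · exact H.up _ (by assumption) _
    · exact H.down _ (by assumption) _
    · exact H.comm _ (by assumption) _ _ (by assumption) (by assumption) (by assumption)
    · exact H.pow _ (by assumption)
    · exact H.powInv _ (by assumption)
    · exact H.two_left _ (by assumption)
    · exact H.two_right _ (by assumption)⟩

section
variable {e : 2 ≤ N → ZMod N → A} {o oi : A} (H : Rels N β e o oi)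

theorem lift_gen (g : Gen N) : lift H (gen N β g) = match g with
    | .e h i => e h i
    | .om => o
    | .omInv => oi :=
  (RingQuot.liftAlgHom_mkAlgHom_apply ℂ _ _ _).trans (FreeAlgebra.lift_ι_apply _ _)

theorem lift_e (h i) : lift H (gen N β (.e h i)) = e h i := lift_gen H _

theorem lift_om : lift H (gen N β .om) = o := lift_gen H _

theorem lift_omInv : lift H (gen N β .omInv) = oi := lift_gen H _
end

/-- A set closed under the operations and containing the generators is everything. -/
theorem induction {P : ATL N β → Prop} (hg : ∀ g, P (gen N β g))
    (hc : ∀ c : ℂ, P (algebraMap ℂ _ c)) (ha : ∀ a b, P a → P b → P (a + b))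
    (hm : ∀ a b, P a → P b → P (a * b)) (a : ATL N β) : P a := by
  obtain ⟨x, rfl⟩ := mk_surjective N β a
  induction x using FreeAlgebra.induction with
  | grade0 r => simpa only [AlgHom.commutes] using hc r
  | grade1 g => exact hg g
  | mul a b ha hb => simpa only [map_mul] using hm _ _ ha hb
  | add a b ha' hb => simpa only [map_add] using ha _ _ ha' hb

theorem rot_inv {e : 2 ≤ N → ZMod N → A} {o oi : A} (H : Rels N β e o oi) (h i) :
    oi * e h i = e h (i + 1) * oi := by
  have := H.rot h (i + 1)
  rw [add_sub_cancel_right] at this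
  calc oi * e h i = oi * (e h i * o) * oi := by rw [mul_assoc, mul_assoc, H.mul_inv, mul_one]
    _ = (oi * o) * e h (i + 1) * oi := by rw [← this]; simp only [mul_assoc]
    _ = _ := by rw [H.inv_mul, one_mul]

theorem om_pow_e {e : 2 ≤ N → ZMod N → A} {o oi : A} (H : Rels N β e o oi) (h i) (m : ℕ) :
    o ^ m * e h i = e h (i - m) * o ^ m := by
  induction m generalizing i with
  | zero => simp
  | succ m ih => rw [pow_succ, mul_assoc, H.rot, ← mul_assoc, ih, mul_assoc]; simp [sub_sub, add_comm]

theorem omInv_pow_e {e : 2 ≤ N → ZMod N → A} {o oi : A} (H : Rels N β e o oi) (h i) (m : ℕ) :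
    oi ^ m * e h i = e h (i + m) * oi ^ m := by
  induction m generalizing i with
  | zero => simp
  | succ m ih =>
    rw [pow_succ, mul_assoc, rot_inv H, ← mul_assoc, ih, mul_assoc, ← pow_succ]
    congr 2; push_cast; ring

theorem pow_flip {A : Type*} [Ring A] {x y e : A} (hyx : y * x = 1) (N : ℕ)
    (hc : x ^ N * e = e * x ^ N)
    (h : (x * e) ^ (N - 1) = x ^ N * (x * e)) : (e * x) ^ (N - 1) = e * x * x ^ N := by
  have : ∀ m, (e * x) ^ m = y * (x * e) ^ m * x := by
    intro m
    induction m with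
    | zero => simp [hyx]
    | succ m ih =>
      rw [pow_succ, ih, pow_succ]
      have : y * (x * e) ^ m * x * (e * x) = y * ((x * e) ^ m * (x * e)) * x := by
        simp only [mul_assoc]
      rw [this]
  rw [this, h, mul_assoc e, ← pow_succ', pow_succ, ← mul_assoc e, ← hc]
  have : y * (x ^ N * (x * e)) * x = (y * x) * x ^ N * e * x := by
    rw [← mul_assoc (x ^ N), ← pow_succ, pow_succ' x N]; simp only [mul_assoc]
  rw [this, hyx, one_mul]

/-- The anti-involution `a ↦ a†` (left-right reflection of diagrams): it reverses products, fixes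
every `e i` and exchanges `Ω` and `Ω⁻¹`. -/
noncomputable def dagger (N : ℕ) (β : ℂ) : ATL N β →ₐ[ℂ] (ATL N β)ᵐᵒᵖ :=
  lift (e := fun h i => .op (gen N β (.e h i))) (o := .op (gen N β .omInv))
    (oi := .op (gen N β .om)) <| by
    have H := gen_rels N β
    constructor <;> intros <;>
      simp only [← MulOpposite.op_mul, ← MulOpposite.op_pow, ← MulOpposite.op_smul,
        ← MulOpposite.op_one] <;> congr 1
    · exact H.mul_inv
    · exact H.inv_mul
    · rw [rot_inv H, sub_add_cancel]
    · exact H.sq _ _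
    · rw [← mul_assoc]; exact H.up _ (by assumption) _
    · rw [← mul_assoc]; exact H.down _ (by assumption) _
    · exact (H.comm _ (by assumption) _ _ (by assumption) (by assumption) (by assumption)).symm
    · exact pow_flip H.mul_inv N (by rw [omInv_pow_e H]; simp)
        (H.powInv _ (by assumption))
    · exact pow_flip H.inv_mul N (by rw [om_pow_e H]; simp)
        (H.pow _ (by assumption))
    · rename_i h hN
      rw [← H.two_right h hN, mul_assoc]
      conv_lhs => rw [sq, sq, mul_assoc, ← mul_assoc (gen N β .om) (gen N β .omInv), H.mul_inv,
        one_mul, H.mul_inv, mul_one]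
      exact (H.two_right h hN).symm
    · rename_i h hN
      rw [← H.two_left h hN, ← mul_assoc]
      conv_lhs => rw [sq, sq, mul_assoc (gen N β .omInv), ← mul_assoc (gen N β .omInv) (gen N β .om),
        H.inv_mul, one_mul, H.inv_mul, one_mul]
      exact (H.two_left h hN).symm

/-- The automorphism `Φ` (top-bottom reflection of diagrams): `e i ↦ e (N - i)` and
`Ω^{±1} ↦ Ω^{∓1}`. -/
noncomputable def flip (N : ℕ) (β : ℂ) : ATL N β →ₐ[ℂ] ATL N β :=
  lift (e := fun h i => gen N β (.e h (-i))) (o := gen N β .omInv) (oi := gen N β .om) <| by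
    have H := gen_rels N β
    constructor <;> intros
    · exact H.inv_mul
    · exact H.mul_inv
    · rw [rot_inv H]; congr 3; ring
    · exact H.sq _ _
    · rw [neg_add, ← sub_eq_add_neg]; exact H.down _ (by assumption) _
    · rw [neg_sub', sub_neg_eq_add]; exact H.up _ (by assumption) _
    · rename_i h1 h2 h3
      refine H.comm _ (by assumption) _ _ (fun h => h1 (neg_injective h)) (fun h => h3 ?_)
        (fun h => h2 ?_)
      · rw [← neg_injective.eq_iff, h]; ring
      · rw [← neg_injective.eq_iff, h]; ring
    · rw [neg_zero]; exact H.powInv _ (by assumption)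
    · rw [neg_zero]; exact H.pow _ (by assumption)
    · rename_i h hN
      subst hN
      have : (-1 : ZMod 2) = 1 := by decide
      rw [this, ← H.two_left h rfl, ← mul_assoc]
      conv_lhs => rw [sq, sq, mul_assoc (gen 2 β .omInv), ← mul_assoc (gen 2 β .omInv) (gen 2 β .om),
        H.inv_mul, one_mul, H.inv_mul, one_mul]
      exact (H.two_left h rfl).symm
    · rename_i h hN
      subst hN
      have : (-1 : ZMod 2) = 1 := by decide
      rw [this, ← H.two_right h rfl, mul_assoc]
      conv_lhs => rw [sq, sq, mul_assoc, ← mul_assoc (gen 2 β .om) (gen 2 β .omInv), H.mul_inv,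
        one_mul, H.mul_inv, mul_one]
      exact (H.two_right h rfl).symm

end ATL

/-! ### The two dualities -/

section Dualities

variable {N : ℕ} {β : ℂ} (M : Type*) [AddCommGroup M] [Module ℂ M] [Module (ATL N β) M]
  [IsScalarTower ℂ (ATL N β) M]

/-- The contravariant dual `M⋆`: the linear functionals on `M` with `(a ⋆ f)(m) = f (a† m)`. -/
def StarDual : Type _ := Module.Dual ℂ M

noncomputable instance : AddCommGroup (StarDual M) := inferInstanceAs (AddCommGroup (Module.Dual ℂ M))
noncomputable instance : Module ℂ (StarDual M) := inferInstanceAs (Module ℂ (Module.Dual ℂ M))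

/-- The linear functional underlying an element of `M⋆`. -/
noncomputable def StarDual.equiv : StarDual M ≃ₗ[ℂ] Module.Dual ℂ M := LinearEquiv.refl ℂ _

theorem StarDual.ext' {f g : StarDual M} (h : ∀ m, StarDual.equiv M f m = StarDual.equiv M g m) :
    f = g := (StarDual.equiv M).injective (LinearMap.ext h)

noncomputable instance : SMul (ATL N β) (StarDual M) where
  smul a f := (StarDual.equiv M).symm
    (StarDual.equiv M f ∘ₗ Algebra.lsmul ℂ ℂ M (ATL.dagger N β a).unop)

theorem StarDual.smul_apply (a : ATL N β) (f : StarDual M) (m : M) :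
    StarDual.equiv M (a • f) m = StarDual.equiv M f ((ATL.dagger N β a).unop • m) := rfl

noncomputable instance : Module (ATL N β) (StarDual M) where
  one_smul f := StarDual.ext' M fun m => by simp [StarDual.smul_apply]
  mul_smul a b f := StarDual.ext' M fun m => by simp [StarDual.smul_apply, mul_smul]
  smul_zero a := StarDual.ext' M fun m => by simp [StarDual.smul_apply]
  smul_add a f g := StarDual.ext' M fun m => by simp [StarDual.smul_apply]
  add_smul a b f := StarDual.ext' M fun m => by simp [StarDual.smul_apply, add_smul]
  zero_smul f := StarDual.ext' M fun m => by simp [StarDual.smul_apply]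

instance : IsScalarTower ℂ (ATL N β) (StarDual M) :=
  ⟨fun c a f => StarDual.ext' M fun m => by simp [StarDual.smul_apply]⟩

/-- The twisted module `M∘`: the space `M` on which `a` acts as `Φ(a)`. -/
def CircTwist : Type _ := M

noncomputable instance : AddCommGroup (CircTwist M) := inferInstanceAs (AddCommGroup M)
noncomputable instance : Module ℂ (CircTwist M) := inferInstanceAs (Module ℂ M)

/-- The vector of `M` underlying an element of `M∘`. -/
noncomputable def CircTwist.equiv : CircTwist M ≃ₗ[ℂ] M := LinearEquiv.refl ℂ _

noncomputable instance : Module (ATL N β) (CircTwist M) :=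
  Module.compHom M (ATL.flip N β).toRingHom

theorem CircTwist.equiv_smul (a : ATL N β) (m : CircTwist M) :
    CircTwist.equiv M (a • m) = ATL.flip N β a • CircTwist.equiv M m := rfl

instance : IsScalarTower ℂ (ATL N β) (CircTwist M) :=
  ⟨fun c a m => (CircTwist.equiv M).injective <| by
    rw [CircTwist.equiv_smul, map_smul, map_smul, CircTwist.equiv_smul, smul_assoc]⟩

end Dualities

/-! ### The periodic XXZ spin chain -/

/-- The space `(ℂ²)^{⊗N}` in its spin basis; a spin configuration assigns `±1` to every site, and
the sites `1, …, N` are indexed modulo `N` (so that the site `N` is `0`). -/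
abbrev SpinSpace (N : ℕ) : Type := (ZMod N → ℤˣ) →₀ ℂ

/-- The basis vector `|x₁ x₂ … x_N⟩`. -/
noncomputable def ket {N : ℕ} (x : ZMod N → ℤˣ) : SpinSpace N := Finsupp.single x 1

/-- The linear map with prescribed values on the spin basis. -/
noncomputable def onKets {N : ℕ} (f : (ZMod N → ℤˣ) → SpinSpace N) : Module.End ℂ (SpinSpace N) :=
  Finsupp.linearCombination ℂ f

@[simp] theorem onKets_ket {N : ℕ} (f : (ZMod N → ℤˣ) → SpinSpace N) (x) :
    onKets f (ket x) = f x := by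
  simp [onKets, ket]

theorem ket_ext {N : ℕ} {V : Type*} [AddCommMonoid V] [Module ℂ V] {f g : SpinSpace N →ₗ[ℂ] V}
    (h : ∀ x, f (ket x) = g (ket x)) : f = g :=
  Finsupp.lhom_ext' fun x => LinearMap.ext_ring (h x)

/-- `σ_i^+`. -/
noncomputable def sigmaPlus {N : ℕ} (i : ZMod N) : Module.End ℂ (SpinSpace N) :=
  onKets fun x => if x i = -1 then ket (Function.update x i 1) else 0

/-- `σ_i^-`. -/
noncomputable def sigmaMinus {N : ℕ} (i : ZMod N) : Module.End ℂ (SpinSpace N) :=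
  onKets fun x => if x i = 1 then ket (Function.update x i (-1)) else 0

/-- `σ_i^z`. -/
noncomputable def sigmaZ {N : ℕ} (i : ZMod N) : Module.End ℂ (SpinSpace N) :=
  onKets fun x => ((x i : ℤ) : ℂ) • ket x

/-- The total spin `S^z = ½ ∑ σ_i^z`. -/
noncomputable def totalSpin (N : ℕ) [NeZero N] : Module.End ℂ (SpinSpace N) :=
  (1 / 2 : ℂ) • ∑ i : ZMod N, sigmaZ i

/-- The spin flip `|x₁ … x_N⟩ ↦ |(-x₁) … (-x_N)⟩`. -/
noncomputable def spinFlip (N : ℕ) : Module.End ℂ (SpinSpace N) := onKets fun x => ket (-x)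

/-- The factor of the hopping terms of `e_i`: `z²` between the sites `N` and `1`, else `1`. -/
def twist {N : ℕ} (z : ℂˣ) (i : ZMod N) : ℂˣ := if i = 0 then z ^ 2 else 1

/-- The nearest-neighbour interaction `e_i^ε` between the sites `i` and `i + 1` (`ε = ±1`). -/
noncomputable def xxzE {N : ℕ} (q z : ℂˣ) (ε : ℤˣ) (i : ZMod N) : Module.End ℂ (SpinSpace N) :=
  (twist z i : ℂ) • (sigmaMinus i * sigmaPlus (i + 1))
    + ((twist z i)⁻¹ : ℂ) • (sigmaPlus i * sigmaMinus (i + 1))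
    + ((q : ℂ) + (q : ℂ)⁻¹) • (sigmaPlus i * sigmaMinus i * sigmaPlus (i + 1) * sigmaMinus (i + 1))
    - ((q : ℂ) ^ (ε : ℤ)) • (sigmaPlus i * sigmaMinus i)
    - ((q : ℂ) ^ (-(ε : ℤ))) • (sigmaPlus (i + 1) * sigmaMinus (i + 1))

/-- `Ω = t z^{-σ_1^z}` with `t` the left translation `|x₁ x₂ … x_N⟩ ↦ |x₂ … x_N x₁⟩`. -/
noncomputable def xxzOm (N : ℕ) (z : ℂˣ) : Module.End ℂ (SpinSpace N) :=
  onKets fun x => ((z : ℂ) ^ (-(x 1 : ℤ))) • ket fun j => x (j + 1)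

/-- `Ω⁻¹ = t⁻¹ z^{σ_N^z}`. -/
noncomputable def xxzOmInv (N : ℕ) (z : ℂˣ) : Module.End ℂ (SpinSpace N) :=
  onKets fun x => ((z : ℂ) ^ ((x 0 : ℤ))) • ket fun j => x (j - 1)

/-- `β = -q - q⁻¹`. -/
noncomputable def beta (q : ℂˣ) : ℂ := -(q : ℂ) - (q : ℂ)⁻¹

section XXZRelations

variable {N : ℕ} (q z : ℂˣ) (ε : ℤˣ)

/-- Put opposite spins `a`, `-a` on the sites `i`, `j`. -/
def put (x : ZMod N → ℤˣ) (i j : ZMod N) (a : ℤˣ) : ZMod N → ℤˣ :=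
  Function.update (Function.update x i a) j (-a)

noncomputable def cpl (i : ZMod N) (a : ℤˣ) : ℂ :=
  if a = 1 then -(q : ℂ) ^ (ε : ℤ) else twist z i

noncomputable def cph (i : ZMod N) (a : ℤˣ) : ℂ :=
  if a = 1 then 1 else -((twist z i : ℂ)⁻¹ * (q : ℂ) ^ (-(ε : ℤ)))

/-- A (twisted) singlet on the sites `i`, `i+1`. -/
noncomputable def singlet (i : ZMod N) (x : ZMod N → ℤˣ) : SpinSpace N :=
  cpl q z ε i 1 • ket (put x i (i + 1) 1) + cpl q z ε i (-1) • ket (put x i (i + 1) (-1))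

theorem ne_succ (h : 2 ≤ N) (i : ZMod N) : i + 1 ≠ i := by
  have : Fact (1 < N) := ⟨h⟩
  simp

theorem xxzE_ket (h : 2 ≤ N) (i : ZMod N) (x : ZMod N → ℤˣ) :
    xxzE q z ε i (ket x) =
      if x (i + 1) = - x i then cph q z ε i (x i) • singlet q z ε i x else 0 := by
  have hn := ne_succ h i
  have e1 : ∀ a, x i = a → Function.update x i a = x := fun a ha => by simp [← ha]
  have e2 : ∀ a, x (i+1) = a → Function.update x (i+1) a = x := fun a ha => by simp [← ha]
  have hq : (q : ℂ) ≠ 0 := q.ne_zero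
  have ht : (twist z i : ℂ) ≠ 0 := (twist z i).ne_zero
  have comm : ∀ a b, Function.update (Function.update x (i+1) b) i a =
    Function.update (Function.update x i a) (i+1) b := fun a b => Function.update_comm hn _ _ _
  rcases Int.units_eq_one_or (x i) with h1 | h1 <;>
  rcases Int.units_eq_one_or (x (i + 1)) with h2 | h2 <;>
  rcases Int.units_eq_one_or ε with rfl | rfl <;>
  simp [xxzE, sigmaPlus, sigmaMinus, h1, h2, hn.symm, Function.update_of_ne, cph, cpl, singlet, put,
    comm, e1, e2, Function.update_idem, smul_smul, smul_add, hq]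
  · module
  · module
  · module
  · module
  · rw [show (twist z i : ℂ)⁻¹ * (q : ℂ)⁻¹ * twist z i = (q : ℂ)⁻¹ by field_simp]; module
  · rw [show (twist z i : ℂ)⁻¹ * (q : ℂ) * twist z i = (q : ℂ) by field_simp]; module

theorem singlet_congr (i : ZMod N) {x y : ZMod N → ℤˣ}
    (hxy : ∀ j, j ≠ i → j ≠ i + 1 → x j = y j) : singlet q z ε i x = singlet q z ε i y := by
  have : ∀ a, put x i (i + 1) a = put y i (i + 1) a := by
    intro a
    funext j
    simp only [put, Function.update_apply]
    split_ifs with h1 h2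
    · rfl
    · rfl
    · exact hxy j h2 h1
  simp only [singlet, this]

theorem put_fst (h : 2 ≤ N) (x : ZMod N → ℤˣ) (i a) : put x i (i + 1) a i = a := by
  simp [put, Function.update_of_ne (ne_succ h i).symm]

theorem put_snd (x : ZMod N → ℤˣ) (i j a) : put x i j a j = -a := by simp [put]

theorem put_of_ne (x : ZMod N → ℤˣ) {i j k : ZMod N} (a) (h1 : k ≠ i) (h2 : k ≠ j) :
    put x i j a k = x k := by
  simp [put, Function.update_of_ne, h1, h2]

theorem singlet_put (i a) (x : ZMod N → ℤˣ) :
    singlet q z ε i (put x i (i + 1) a) = singlet q z ε i x :=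
  singlet_congr q z ε i fun _ h1 h2 => put_of_ne x a h1 h2

theorem xxzE_singlet (h : 2 ≤ N) (i : ZMod N) (x : ZMod N → ℤˣ) :
    xxzE q z ε i (singlet q z ε i x) = beta q • singlet q z ε i x := by
  have ht : (twist z i : ℂ) ≠ 0 := (twist z i).ne_zero
  have hn : (-1 : ℤˣ) ≠ 1 := by decide
  conv_lhs => rw [singlet]
  rw [map_add, map_smul, map_smul, xxzE_ket q z ε h, xxzE_ket q z ε h]
  simp only [put_fst h, put_snd, if_true, singlet_put q z ε, smul_smul, ← add_smul]
  congr 1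
  rcases Int.units_eq_one_or ε with rfl | rfl <;> simp [cpl, cph, beta, hn] <;> field_simp <;> ring

theorem hop_up (h : 3 ≤ N) (i : ZMod N) (x : ZMod N → ℤˣ) :
    xxzE q z ε (i + 1) (singlet q z ε i x) =
      (cpl q z ε i (x (i + 1 + 1)) * cph q z ε (i + 1) (-x (i + 1 + 1))) •
        singlet q z ε (i + 1) (Function.update x i (x (i + 1 + 1))) := by
  have h2 : 2 ≤ N := by omega
  have n1 := ne_succ h2 i
  have n2 := ne_succ h2 (i + 1)
  have n3 : i + 1 + 1 ≠ i := by
    rw [add_assoc]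
    have : ((2 : ℕ) : ZMod N) ≠ 0 := by
      rw [Ne, ZMod.natCast_eq_zero_iff]; intro hd; have := Nat.le_of_dvd (by norm_num) hd; omega
    intro h; apply this; push_cast; rw [← one_add_one_eq_two]; simpa using h
  have hs : ∀ a, singlet q z ε (i + 1) (put x i (i + 1) a) =
      singlet q z ε (i + 1) (Function.update x i a) := fun a =>
    singlet_congr q z ε _ fun j h1 _ => by simp [put, Function.update_of_ne h1]
  have hk : ∀ a, put x i (i + 1) a (i + 1 + 1) = x (i + 1 + 1) := fun a => put_of_ne x a n3 n2
  conv_lhs => rw [singlet]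
  rw [map_add, map_smul, map_smul, xxzE_ket q z ε h2, xxzE_ket q z ε h2]
  simp only [put_snd, hk, hs, neg_neg]
  rcases Int.units_eq_one_or (x (i + 1 + 1)) with h1 | h1 <;> simp [h1, smul_smul]

theorem hop_down (h : 3 ≤ N) (i : ZMod N) (x : ZMod N → ℤˣ) :
    xxzE q z ε i (singlet q z ε (i + 1) x) =
      (cpl q z ε (i + 1) (-x i) * cph q z ε i (x i)) •
        singlet q z ε i (Function.update x (i + 1 + 1) (x i)) := by
  have h2 : 2 ≤ N := by omega
  have n1 := ne_succ h2 i
  have n2 := ne_succ h2 (i + 1)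
  have n3 : i + 1 + 1 ≠ i := by
    rw [add_assoc]
    have : ((2 : ℕ) : ZMod N) ≠ 0 := by
      rw [Ne, ZMod.natCast_eq_zero_iff]; intro hd; have := Nat.le_of_dvd (by norm_num) hd; omega
    intro h; apply this; push_cast; rw [← one_add_one_eq_two]; simpa using h
  have hs : ∀ a, singlet q z ε i (put x (i + 1) (i + 1 + 1) a) =
      singlet q z ε i (Function.update x (i + 1 + 1) (-a)) := fun a =>
    singlet_congr q z ε _ fun j h1 h2 => by
      simp only [put, Function.update_apply, if_neg h2]
  have hk : ∀ a, put x (i + 1) (i + 1 + 1) a i = x i := fun a => put_of_ne x a n1.symm n3.symm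
  conv_lhs => rw [singlet]
  rw [map_add, map_smul, map_smul, xxzE_ket q z ε h2, xxzE_ket q z ε h2]
  simp only [put_fst h2, hk, hs]
  rcases Int.units_eq_one_or (x i) with h1 | h1 <;> simp [h1, smul_smul]

theorem cpl_cph (i j : ZMod N) (y : ℤˣ) :
    cpl q z ε i y * cph q z ε j (-y) * (cpl q z ε j (-y) * cph q z ε i y) = 1 := by
  have hn : (-1 : ℤˣ) ≠ 1 := by decide
  have ht : (twist z i : ℂ) ≠ 0 := (twist z i).ne_zero
  have ht : (twist z j : ℂ) ≠ 0 := (twist z j).ne_zero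
  have hq : (q : ℂ) ≠ 0 := q.ne_zero
  rcases Int.units_eq_one_or ε with rfl | rfl <;> rcases Int.units_eq_one_or y with rfl | rfl <;>
    simp [cpl, cph, hn] <;> field_simp

theorem xxz_up (h : 3 ≤ N) (i : ZMod N) (x : ZMod N → ℤˣ) :
    xxzE q z ε i (xxzE q z ε (i + 1) (singlet q z ε i x)) = singlet q z ε i x := by
  have h2 : 2 ≤ N := by omega
  rw [hop_up q z ε h, map_smul, hop_down q z ε h, smul_smul]
  simp only [Function.update_self]
  rw [cpl_cph, one_smul]
  refine singlet_congr q z ε _ fun j h1 _ => ?_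
  simp only [Function.update_apply, h1, if_false]
  split_ifs with h3
  · rw [h3]
  · rfl

theorem xxz_down (h : 3 ≤ N) (i : ZMod N) (x : ZMod N → ℤˣ) :
    xxzE q z ε (i + 1) (xxzE q z ε i (singlet q z ε (i + 1) x)) = singlet q z ε (i + 1) x := by
  have h2 : 2 ≤ N := by omega
  rw [hop_down q z ε h, map_smul, hop_up q z ε h, smul_smul]
  simp only [Function.update_self]
  rw [mul_comm, cpl_cph, one_smul]
  refine singlet_congr q z ε _ fun j _ h1 => ?_
  simp only [Function.update_apply, h1, if_false]
  split_ifs with h3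
  · rw [h3]
  · rfl

/-- Everything in the image of `e_i` is a combination of singlets. -/
theorem xxzE_induction (h : 2 ≤ N) (i : ZMod N) {f g : Module.End ℂ (SpinSpace N)}
    (H : ∀ x, f (singlet q z ε i x) = g (singlet q z ε i x)) :
    f * xxzE q z ε i = g * xxzE q z ε i := by
  refine ket_ext fun x => ?_
  simp only [Module.End.mul_apply, xxzE_ket q z ε h]
  split_ifs
  · rw [map_smul, map_smul, H]
  · simp

theorem xxz_comm (h : 2 ≤ N) (i j : ZMod N) (hij : i ≠ j) (h1 : j ≠ i + 1) (h3 : i ≠ j + 1) :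
    xxzE q z ε i * xxzE q z ε j = xxzE q z ε j * xxzE q z ε i := by
  have h4 : i + 1 ≠ j + 1 := fun h => hij (add_right_cancel h)
  have hc : ∀ (i j : ZMod N), i ≠ j → j ≠ i + 1 → i ≠ j + 1 → ∀ x a b,
      put (put x i (i + 1) a) j (j + 1) b = put (put x j (j + 1) b) i (i + 1) a := by
    intro i j hij h1 h3 x a b
    have h4 : i + 1 ≠ j + 1 := fun h => hij (add_right_cancel h)
    funext k
    simp only [put, Function.update_apply]
    grind
  refine ket_ext fun x => ?_
  have key : ∀ (i j : ZMod N), i ≠ j → j ≠ i + 1 → i ≠ j + 1 →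
      xxzE q z ε i (singlet q z ε j x) = if x (i + 1) = - x i then cph q z ε i (x i) •
        (cpl q z ε j 1 • singlet q z ε i (put x j (j + 1) 1) +
         cpl q z ε j (-1) • singlet q z ε i (put x j (j + 1) (-1))) else 0 := by
    intro i j hij h1 h3
    have h4 : i + 1 ≠ j + 1 := fun h => hij (add_right_cancel h)
    have e1 : ∀ a, put x j (j + 1) a i = x i := fun a => put_of_ne x a hij h3
    have e2 : ∀ a, put x j (j + 1) a (i + 1) = x (i + 1) := fun a => put_of_ne x a h1.symm h4
    conv_lhs => rw [singlet]
    rw [map_add, map_smul, map_smul, xxzE_ket q z ε h, xxzE_ket q z ε h]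
    simp only [e1, e2]
    split_ifs
    · module
    · simp
  simp only [Module.End.mul_apply, xxzE_ket q z ε h, apply_ite, map_smul, map_zero,
    key i j hij h1 h3, key j i hij.symm h3 h1]
  simp only [singlet, hc i j hij h1 h3]
  split_ifs <;> module

theorem xxz_rot (h : 2 ≤ N) (i : ZMod N) :
    xxzOm N z * xxzE q z ε i = xxzE q z ε (i - 1) * xxzOm N z := by
  refine ket_ext fun x => ?_
  have hz : (z : ℂ) ≠ 0 := z.ne_zero
  have hq : (q : ℂ) ≠ 0 := q.ne_zero
  have hn : (-1 : ℤˣ) ≠ 1 := by decide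
  have h01 : (1 : ZMod N) ≠ 0 := by simpa using ne_succ h 0
  have hp : ∀ a, (fun j => put x i (i + 1) a (j + 1)) =
      put (fun j => x (j + 1)) (i - 1) (i - 1 + 1) a := by
    intro a; funext j
    simp only [put, Function.update_apply]
    grind
  simp only [Module.End.mul_apply, xxzE_ket q z ε h]
  simp only [xxzOm, onKets_ket, map_smul, xxzE_ket q z ε h, sub_add_cancel]
  split_ifs with h1
  · simp only [singlet, map_add, map_smul, onKets_ket, hp]
    simp only [sub_add_cancel]
    by_cases hi1 : i = 1
    · subst hi1
      have e1 : ∀ a, put x 1 (1 + 1) a 1 = a := put_fst h x 1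
      simp only [e1, smul_smul, smul_add, sub_self]
      rcases Int.units_eq_one_or (x 1) with h2 | h2 <;>
        simp [h2, cpl, cph, twist, h01, hn] <;> congr 2 <;> field_simp
    · by_cases hi0 : i = 0
      · subst hi0
        have e1 : ∀ a, put x 0 (0 + 1) a 1 = -a := fun a => by
          have := put_snd x 0 (0 + 1) a; rwa [zero_add] at this ⊢
        have h00 : (-1 : ZMod N) ≠ 0 := neg_ne_zero.mpr h01
        rw [zero_add] at h1
        simp only [e1, smul_smul, smul_add]
        rcases Int.units_eq_one_or (x 0) with h2 | h2 <;>
          simp [h1, h2, cpl, cph, twist, h00, hn] <;> congr 2 <;> field_simp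
      · have e1 : ∀ a, put x i (i + 1) a 1 = x 1 := fun a => put_of_ne x a (Ne.symm hi1)
          (fun h => hi0 (by simpa using h))
        have : i - 1 ≠ 0 := sub_ne_zero.mpr hi1
        simp only [e1, smul_smul, smul_add]
        simp [cpl, cph, twist, hi0, this]
        congr 2 <;> ring_nf
  · simp

theorem xxz_inv : xxzOm N z * xxzOmInv N z = 1 ∧ xxzOmInv N z * xxzOm N z = 1 := by
  have hz : ∀ a : ℤ, (z : ℂ) ^ a ≠ 0 := fun a => zpow_ne_zero a z.ne_zero
  constructor <;> refine ket_ext fun x => ?_ <;>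
    simp only [xxzOm, xxzOmInv, Module.End.mul_apply, onKets_ket, map_smul, smul_smul, zpow_neg,
      sub_add_cancel, add_sub_cancel_right, Module.End.one_apply, sub_self, zero_add,
      mul_inv_cancel₀ (hz _), inv_mul_cancel₀ (hz _), one_smul]

theorem xxz_om_pow (m : ℕ) (x : ZMod N → ℤˣ) : (xxzOm N z ^ m) (ket x) =
    ((z : ℂ) ^ (-∑ j ∈ Finset.range m, (x ((j + 1 : ℕ)) : ℤ))) •
      ket fun j => x (j + (m : ZMod N)) := by
  have hz : (z : ℂ) ≠ 0 := z.ne_zero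
  induction m with
  | zero => simp
  | succ m ih =>
    rw [pow_succ', Module.End.mul_apply, ih, map_smul, xxzOm, onKets_ket, smul_smul,
      Finset.sum_range_succ, neg_add, zpow_add₀ hz]
    congr 2
    · push_cast; rw [add_comm (1 : ZMod N)]
    · push_cast; funext j; congr 1; ring

theorem om_singlet_zero (h : 2 ≤ N) (x : ZMod N → ℤˣ) :
    xxzOm N z (singlet q z ε 0 x) = (z : ℂ) • singlet q z ε (-1) (fun j => x (j + 1)) := by
  have e1 : singlet q z ε 0 x = xxzE q z ε 0 (ket (put x 0 (0 + 1) 1)) := by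
    rw [xxzE_ket q z ε h, put_fst h, put_snd, if_pos rfl, singlet_put]
    simp [cph]
  have e2 : put x 0 (0 + 1) 1 1 = -1 := by
    have := put_snd x 0 (0 + 1) 1; rwa [zero_add] at this ⊢
  have e3 : put x 0 (0 + 1) 1 0 = 1 := put_fst h x 0 1
  rw [e1, ← Module.End.mul_apply, xxz_rot q z ε h, Module.End.mul_apply, xxzOm, onKets_ket, map_smul,
    xxzE_ket q z ε h, e2]
  simp only [zero_sub, neg_add_cancel, e3]
  rw [if_pos (by rw [zero_add, ← e2, zero_add])]
  simp only [cph, if_true, one_smul]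
  rw [singlet_congr q z ε (-1) (y := fun j => x (j + 1))]
  · simp
  · intro j h1 h2
    refine put_of_ne x 1 (fun h => h1 (eq_neg_of_add_eq_zero_left h)) (fun h => h2 ?_)
    rw [neg_add_cancel]; exact add_right_cancel h

theorem xxz_step (h : 3 ≤ N) (x y : ZMod N → ℤˣ) (h1 : y (-2) = x 1)
    (h2 : ∀ j, j ≠ -2 → j ≠ -1 → j ≠ 0 → y j = x (j + 1)) :
    (xxzOm N z * xxzE q z ε 0 : Module.End ℂ (SpinSpace N)) (singlet q z ε (-1) x) =
      ((z : ℂ) ^ (-(x 1 : ℤ))) • singlet q z ε (-1) y := by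
  have hz : (z : ℂ) ≠ 0 := z.ne_zero
  have hq : (q : ℂ) ≠ 0 := q.ne_zero
  have hn : (-1 : ℤˣ) ≠ 1 := by decide
  have h2' : 2 ≤ N := by omega
  have h01 : (1 : ZMod N) ≠ 0 := by simpa using ne_succ h2' 0
  have e := hop_up q z ε h (-1) x
  rw [neg_add_cancel, zero_add] at e
  rw [Module.End.mul_apply, e, map_smul, om_singlet_zero q z ε h2', smul_smul]
  congr 1
  · rcases Int.units_eq_one_or (x 1) with h3 | h3 <;>
    rcases Int.units_eq_one_or ε with rfl | rfl <;> simp [h3, cpl, cph, twist, hn, h01] <;>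
    field_simp
  · refine singlet_congr q z ε _ fun j h3 h4 => ?_
    rw [neg_add_cancel] at h4
    by_cases h5 : j = -2
    · subst h5
      rw [h1, Function.update_apply, if_pos (by ring)]
    · rw [h2 j h5 h3 h4, Function.update_of_ne]
      intro h; apply h5; rw [eq_sub_of_add_eq h]; ring

theorem val_add_one' (h : 2 ≤ N) {j : ZMod N} (hj : j ≠ -1) : (j + 1).val = j.val + 1 := by
  have : NeZero N := ⟨by omega⟩
  have : Fact (1 < N) := ⟨h⟩
  have h1 : j.val + 1 < N := by
    have := j.val_lt
    rcases Nat.lt_or_ge (j.val + 1) N with h | h'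
    · exact h
    · exfalso; apply hj
      have h3 : j.val + 1 = N := by omega
      have : ((j.val + 1 : ℕ) : ZMod N) = 0 := by rw [h3]; simp
      rw [Nat.cast_add, ZMod.natCast_zmod_val] at this
      exact eq_neg_of_add_eq_zero_left (by simpa using this)
  rw [ZMod.val_add_of_lt] <;> rw [ZMod.val_one]
  exact h1

theorem val_neg_two (h : 3 ≤ N) : (-2 : ZMod N).val = N - 2 := by
  have : (-2 : ZMod N) = ((N - 2 : ℕ) : ZMod N) := by
    rw [Nat.cast_sub (by omega)]; simp
  rw [this, ZMod.val_cast_of_lt (by omega)]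

theorem xxz_iter (h : 3 ≤ N) (x : ZMod N → ℤˣ) (m : ℕ) (hm : m ≤ N - 2) :
    ((xxzOm N z * xxzE q z ε 0) ^ m : Module.End ℂ (SpinSpace N)) (singlet q z ε (-1) x) =
      ((z : ℂ) ^ (-∑ j ∈ Finset.range m, (x ((j + 1 : ℕ)) : ℤ))) •
        singlet q z ε (-1) fun j => if j.val + m ≤ N - 2 then x ((j.val + m : ℕ)) else
          x ((j.val + m - (N - 2) : ℕ)) := by
  have hz : (z : ℂ) ≠ 0 := z.ne_zero
  have : NeZero N := ⟨by omega⟩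
  have : Fact (1 < N) := ⟨by omega⟩
  induction m with
  | zero =>
    simp only [pow_zero, Module.End.one_apply, Finset.range_zero, Finset.sum_empty, neg_zero,
      zpow_zero, one_smul]
    refine singlet_congr q z ε _ fun j h1 h2 => ?_
    rw [if_pos, add_zero, ZMod.natCast_zmod_val]
    have h3 : j + 1 ≠ -1 + 1 := fun h => h1 (add_right_cancel h)
    have := val_add_one' (by omega) h1
    have := (j + 1).val_lt
    omega
  | succ m ih =>
    rw [pow_succ', Module.End.mul_apply, ih (by omega), map_smul]
    rw [xxz_step q z ε h _ (fun j => if j.val + (m + 1) ≤ N - 2 then x ((j.val + (m + 1) : ℕ)) else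
          x ((j.val + (m + 1) - (N - 2) : ℕ)))]
    · rw [smul_smul, ← zpow_add₀ hz, Finset.sum_range_succ, neg_add, ZMod.val_one,
        if_pos (by omega), add_comm 1 m]
    · simp only [val_neg_two h, ZMod.val_one]
      rw [if_neg (by omega), if_pos (by omega)]
      congr 2; omega
    · intro j _ h2 _
      simp only [val_add_one' (by omega) h2]
      simp only [add_assoc, add_comm 1 m]

theorem xxz_pow (h : 3 ≤ N) : (xxzOm N z * xxzE q z ε 0) ^ (N - 1) =
    xxzOm N z ^ N * (xxzOm N z * xxzE q z ε 0) := by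
  have h2 : 2 ≤ N := by omega
  have hN : NeZero N := ⟨by omega⟩
  obtain ⟨M, rfl⟩ : ∃ M, N = M + 2 := ⟨N - 2, by omega⟩
  rw [show M + 2 - 1 = M + 1 by omega, pow_succ]
  have hr : xxzOm (M + 2) z * xxzE q z ε 0 = xxzE q z ε (-1) * xxzOm (M + 2) z := by
    rw [xxz_rot q z ε h2, zero_sub]
  conv_lhs => rw [hr, ← mul_assoc, ← hr]
  conv_rhs => rw [hr, ← mul_assoc]
  congr 1
  refine xxzE_induction q z ε h2 _ fun x => ?_
  have key : ∀ a, (xxzOm (M + 2) z ^ (M + 2)) (ket (put x (-1) (-1 + 1) a)) =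
      ((z : ℂ) ^ (-∑ j ∈ Finset.range M, (x ((j + 1 : ℕ)) : ℤ))) •
        ket (put x (-1) (-1 + 1) a) := by
    intro a
    have c1 : ((M + 1 : ℕ) : ZMod (M + 2)) = -1 := by
      have : ((M + 2 : ℕ) : ZMod (M + 2)) = 0 := ZMod.natCast_self _
      push_cast at this ⊢
      linear_combination this
    have c2 : ((M + 1 + 1 : ℕ) : ZMod (M + 2)) = -1 + 1 := by
      rw [neg_add_cancel]; exact ZMod.natCast_self _
    rw [xxz_om_pow, Finset.sum_range_succ, Finset.sum_range_succ, c1, c2, put_snd, put_fst h2]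
    congr 2
    · simp only [Units.val_neg, add_neg_cancel_right, neg_inj]
      refine Finset.sum_congr rfl fun j hj => ?_
      rw [Finset.mem_range] at hj
      rw [put_of_ne]
      · rw [← c1]; intro h
        have := congrArg ZMod.val h
        rw [ZMod.val_cast_of_lt (by omega), ZMod.val_cast_of_lt (by omega)] at this; omega
      · rw [neg_add_cancel]; intro h
        have := congrArg ZMod.val h
        rw [ZMod.val_cast_of_lt (by omega), ZMod.val_zero] at this; omega
    · funext j; simp only [neg_add_cancel, add_zero]
  rw [xxz_iter q z ε h x M (by omega)]
  conv_rhs => rw [singlet, map_add, map_smul, map_smul, key, key, smul_comm, smul_comm (cpl _ _ _ _ (-1)),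
    ← smul_add]
  congr 1
  refine singlet_congr q z ε _ fun j h1 h2 => ?_
  rw [neg_add_cancel] at h2
  have hj : j.val ≠ 0 := fun h => h2 ((ZMod.val_eq_zero j).mp h)
  rw [if_neg (by omega), show j.val + M - (M + 2 - 2) = j.val by omega, ZMod.natCast_zmod_val]

/-- The reflection `|x₁ … x_N⟩ ↦ |x_N … x₁⟩`. -/
noncomputable def reflect (N : ℕ) : Module.End ℂ (SpinSpace N) :=
  onKets fun x => ket fun j => x (1 - j)

theorem reflect_reflect : reflect N * reflect N = 1 :=
  ket_ext fun x => by simp [reflect]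

theorem reflect_om : reflect N * xxzOmInv N z = xxzOm N z⁻¹ * reflect N := by
  refine ket_ext fun x => ?_
  simp only [reflect, xxzOmInv, xxzOm, Module.End.mul_apply, onKets_ket, map_smul, sub_self]
  congr 1
  · simp
  · congr 1; funext j; congr 1; ring

theorem reflect_e (h : 2 ≤ N) :
    reflect N * xxzE q z ε 0 = xxzE q z⁻¹ (-ε) 0 * reflect N := by
  have hz : (z : ℂ) ≠ 0 := z.ne_zero
  have hq : (q : ℂ) ≠ 0 := q.ne_zero
  have hn : (-1 : ℤˣ) ≠ 1 := by decide
  have h01 : (1 : ZMod N) ≠ 0 := by simpa using ne_succ h 0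
  have hp : ∀ x : ZMod N → ℤˣ, ∀ a, (fun j => put x 0 1 a (1 - j)) =
      put (fun j => x (1 - j)) 0 1 (-a) := by
    intro x a; funext j
    simp only [put, Function.update_apply, neg_neg]
    grind
  refine ket_ext fun x => ?_
  simp only [Module.End.mul_apply, xxzE_ket q z ε h, reflect, onKets_ket,
    xxzE_ket q z⁻¹ (-ε) h, zero_add, sub_self, sub_zero]
  by_cases h1 : x 1 = - x 0
  · rw [if_pos h1, if_pos (by rw [h1, neg_neg]), h1]
    simp only [singlet, map_smul, map_add, onKets_ket, zero_add, hp]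
    rcases Int.units_eq_one_or ε with rfl | rfl <;>
    rcases Int.units_eq_one_or (x 0) with h2 | h2 <;> simp [h2, cpl, cph, twist, hn, smul_smul] <;>
    field_simp <;> rw [add_comm]
  · rw [if_neg h1, if_neg (fun h => h1 (by rw [h, neg_neg])), map_zero]

theorem xxz_powInv (h : 3 ≤ N) : (xxzOmInv N z * xxzE q z ε 0) ^ (N - 1) =
    xxzOmInv N z ^ N * (xxzOmInv N z * xxzE q z ε 0) := by
  have h2 : 2 ≤ N := by omega
  have c1 : SemiconjBy (reflect N) (xxzOmInv N z) (xxzOm N z⁻¹) := reflect_om z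
  have c2 : SemiconjBy (reflect N) (xxzE q z ε 0) (xxzE q z⁻¹ (-ε) 0) := reflect_e q z ε h2
  have c3 := (c1.mul_right c2).pow_right (N - 1)
  rw [xxz_pow q z⁻¹ (-ε) h] at c3
  have c4 := (c1.pow_right N).mul_right (c1.mul_right c2)
  have := congrArg (reflect N * ·) (c3.eq.trans c4.eq.symm)
  simpa only [← mul_assoc, reflect_reflect, one_mul] using this

end XXZRelations

theorem xxz_two (q z : ℂˣ) (ε : ℤˣ) : xxzOm 2 z ^ 2 * xxzE q z ε 1 = xxzE q z ε 1 := by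
  have h : 2 ≤ 2 := le_rfl
  refine (xxzE_induction q z ε h 1 (g := 1) fun x => ?_).trans (one_mul _)
  have key : ∀ a, (xxzOm 2 z ^ 2) (ket (put x 1 (1 + 1) a)) = ket (put x 1 (1 + 1) a) := by
    intro a
    rw [xxz_om_pow]
    have c : ((0 + 1 : ℕ) : ZMod 2) = 1 := by decide
    have c' : ((1 + 1 : ℕ) : ZMod 2) = 1 + 1 := by decide
    rw [Finset.sum_range_succ, Finset.sum_range_one, c, c', put_snd, put_fst h, show (1 : ZMod 2) + 1 = 0 from by decide]
    simp
  rw [singlet, map_add, map_smul, map_smul, key, key]; rfl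

/-- The operators `e_i^ε`, `Ω`, `Ω⁻¹` satisfy the relations of the affine Temperley-Lieb algebra. -/
theorem xxz_rels (N : ℕ) (q z : ℂˣ) (ε : ℤˣ) :
    Rels N (beta q) (fun _ i => xxzE q z ε i) (xxzOm N z) (xxzOmInv N z) where
  mul_inv := (xxz_inv z).1
  inv_mul := (xxz_inv z).2
  rot h i := xxz_rot q z ε h i
  sq h i := xxzE_induction q z ε h i (g := beta q • 1) (fun x => xxzE_singlet q z ε h i x) |>.trans
    (by rw [smul_mul_assoc, one_mul])
  up h h3 i := (xxzE_induction q z ε h i (f := xxzE q z ε i * xxzE q z ε (i + 1)) (g := 1)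
    (fun x => xxz_up q z ε h3 i x)).trans (one_mul _)
  down h h3 i := (xxzE_induction q z ε h i (f := xxzE q z ε i * xxzE q z ε (i - 1)) (g := 1)
    (fun x => by have := xxz_down q z ε h3 (i - 1) x; rwa [sub_add_cancel] at this)).trans
    (one_mul _)
  comm h _ i j h1 h2 h4 := xxz_comm q z ε h i j h1 h2 fun h5 => h4 (by rw [h5]; ring)
  pow _ h3 := xxz_pow q z ε h3
  powInv _ h3 := xxz_powInv q z ε h3
  two_left h hN := by subst hN; exact xxz_two q z ε
  two_right h hN := by
    subst hN
    have h2 : xxzOm 2 z ^ 2 * xxzE q z ε 1 = xxzE q z ε 1 * xxzOm 2 z ^ 2 := by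
      rw [sq, mul_assoc, xxz_rot q z ε h, ← mul_assoc, xxz_rot q z ε h, mul_assoc]
      congr 2
    rw [← h2]; exact xxz_two q z ε

/-- The module `X^ε_{N;z}` (`ε = ±1`): the space `(ℂ²)^{⊗N}` with the action of `aTL_N(β)`
through `e_i^ε` and `Ω`. -/
def XXZ (N : ℕ) (_q _z : ℂˣ) (_ε : ℤˣ) : Type := SpinSpace N

section XXZModules

variable {N : ℕ} {q z : ℂˣ} {ε : ℤˣ}

noncomputable instance : AddCommGroup (XXZ N q z ε) := inferInstanceAs (AddCommGroup (SpinSpace N))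
noncomputable instance : Module ℂ (XXZ N q z ε) := inferInstanceAs (Module ℂ (SpinSpace N))

/-- The vector of `(ℂ²)^{⊗N}` underlying an element of `X^ε_{N;z}`. -/
noncomputable def XXZ.vec : XXZ N q z ε ≃ₗ[ℂ] SpinSpace N := LinearEquiv.refl ℂ _

noncomputable instance : Module (ATL N (beta q)) (XXZ N q z ε) :=
  Module.compHom (SpinSpace N) (ATL.lift (xxz_rels N q z ε)).toRingHom

theorem XXZ.vec_smul (a : ATL N (beta q)) (v : XXZ N q z ε) :
    XXZ.vec (a • v) = ATL.lift (xxz_rels N q z ε) a (XXZ.vec v) := rfl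

instance : IsScalarTower ℂ (ATL N (beta q)) (XXZ N q z ε) :=
  ⟨fun c a v => XXZ.vec.injective <| by
    rw [XXZ.vec_smul, map_smul, map_smul, XXZ.vec_smul, LinearMap.smul_apply]⟩

theorem totalSpin_ket [NeZero N] (x : ZMod N → ℤˣ) :
    totalSpin N (ket x) = (((∑ i, (x i : ℤ) : ℤ) : ℂ) / 2) • ket x := by
  simp [totalSpin, sigmaZ, ← Finset.sum_smul, smul_smul]
  congr 1; ring

theorem sum_put [NeZero N] (h : 2 ≤ N) (i : ZMod N) (x : ZMod N → ℤˣ) (hx : x (i + 1) = - x i)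
    (a : ℤˣ) : ∑ j, (put x i (i + 1) a j : ℤ) = ∑ j, (x j : ℤ) := by
  rw [← sub_eq_zero, ← Finset.sum_sub_distrib, Fintype.sum_eq_add i (i + 1) (ne_succ h i).symm]
  · rw [put_fst h, put_snd, hx]; simp
  · rintro j ⟨h1, h2⟩
    rw [put_of_ne x a h1 h2, sub_self]

theorem totalSpin_commute [NeZero N] (a : ATL N (beta q)) :
    Commute (totalSpin N) (ATL.lift (xxz_rels N q z ε) a) := by
  induction a using ATL.induction with
  | hc c => rw [AlgHom.commutes]; exact (Algebra.commutes c _).symm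
  | ha a b iha ihb => rw [map_add]; exact iha.add_right ihb
  | hm a b iha ihb => rw [map_mul]; exact iha.mul_right ihb
  | hg g =>
    refine ket_ext fun x => ?_
    cases g with
    | e h i =>
      rw [ATL.lift_e, Module.End.mul_apply, Module.End.mul_apply, totalSpin_ket, map_smul,
        xxzE_ket q z ε h]
      split_ifs with hx
      · simp only [singlet, map_smul, map_add, totalSpin_ket, sum_put h i x hx]
        module
      · simp
    | om =>
      rw [ATL.lift_om, Module.End.mul_apply, Module.End.mul_apply, totalSpin_ket, map_smul, xxzOm,
        onKets_ket, map_smul, totalSpin_ket, smul_comm,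
        show ∑ j, (x (j + 1) : ℤ) = ∑ j, (x j : ℤ) from
          Equiv.sum_comp (Equiv.addRight (1 : ZMod N)) fun j => (x j : ℤ)]
    | omInv =>
      rw [ATL.lift_omInv, Module.End.mul_apply, Module.End.mul_apply, totalSpin_ket, map_smul,
        xxzOmInv, onKets_ket, map_smul, totalSpin_ket, smul_comm,
        show ∑ j, (x (j - 1) : ℤ) = ∑ j, (x j : ℤ) from
          Equiv.sum_comp (Equiv.subRight (1 : ZMod N)) fun j => (x j : ℤ)]

end XXZModules

/-- The submodule `X^ε_{N;d,z}` of `X^ε_{N;z}`: the eigenspace of `S^z` with eigenvalue `d/2`. -/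
noncomputable def XXZd (N : ℕ) [NeZero N] (q z : ℂˣ) (ε : ℤˣ) (d : ℤ) :
    Submodule (ATL N (beta q)) (XXZ N q z ε) where
  carrier := {v | totalSpin N (XXZ.vec v) = ((d : ℂ) / 2) • XXZ.vec v}
  add_mem' {v w} hv hw := by
    rw [Set.mem_ofPred_eq] at *
    rw [map_add, map_add, hv, hw, smul_add]
  zero_mem' := by simp
  smul_mem' a v hv := by
    rw [Set.mem_ofPred_eq] at *
    rw [XXZ.vec_smul, ← Module.End.mul_apply, (totalSpin_commute a).eq, Module.End.mul_apply, hv,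
      map_smul]

/-! ### Diagrams on the annulus -/

/-- The marked points of an `(N,d)`-diagram: `N` points on the left side (the points `1, …, N`,
indexed modulo `N`) and `d` points on the right side. -/
abbrev Site (N d : ℕ) : Type := ZMod N ⊕ Fin d

/-- How the marked points of an `(N,d)`-diagram are linked.  The annulus is unrolled to a strip, in
which every marked point `x` has the copies `(x, m)`, `m ∈ ℤ`, `m` increasing downwards.  The line
that starts at the copy `(x, m)` ends at the copy `(p x, m + n x)`, so that `n x` counts (with sign)
how often this line goes through the top and bottom sides of the rectangle.  Moreover the diagram
has `loops` non-contractible loops, and no contractible one.  (Lines may still cross here; planarity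
is the condition `Link.IsPlanar` below.) -/
@[ext]
structure Link (N d : ℕ) where
  p : Site N d → Site N d
  n : Site N d → ℤ
  loops : ℕ
  p_p : ∀ x, p (p x) = x
  p_ne : ∀ x, p x ≠ x
  n_p : ∀ x, n (p x) = -n x

namespace Link

variable {N d : ℕ}

/-- Cut the lines at the points `u` and `v`, join the two loose ends by a line passing from the copy
`(u, m)` to the copy `(v, m + s)`, and link `u` to `v` by a line of the same shape.  A loop that
arises is recorded if it is not contractible. -/
def join (u v : Site N d) (s : ℤ) (huv : u ≠ v) (L : Link N d) : Link N d where
  p x := if x = u then v else if x = v then u else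
    if L.p x = u then L.p v else if L.p x = v then L.p u else L.p x
  n x := if x = u then s else if x = v then -s else
    if L.p x = u then L.n x + s + L.n v else if L.p x = v then L.n x - s + L.n u else L.n x
  loops := if L.p u = v ∧ L.n u ≠ s then L.loops + 1 else L.loops
  p_p x := by
    have := L.p_p; have := L.p_ne
    grind
  p_ne x := by
    have := L.p_p; have := L.p_ne
    grind
  n_p x := by
    have := L.p_p; have := L.p_ne; have := L.n_p
    grind

/-- Whether joining `u` and `v` creates a contractible loop. -/
def Closes (u v : Site N d) (s : ℤ) (L : Link N d) : Prop := L.p u = v ∧ L.n u = s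

instance (u v : Site N d) (s : ℤ) (L : Link N d) : Decidable (L.Closes u v s) :=
  inferInstanceAs (Decidable (_ ∧ _))

theorem join_symm (u v : Site N d) (s : ℤ) (huv : u ≠ v) (L : Link N d) :
    L.join u v s huv = L.join v u (-s) huv.symm := by
  have := L.p_p; have := L.p_ne; have := L.n_p
  ext x
  · simp only [join]; grind
  · simp only [join]; grind
  · simp only [join]; grind

theorem closes_symm (u v : Site N d) (s : ℤ) (L : Link N d) :
    L.Closes u v s ↔ L.Closes v u (-s) := by
  have := L.p_p; have := L.n_p
  simp only [Closes]; grind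

theorem closes_join (u v : Site N d) (s : ℤ) (huv : u ≠ v) (L : Link N d) :
    (L.join u v s huv).Closes u v s := by
  simp [join, Closes]

theorem join_of_closes (u v : Site N d) (s : ℤ) (huv : u ≠ v) (L : Link N d) (h : L.Closes u v s) :
    L.join u v s huv = L := by
  have := L.p_p; have := L.p_ne; have := L.n_p
  obtain ⟨h1, h2⟩ := h
  ext x
  · simp only [join]; grind
  · simp only [join]; grind
  · simp only [join]; grind

theorem join_tl (u v w : Site N d) (s t : ℤ) (huv : u ≠ v) (hvw : v ≠ w) (huw : u ≠ w)
    (L : Link N d) (h : L.Closes u v s) : (L.join v w t hvw).join u v s huv = L := by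
  have := L.p_p; have := L.p_ne; have := L.n_p
  obtain ⟨h1, h2⟩ := h
  ext x
  · simp only [join]; grind
  · simp only [join]; grind
  · simp only [join]; grind

theorem not_closes_tl (u v w : Site N d) (s t : ℤ) (hvw : v ≠ w) (huw : u ≠ w)
    (L : Link N d) (h : L.Closes u v s) :
    ¬ L.Closes v w t ∧ ¬ (L.join v w t hvw).Closes u v s := by
  have := L.p_p; have := L.p_ne; have := L.n_p
  obtain ⟨h1, h2⟩ := h
  simp only [join, Closes]; grind

theorem join_comm (u v u' v' : Site N d) (s t : ℤ) (huv : u ≠ v) (huv' : u' ≠ v')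
    (h1 : u ≠ u') (h2 : u ≠ v') (h3 : v ≠ u') (h4 : v ≠ v') (L : Link N d) :
    (L.join u v s huv).join u' v' t huv' = (L.join u' v' t huv').join u v s huv := by
  have hp := L.p_p; have hne := L.p_ne; have hn := L.n_p
  have e1 := hp u; have e2 := hp v; have e3 := hp u'; have e4 := hp v'
  have f1 := hne u; have f2 := hne v; have f3 := hne u'; have f4 := hne v'
  have g1 := hn u; have g2 := hn v; have g3 := hn u'; have g4 := hn v'
  ext x
  · have e5 := hp x; have f5 := hne x
    clear hp hne hn
    simp only [join]; grind (splits := 40)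
  · have e5 := hp x; have f5 := hne x; have g5 := hn x
    clear hp hne hn
    simp only [join]; grind (splits := 40)
  · clear hp hne hn
    simp only [join]; grind (splits := 40)

end Link

namespace Link

variable {N d : ℕ}

/-- Move the end of every line at `(x, m)` to `(ρ x, σ m + r x)`. -/
def relabel (σ : ℤˣ) (ρ : Site N d ≃ Site N d) (r : Site N d → ℤ) (L : Link N d) : Link N d where
  p x := ρ (L.p (ρ.symm x))
  n x := σ * L.n (ρ.symm x) + r (L.p (ρ.symm x)) - r (ρ.symm x)
  loops := L.loops
  p_p x := by simp [L.p_p]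
  p_ne x h := L.p_ne (ρ.symm x) (by
    have := congrArg ρ.symm h; rwa [Equiv.symm_apply_apply] at this)
  n_p x := by simp [L.p_p, L.n_p]; ring

theorem relabel_p (σ : ℤˣ) (ρ : Site N d ≃ Site N d) (r : Site N d → ℤ) (L : Link N d) (x) :
    (L.relabel σ ρ r).p (ρ x) = ρ (L.p x) := by simp [relabel]

theorem relabel_n (σ : ℤˣ) (ρ : Site N d ≃ Site N d) (r : Site N d → ℤ) (L : Link N d) (x) :
    (L.relabel σ ρ r).n (ρ x) = σ * L.n x + r (L.p x) - r x := by simp [relabel]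

theorem ext_of {L L' : Link N d} (ρ : Site N d → Site N d) (hρ : Function.Surjective ρ)
    (h1 : ∀ x, L.p (ρ x) = L'.p (ρ x)) (h2 : ∀ x, L.n (ρ x) = L'.n (ρ x))
    (h3 : L.loops = L'.loops) : L = L' := by
  ext x
  · obtain ⟨y, rfl⟩ := hρ x; exact h1 y
  · obtain ⟨y, rfl⟩ := hρ x; exact h2 y
  · exact h3

theorem closes_relabel (σ : ℤˣ) (ρ : Site N d ≃ Site N d) (r : Site N d → ℤ) (L : Link N d)
    (u v : Site N d) (s : ℤ) :
    (L.relabel σ ρ r).Closes (ρ u) (ρ v) (σ * s + r v - r u) ↔ L.Closes u v s := by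
  simp only [Closes, relabel_p, relabel_n, EmbeddingLike.apply_eq_iff_eq]
  refine and_congr_right fun h => ?_
  rw [h]
  rcases Int.units_eq_one_or σ with rfl | rfl <;> simp

theorem relabel_join (σ : ℤˣ) (ρ : Site N d ≃ Site N d) (r : Site N d → ℤ) (L : Link N d)
    (u v : Site N d) (s : ℤ) (huv : u ≠ v) :
    (L.join u v s huv).relabel σ ρ r =
      (L.relabel σ ρ r).join (ρ u) (ρ v) (σ * s + r v - r u) (ρ.injective.ne huv) := by
  have hn : ∀ x, (L.relabel σ ρ r).n (ρ x) = σ * L.n x + r (L.p x) - r x := relabel_n σ ρ r L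
  have := L.p_p
  refine ext_of ρ ρ.surjective (fun x => ?_) (fun x => ?_) ?_
  · rw [relabel_p]
    simp only [join, relabel_p, EmbeddingLike.apply_eq_iff_eq]
    split_ifs <;> rfl
  · rw [relabel_n]
    simp only [join, relabel_p, hn, EmbeddingLike.apply_eq_iff_eq]
    rcases Int.units_eq_one_or σ with rfl | rfl <;> simp <;> grind
  · simp only [relabel, join, Equiv.symm_apply_apply, EmbeddingLike.apply_eq_iff_eq]
    by_cases h : L.p u = v
    · rcases Int.units_eq_one_or σ with rfl | rfl <;> simp [h]
    · simp [h]

theorem relabel_relabel (σ σ' : ℤˣ) (ρ ρ' : Site N d ≃ Site N d) (r r' : Site N d → ℤ)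
    (L : Link N d) : (L.relabel σ ρ r).relabel σ' ρ' r' =
      L.relabel (σ' * σ) (ρ.trans ρ') (fun x => σ' * r x + r' (ρ x)) := by
  refine ext_of id Function.surjective_id (fun x => ?_) (fun x => ?_) rfl
  · simp [relabel]
  · simp [relabel]; ring

theorem relabel_eq_self (ρ : Site N d ≃ Site N d) (r : Site N d → ℤ) (L : Link N d)
    (h : ∀ x, ρ x = x) (h' : ∀ x, r x = 0) : L.relabel 1 ρ r = L := by
  obtain rfl : ρ = Equiv.refl _ := Equiv.ext h
  refine ext_of id Function.surjective_id (fun x => ?_) (fun x => ?_) rfl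
  · simp [relabel]
  · simp [relabel, h']

theorem relabel_congr {ρ ρ' : Site N d ≃ Site N d} {r r' : Site N d → ℤ} (L : Link N d)
    (h : ∀ x, ρ x = ρ' x) (h' : ∀ x, r (L.p x) - r x = r' (L.p x) - r' x) :
    L.relabel 1 ρ r = L.relabel 1 ρ' r' := by
  obtain rfl : ρ = ρ' := Equiv.ext h
  refine ext_of ρ ρ.surjective (fun x => ?_) (fun x => ?_) rfl
  · rw [relabel_p, relabel_p]
  · rw [relabel_n, relabel_n, add_sub_assoc, h', add_sub_assoc]

theorem relabel_iterate (ρ : Site N d ≃ Site N d) (r : Site N d → ℤ) (L : Link N d) (m : ℕ) :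
    (relabel 1 ρ r)^[m] L = L.relabel 1 (ρ ^ m : Equiv.Perm _)
      (fun x => ∑ k ∈ Finset.range m, r (ρ^[k] x)) := by
  induction m with
  | zero => exact (relabel_eq_self _ _ _ (fun _ => rfl) (fun _ => rfl)).symm
  | succ m ih =>
    rw [Function.iterate_succ_apply', ih, relabel_relabel]
    refine relabel_congr _ (fun x => ?_) (fun x => ?_)
    · rw [pow_succ']; rfl
    · simp only [Finset.sum_range_succ, Units.val_one, one_mul, Equiv.Perm.iterate_eq_pow]

/-- If `u` and `v` are linked, then joining `v` and `w` only moves the ends of the lines. -/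
theorem join_eq_relabel (u v w : Site N d) (s t : ℤ) (huv : u ≠ v) (hvw : v ≠ w) (huw : u ≠ w)
    (L : Link N d) (h : L.Closes u v s) : L.join v w t hvw =
      L.relabel 1 ((Equiv.swap u w).trans (Equiv.swap v w))
        (fun x => if x = u then s else if x = v then t else if x = w then -(s + t) else 0) := by
  have hp := L.p_p; have := L.p_ne; have := L.n_p
  obtain ⟨h1, h2⟩ := h
  have h3 : L.p v = u := by rw [← h1, hp]
  have key : ∀ x, ((Equiv.swap u w).trans (Equiv.swap v w)) x =
    if x = u then v else if x = v then w else if x = w then u else x := by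
    intro x
    simp only [Equiv.trans_apply, Equiv.swap_apply_def]; grind
  refine ext_of _ ((Equiv.swap u w).trans (Equiv.swap v w)).surjective
    (fun x => ?_) (fun x => ?_) ?_
  · rw [relabel_p]; simp only [key, join]; grind
  · rw [relabel_n]; simp only [key, join, Units.val_one, one_mul]; grind
  · simp only [join, relabel]; grind

theorem closes_comm (u v u' v' : Site N d) (s t : ℤ) (huv : u ≠ v) (huv' : u' ≠ v')
    (h1 : u ≠ u') (h2 : u ≠ v') (h3 : v ≠ u') (h4 : v ≠ v') (L : Link N d) :
    ((L.Closes u v s ∧ (L.join u v s huv).Closes u' v' t) ↔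
      (L.Closes u' v' t ∧ (L.join u' v' t huv').Closes u v s)) ∧
    ((L.Closes u v s ∨ (L.join u v s huv).Closes u' v' t) ↔
      (L.Closes u' v' t ∨ (L.join u' v' t huv').Closes u v s)) := by
  have hp := L.p_p; have hne := L.p_ne; have hn := L.n_p
  have e1 := hp u; have e2 := hp v; have e3 := hp u'; have e4 := hp v'
  have g1 := hn u; have g2 := hn v; have g3 := hn u'; have g4 := hn v'
  clear hp hne hn
  simp only [join, Closes];
  constructor <;> grind (splits := 40)

end Link


section LinkModule

variable {X : Type*}

/-- The linear map with `x ↦ w x • f x` for every basis vector `x`. -/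
noncomputable def wop (f : X → X) (w : X → ℂ) : Module.End ℂ (X →₀ ℂ) :=
  Finsupp.linearCombination ℂ fun x => Finsupp.single (f x) (w x)

theorem wop_single (f : X → X) (w : X → ℂ) (x : X) (a : ℂ) :
    wop f w (Finsupp.single x a) = Finsupp.single (f x) (w x * a) := by
  simp [wop, mul_comm]

theorem wop_mul (f g : X → X) (w v : X → ℂ) :
    wop f w * wop g v = wop (f ∘ g) (fun x => w (g x) * v x) := by
  refine Finsupp.lhom_ext fun x a => ?_
  simp only [Module.End.mul_apply, Function.comp_apply, wop_single, mul_assoc]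

theorem wop_congr {f g : X → X} {w v : X → ℂ} (h : ∀ x, f x = g x) (h' : ∀ x, w x = v x) :
    wop f w = wop g v := by
  rw [funext h, funext h']

theorem wop_id {f : X → X} {w : X → ℂ} (h : ∀ x, f x = x) (h' : ∀ x, w x = 1) :
    wop f w = 1 := by
  refine Finsupp.lhom_ext fun x a => ?_
  simp [wop_single, h, h']

theorem wop_smul (c : ℂ) (f : X → X) (w : X → ℂ) : c • wop f w = wop f (fun x => c * w x) := by
  refine Finsupp.lhom_ext fun x a => ?_
  simp only [LinearMap.smul_apply, Finsupp.smul_single, smul_eq_mul, wop_single, mul_assoc]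

theorem wop_pow {f : X → X} (m : ℕ) : wop f 1 ^ m = wop f^[m] 1 := by
  induction m with
  | zero => exact (wop_id (fun _ => rfl) (fun _ => rfl)).symm
  | succ m ih =>
    rw [pow_succ, ih, wop_mul, Function.iterate_succ]
    exact wop_congr (fun _ => rfl) (by simp)

end LinkModule

section Gens
variable {N d : ℕ}

/-- The permutation `i ↦ i - 1` of the left sites. -/
def rotSite : Site N d ≃ Site N d := Equiv.sumCongr (Equiv.subRight 1) (Equiv.refl _)

/-- Multiplication by `Ω` from the left: the left site `i` becomes the left site `i - 1`, where the
left site `1` moves to the copy above. -/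
def rotUp (L : Link N d) : Link N d :=
  L.relabel 1 rotSite (Sum.elim (fun i => if i = 1 then -1 else 0) 0)

/-- Multiplication by `Ω⁻¹` from the left: the left site `i` becomes the left site `i + 1`, where
the left site `N` moves to the copy below. -/
def rotDown (L : Link N d) : Link N d :=
  L.relabel 1 rotSite.symm (Sum.elim (fun i => if i = 0 then 1 else 0) 0)

theorem inl_ne (h : 2 ≤ N) (i : ZMod N) : (.inl i : Site N d) ≠ .inl (i + 1) :=
  fun h' => ne_succ h i (Sum.inl_injective h').symm

/-- Multiplication by the diagram `e_i` from the left: the lines at the left sites `i` and `i + 1`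
are joined, and these sites are linked directly.  (From the site `N` the line goes to the copy of
the site `1` below.) -/
def cup (h : 2 ≤ N) (i : ZMod N) (L : Link N d) : Link N d :=
  L.join (.inl i) (.inl (i + 1)) (if i = 0 then 1 else 0) (inl_ne h i)

/-- Whether a contractible loop arises when `e_i` is multiplied from the left. -/
def Pops (i : ZMod N) (L : Link N d) : Prop :=
  L.Closes (.inl i) (.inl (i + 1)) (if i = 0 then 1 else 0)

instance (i : ZMod N) (L : Link N d) : Decidable (Pops i L) :=
  inferInstanceAs (Decidable (L.Closes _ _ _))

theorem pops_cup (h : 2 ≤ N) (i : ZMod N) (L : Link N d) : Pops i (cup h i L) :=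
  Link.closes_join _ _ _ _ _

theorem cup_of_pops (h : 2 ≤ N) (i : ZMod N) (L : Link N d) (hL : Pops i L) : cup h i L = L :=
  Link.join_of_closes _ _ _ _ _ hL

theorem rotUp_cup (h : 2 ≤ N) (i : ZMod N) (L : Link N d) :
    rotUp (cup h i L) = cup h (i - 1) (rotUp L) := by
  rw [rotUp, cup, Link.relabel_join]
  unfold cup rotUp
  congr 1
  · simp [rotSite]
  · have : i - 1 = 0 ↔ i = 1 := sub_eq_zero
    simp [this]
    split_ifs <;> simp

theorem pops_rotUp (i : ZMod N) (L : Link N d) :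
    Pops (i - 1) (rotUp L) ↔ Pops i L := by
  rw [Pops, Pops, ← Link.closes_relabel 1 rotSite
    (Sum.elim (fun i => if i = 1 then -1 else 0) 0) L]
  have : i - 1 = 0 ↔ i = 1 := sub_eq_zero
  simp only [this, rotUp, rotSite, Equiv.sumCongr_apply, Sum.map_inl, Equiv.subRight_apply,
    add_sub_cancel_right, sub_add_cancel, Sum.elim_inl, add_eq_right, Units.val_one, one_mul]
  split_ifs <;> simp

theorem rotUp_rotDown (L : Link N d) : rotUp (rotDown L) = L := by
  rw [rotUp, rotDown, Link.relabel_relabel]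
  refine Link.relabel_eq_self _ _ _ (fun x => by simp) (fun x => ?_)
  rcases x with x | x <;> simp [rotSite]; split_ifs <;> simp

theorem rotDown_rotUp (L : Link N d) : rotDown (rotUp L) = L := by
  rw [rotUp, rotDown, Link.relabel_relabel]
  refine Link.relabel_eq_self _ _ _ (fun x => by simp) (fun x => ?_)
  rcases x with x | x <;> simp [rotSite, sub_eq_zero]; split_ifs <;> simp

theorem inl_ne_two (h : 3 ≤ N) (i : ZMod N) : (.inl i : Site N d) ≠ .inl (i + 1 + 1) := by
  intro h'
  have h2 := Sum.inl_injective h'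
  have : ((2 : ℕ) : ZMod N) = 0 := by
    push_cast; linear_combination -h2
  rw [ZMod.natCast_eq_zero_iff] at this
  exact absurd (Nat.le_of_dvd (by omega) this) (by omega)

theorem tl_up (h : 3 ≤ N) (i : ZMod N) (L : Link N d) (hL : Pops i L) :
    cup (by omega) i (cup (by omega) (i + 1) L) = L ∧ ¬ Pops (i + 1) L ∧
      ¬ Pops i (cup (by omega) (i + 1) L) :=
  ⟨Link.join_tl _ _ _ _ _ _ _ (inl_ne_two h i) _ hL,
    Link.not_closes_tl _ _ _ _ _ (inl_ne (by omega) _) (inl_ne_two h i) _ hL⟩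

theorem tl_down (h : 3 ≤ N) (i : ZMod N) (L : Link N d) (hL : Pops (i + 1) L) :
    cup (by omega) (i + 1) (cup (by omega) i L) = L ∧ ¬ Pops i L ∧
      ¬ Pops (i + 1) (cup (by omega) i L) := by
  have this := inl_ne_two (d := d) h i
  have hL' := (Link.closes_symm _ _ _ _).mp hL
  unfold Pops cup
  rw [Link.closes_symm (.inl i), Link.closes_symm (.inl (i + 1)) (.inl (i + 1 + 1)),
    Link.join_symm (.inl i), Link.join_symm (.inl (i + 1))]
  exact ⟨Link.join_tl _ _ _ _ _ _ _ this.symm _ hL',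
    Link.not_closes_tl _ _ _ _ _ (inl_ne (by omega) _).symm this.symm _ hL'⟩

theorem cup_comm (h : 2 ≤ N) (i j : ZMod N) (h1 : i ≠ j) (h2 : j ≠ i + 1) (h3 : j ≠ i - 1)
    (L : Link N d) : cup h i (cup h j L) = cup h j (cup h i L) ∧
    ((Pops i L ∧ Pops j (cup h i L)) ↔ (Pops j L ∧ Pops i (cup h j L))) ∧
    ((Pops i L ∨ Pops j (cup h i L)) ↔ (Pops j L ∨ Pops i (cup h j L))) := by
  have a1 : (.inl i : Site N d) ≠ .inl j := fun h => h1 (Sum.inl_injective h)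
  have a2 : (.inl i : Site N d) ≠ .inl (j + 1) := fun h => h3 (by
    rw [Sum.inl_injective h]; ring)
  have a3 : (.inl (i + 1) : Site N d) ≠ .inl j := fun h => h2 (Sum.inl_injective h).symm
  have a4 : (.inl (i + 1) : Site N d) ≠ .inl (j + 1) := fun h =>
    h1 (add_right_cancel (Sum.inl_injective h))
  exact ⟨(Link.join_comm _ _ _ _ _ _ _ _ a1 a2 a3 a4 L).symm,
    Link.closes_comm _ _ _ _ _ _ _ _ a1 a2 a3 a4 L⟩

theorem pops_rotUp_cup (h : 2 ≤ N) (L : Link N d) : Pops (-1) (rotUp (cup h 0 L)) := by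
  rw [← zero_sub, pops_rotUp]; exact pops_cup h 0 L

/-- The permutation of the left sites that fixes `N - 1` and `N` and moves `j` to `j - 1`, for
`2 ≤ j ≤ N - 2`, and `1` to `N - 2`. -/
def stepSite : Site N d ≃ Site N d :=
  ((Equiv.swap (.inl (-1)) (.inl 1)).trans (Equiv.swap (.inl 0) (.inl 1))).trans rotSite

theorem step (h : 3 ≤ N) (L : Link N d) (hL : Pops (-1) L) :
    rotUp (cup (by omega) 0 L) =
      L.relabel 1 stepSite (Sum.elim (fun i => if i = 1 then -1 else 0) 0) ∧ ¬ Pops 0 L := by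
  have h0 := tl_up h (-1) L hL
  have h1 := inl_ne_two (d := d) h (-1)
  have h2 := inl_ne (d := d) (by omega : 2 ≤ N) (-1)
  have h3 := inl_ne (d := d) (by omega : 2 ≤ N) 0
  unfold Pops at hL
  simp only [neg_add_cancel, zero_add] at h1 h2 h3 h0 hL
  have h4 : (-1 : ZMod N) ≠ 0 := fun h => h2 (by rw [h])
  have h5 : (-1 : ZMod N) ≠ 1 := fun h => h1 (by rw [h])
  have h6 : (0 : ZMod N) ≠ 1 := fun h => h3 (by rw [h])
  rw [if_neg h4] at hL
  refine ⟨?_, h0.2.1⟩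
  have := Link.join_eq_relabel (.inl (-1)) (.inl 0) (.inl 1) 0 1 h2 h3 h1 L hL
  have e : cup (by omega) 0 L = L.join (.inl 0) (.inl 1) 1 h3 := by
    simp only [cup, zero_add, if_true]
  rw [e, this, rotUp, Link.relabel_relabel]
  congr 1
  funext x
  simp only [Equiv.trans_apply, Equiv.swap_apply_def, Units.val_one, one_mul]
  rcases x with x | x
  · simp only [Sum.inl.injEq, Sum.elim_inl]
    by_cases a : x = -1
    · subst a; simp [h5, h6, h6.symm]
    by_cases b : x = 0
    · subst b; simp [h4.symm, h6]
    by_cases c : x = 1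
    · subst c; simp [h5, h5.symm, h6.symm, h4]
    · simp [a, b, c]
  · simp

/-- A permutation that counts down cyclically. -/
theorem countdown {X : Type*} (g : X → X) (r : X → ℤ) (M : ℕ) (c : ℕ → X)
    (h1 : ∀ j, 1 ≤ j → j < M → g (c (j + 1)) = c j) (h2 : g (c 1) = c M)
    (h3 : r (c 1) = -1) (h4 : ∀ j, 2 ≤ j → j ≤ M → r (c j) = 0) (j : ℕ) (hj : 1 ≤ j)
    (hj' : j ≤ M) : g^[M] (c j) = c j ∧ ∑ k ∈ Finset.range M, r (g^[k] (c j)) = -1 := by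
  have a : ∀ j, 1 ≤ j → j ≤ M → ∀ k, k < j → g^[k] (c j) = c (j - k) := by
    intro j hj hj' k
    induction k with
    | zero => simp
    | succ k ih =>
      intro hk
      rw [Function.iterate_succ_apply', ih (by omega), show j - k = j - (k + 1) + 1 by omega,
        h1 _ (by omega) (by omega)]
  have b : g^[j] (c j) = c M := by
    obtain ⟨i, rfl⟩ : ∃ i, j = i + 1 := ⟨j - 1, by omega⟩
    rw [Function.iterate_succ_apply', a _ hj hj' i (by omega), Nat.add_sub_cancel_left, h2]
  obtain ⟨m, rfl⟩ : ∃ m, M = m + j := ⟨M - j, by omega⟩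
  constructor
  · rw [Function.iterate_add_apply, b, a _ (by omega) le_rfl _ (by omega), Nat.add_sub_cancel_left]
  · rw [add_comm m j, Finset.sum_range_add, Finset.sum_eq_single (j - 1)]
    · rw [a _ hj hj' _ (by omega), show j - (j - 1) = 1 by omega, h3, add_eq_left]
      refine Finset.sum_eq_zero fun k hk => ?_
      rw [Finset.mem_range] at hk
      rw [add_comm j k, Function.iterate_add_apply, b, a _ (by omega) le_rfl _ (by omega),
        h4 _ (by omega) (by omega)]
    · intro k hk hk'
      rw [Finset.mem_range] at hk
      rw [a _ hj hj' _ (by omega), h4 _ (by omega) (by omega)]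
    · intro h; exact absurd (Finset.mem_range.mpr (by omega)) h

theorem iterate_eq {X : Type*} {P : X → Prop} {f g : X → X} (h : ∀ x, P x → f x = g x)
    (hf : ∀ x, P (f x)) (m : ℕ) (x : X) (hx : P x) : f^[m] x = g^[m] x := by
  induction m generalizing x with
  | zero => rfl
  | succ m ih => rw [Function.iterate_succ_apply, ih _ (hf x), h x hx, Function.iterate_succ_apply]

theorem step_iterate (h : 3 ≤ N) (L : Link N d) (hL : Pops (-1) L) :
    (fun L => rotUp (cup (by omega : 2 ≤ N) 0 L))^[N - 2] L = rotUp^[N] L := by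
  have : NeZero N := ⟨by omega⟩
  have : Fact (1 < N) := ⟨by omega⟩
  rw [iterate_eq (fun L hL => (step h L hL).1) (fun L => pops_rotUp_cup (by omega) L) _ _ hL]
  unfold rotUp
  rw [Link.relabel_iterate, Link.relabel_iterate]
  have c0 : ((N : ℕ) : ZMod N) = 0 := ZMod.natCast_self N
  have c1 : ((N - 1 : ℕ) : ZMod N) = -1 := by rw [Nat.cast_sub (by omega)]; simp
  have c2 : ((N - 2 : ℕ) : ZMod N) = -1 - 1 := by rw [Nat.cast_sub (by omega)]; simp; ring
  have hv : ∀ i : ZMod N, i ≠ 0 → 1 ≤ i.val := fun i hi => Nat.pos_of_ne_zero fun h =>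
    hi ((ZMod.val_eq_zero i).mp h)
  have hc : ∀ a b : ℕ, a < N → b < N → (a : ZMod N) = b → a = b := fun a b ha hb h => by
    have := congrArg ZMod.val h
    rwa [ZMod.val_cast_of_lt ha, ZMod.val_cast_of_lt hb] at this
  have hr1 : ∀ j : ℕ, 2 ≤ j → j ≤ N → (j : ZMod N) ≠ 1 := fun j h1 h2 h3 => by
    rcases Nat.lt_or_ge j N with h4 | h4
    · have := hc j 1 h4 (by omega) (by rw [h3]; simp); omega
    · obtain rfl : j = N := by omega
      rw [c0] at h3; exact zero_ne_one h3
  have rot : ∀ i : ZMod N, rotSite (d := d) (.inl i) = .inl (i - 1) := fun i => rfl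
  have stp : ∀ i : ZMod N, stepSite (d := d) (.inl i) =
      if i = -1 then .inl (-1) else if i = 0 then .inl 0 else if i = 1 then .inl (-1 - 1) else
        .inl (i - 1) := by
    intro i
    have h1 := hc 1 0 (by omega) (by omega)
    have h2 := hc (N - 1) 0 (by omega) (by omega)
    have h3 := hc (N - 1) 1 (by omega) (by omega)
    rw [c1] at h2 h3; push_cast at h1 h2 h3
    simp only [stepSite, Equiv.trans_apply, Equiv.swap_apply_def, Sum.inl.injEq]
    split_ifs <;> simp_all
  have A : ∀ i : ZMod N, rotSite^[N] (.inl i : Site N d) = .inl i ∧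
      ∑ k ∈ Finset.range N, (Sum.elim (fun i => if i = 1 then -1 else 0) 0 : Site N d → ℤ)
        (rotSite^[k] (.inl i)) = -1 := by
    intro i
    obtain ⟨j, h1, h2, rfl⟩ : ∃ j : ℕ, 1 ≤ j ∧ j ≤ N ∧ (j : ZMod N) = i := by
      by_cases hi : i = 0
      · exact ⟨N, by omega, le_rfl, by rw [c0, hi]⟩
      · exact ⟨i.val, hv i hi, i.val_lt.le, ZMod.natCast_zmod_val i⟩
    refine countdown _ _ N (fun j => (.inl (j : ZMod N) : Site N d)) ?_ ?_ ?_ ?_ j h1 h2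
    · intro j _ _; rw [rot]; simp
    · rw [rot, c0]; simp
    · simp
    · intro j h1 h2; simp [hr1 j h1 h2]
  have B : ∀ i : ZMod N, i ≠ -1 → i ≠ 0 → stepSite^[N - 2] (.inl i : Site N d) = .inl i ∧
      ∑ k ∈ Finset.range (N - 2), (Sum.elim (fun i => if i = 1 then -1 else 0) 0 : Site N d → ℤ)
        (stepSite^[k] (.inl i)) = -1 := by
    intro i hi1 hi0
    obtain ⟨j, h1, h2, rfl⟩ : ∃ j : ℕ, 1 ≤ j ∧ j ≤ N - 2 ∧ (j : ZMod N) = i := by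
      refine ⟨i.val, hv i hi0, ?_, ZMod.natCast_zmod_val i⟩
      have h1 := i.val_lt
      have h2 : i.val ≠ N - 1 := fun h => hi1 (by rw [← c1, ← h, ZMod.natCast_zmod_val])
      omega
    refine countdown _ _ (N - 2) (fun j => (.inl (j : ZMod N) : Site N d)) ?_ ?_ ?_ ?_ j h1 h2
    · intro j _ h3
      have h4 : ((j + 1 : ℕ) : ZMod N) ≠ -1 := fun h => by
        rw [← c1] at h; have := hc _ _ (by omega) (by omega) h; omega
      have h5 : ((j + 1 : ℕ) : ZMod N) ≠ 0 := fun h => by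
        have := hc (j + 1) 0 (by omega) (by omega) (by rw [h]; simp); omega
      rw [stp, if_neg h4, if_neg h5, if_neg (hr1 _ (by omega) (by omega))]
      simp
    · have h4 : ((1 : ℕ) : ZMod N) ≠ -1 := fun h => by
        rw [← c1] at h; have := hc _ _ (by omega) (by omega) h; omega
      have h5 : ((1 : ℕ) : ZMod N) ≠ 0 := by simp
      rw [stp, if_neg h4, if_neg h5, if_pos (by simp), c2]
    · simp
    · intro j h1 h2; simp [hr1 j h1 (by omega)]
  have C : ∀ (ρ : Site N d ≃ Site N d) (x : Site N d), ρ x = x → ∀ m, ρ^[m] x = x :=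
    fun ρ x hx m => Function.iterate_fixed hx m
  have D1 : stepSite (d := d) (.inl (-1) : Site N d) = .inl (-1) := by rw [stp, if_pos rfl]
  have D0 : stepSite (d := d) (.inl 0 : Site N d) = .inl 0 := by
    rw [stp, if_pos (rfl : (0 : ZMod N) = 0)]; split_ifs with h
    · rw [← h]
    · rfl
  have Dr : ∀ a, stepSite (.inr a : Site N d) = .inr a := fun a => by
    simp [stepSite, rotSite, Equiv.swap_apply_def]
  have Dr' : ∀ a, rotSite (.inr a : Site N d) = .inr a := fun a => rfl
  obtain ⟨e1, e2⟩ := hL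
  rw [neg_add_cancel] at e1
  have e3 : L.p (.inl 0) = .inl (-1) := by rw [← e1, L.p_p]
  refine Link.relabel_congr _ (fun x => ?_) (fun x => ?_)
  · rw [← Equiv.Perm.iterate_eq_pow, ← Equiv.Perm.iterate_eq_pow]
    rcases x with i | a
    · rw [(A i).1]
      by_cases h1 : i = -1
      · subst h1; exact C _ _ D1 _
      by_cases h0 : i = 0
      · subst h0; exact C _ _ D0 _
      exact (B i h1 h0).1
    · rw [C _ _ (Dr a), C _ _ (Dr' a)]
  · -- the two sums agree away from the sites `N - 1` and `N`, which are linked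
    have E : ∀ x : Site N d, x ≠ .inl (-1) → x ≠ .inl 0 →
        ∑ k ∈ Finset.range (N - 2), (Sum.elim (fun i => if i = 1 then -1 else 0) 0 : Site N d → ℤ)
          (stepSite^[k] x) =
        ∑ k ∈ Finset.range N, (Sum.elim (fun i => if i = 1 then -1 else 0) 0 : Site N d → ℤ)
          (rotSite^[k] x) := by
      rintro (i | a) h1 h2
      · rw [(A i).2, (B i (fun h => h1 (by rw [h])) (fun h => h2 (by rw [h]))).2]
      · simp [C _ _ (Dr a), C _ _ (Dr' a)]
    have n1 : (-1 : ZMod N) ≠ 1 := by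
      have := hr1 (N - 1) (by omega) (by omega); rwa [c1] at this
    by_cases h1 : x = .inl (-1)
    · subst h1
      rw [e1, (A _).2, (A _).2]
      simp [C _ _ D0, C _ _ D1, n1]
    by_cases h0 : x = .inl 0
    · subst h0
      rw [e3, (A _).2, (A _).2]
      simp [C _ _ D0, C _ _ D1, n1]
    rw [E x h1 h0, E (L.p x) (fun h => h0 (by rw [← L.p_p x, h, e1]))
      (fun h => h1 (by rw [← L.p_p x, h, e3]))]

/-- The top-bottom reflection of the left side. -/
def mirrorLink (L : Link N d) : Link N d :=
  L.relabel (-1) (Equiv.sumCongr (Equiv.subLeft 1) (Equiv.refl _)) 0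

theorem mirror_mirror (L : Link N d) : mirrorLink (mirrorLink L) = L := by
  rw [mirrorLink, mirrorLink, Link.relabel_relabel]
  refine Link.relabel_eq_self _ _ _ (fun x => ?_) (fun x => by simp)
  rcases x with x | x <;> simp

theorem mirror_rotDown (L : Link N d) : mirrorLink (rotDown L) = rotUp (mirrorLink L) := by
  unfold mirrorLink rotDown rotUp
  rw [Link.relabel_relabel, Link.relabel_relabel]
  congr 1
  · ext x
    rcases x with x | x <;> simp [rotSite]
  · funext x
    rcases x with x | x <;> simp

theorem pops_mirror (L : Link N d) : Pops 0 (mirrorLink L) ↔ Pops 0 L := by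
  have := Link.closes_relabel (-1) (Equiv.sumCongr (Equiv.subLeft 1) (Equiv.refl _)) 0 L
    (.inl 0) (.inl (0 + 1)) (if (0 : ZMod N) = 0 then 1 else 0)
  rw [Link.closes_symm] at this
  rw [Pops, Pops, ← this]
  simp [mirrorLink]

theorem mirror_cup (h : 2 ≤ N) (L : Link N d) :
    mirrorLink (cup h 0 L) = cup h 0 (mirrorLink L) := by
  unfold mirrorLink cup
  rw [Link.relabel_join, Link.join_symm]
  congr 1 <;> simp

end Gens

section Rels

variable (N d : ℕ) (β : ℂ)

/-- The action of `e_i` on the span of the diagrams: a contractible loop gives a factor `β`. -/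
noncomputable def linkE (h : 2 ≤ N) (i : ZMod N) : Module.End ℂ (Link N d →₀ ℂ) :=
  wop (cup h i) fun L => if Pops i L then β else 1

noncomputable def linkOm : Module.End ℂ (Link N d →₀ ℂ) := wop rotUp 1

noncomputable def linkOmInv : Module.End ℂ (Link N d →₀ ℂ) := wop rotDown 1

theorem link_pow (h : 3 ≤ N) : (linkOm N d * linkE N d β (by omega) 0) ^ (N - 1) =
    linkOm N d ^ N * (linkOm N d * linkE N d β (by omega) 0) := by
  have e : linkOm N d * linkE N d β (by omega) 0 = wop (fun L => rotUp (cup (by omega : 2 ≤ N) 0 L))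
      (fun L => if Pops 0 L then β else 1) := by
    rw [linkOm, linkE, wop_mul]; exact wop_congr (fun _ => rfl) (by simp)
  have it : ∀ m, ∀ L : Link N d, Pops (-1) L → ∀ a,
      (wop (fun L => rotUp (cup (by omega : 2 ≤ N) 0 L)) (fun L => if Pops 0 L then β else 1) ^ m)
        (Finsupp.single L a) = Finsupp.single
          ((fun L => rotUp (cup (by omega : 2 ≤ N) 0 L))^[m] L) a := by
    intro m
    induction m with
    | zero => simp
    | succ m ih =>
      intro L hL a
      rw [pow_succ, Module.End.mul_apply, wop_single, if_neg (step h L hL).2, one_mul,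
        ih _ (pops_rotUp_cup _ _), Function.iterate_succ_apply]
  rw [e, show N - 1 = N - 2 + 1 by omega, pow_succ, linkOm, wop_pow]
  refine Finsupp.lhom_ext fun L a => ?_
  rw [Module.End.mul_apply, Module.End.mul_apply, wop_single, wop_single,
    it _ _ (pops_rotUp_cup _ _), step_iterate h _ (pops_rotUp_cup _ _)]
  simp

theorem link_powInv (h : 3 ≤ N) : (linkOmInv N d * linkE N d β (by omega) 0) ^ (N - 1) =
    linkOmInv N d ^ N * (linkOmInv N d * linkE N d β (by omega) 0) := by
  have h2 : 2 ≤ N := by omega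
  have c0 : (wop mirrorLink 1 * wop mirrorLink 1 : Module.End ℂ (Link N d →₀ ℂ)) = 1 := by
    rw [wop_mul]; exact wop_id mirror_mirror (by simp)
  have c1 : SemiconjBy (wop mirrorLink 1) (linkOmInv N d) (linkOm N d) := by
    rw [SemiconjBy, linkOm, linkOmInv, wop_mul, wop_mul]
    exact wop_congr mirror_rotDown (by simp)
  have c2 : SemiconjBy (wop mirrorLink 1) (linkE N d β h2 0) (linkE N d β h2 0) := by
    rw [SemiconjBy, linkE, wop_mul, wop_mul]
    exact wop_congr (mirror_cup h2) (by simp [pops_mirror])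
  have c3 := (c1.mul_right c2).pow_right (N - 1)
  rw [link_pow N d β h] at c3
  have c4 := (c1.pow_right N).mul_right (c1.mul_right c2)
  have := congrArg (wop mirrorLink 1 * ·) (c3.eq.trans c4.eq.symm)
  simpa only [← mul_assoc, c0, one_mul] using this

theorem link_two : linkOm 2 d ^ 2 * linkE 2 d β le_rfl 1 = linkE 2 d β le_rfl 1 := by
  rw [linkOm, linkE, wop_pow, wop_mul]
  refine wop_congr (fun L => ?_) (by simp)
  generalize hM : cup le_rfl 1 L = M
  have hL : Pops 1 M := by rw [← hM]; exact pops_cup _ _ _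
  obtain ⟨e1, -⟩ := hL
  rw [show (1 : ZMod 2) + 1 = 0 from by decide] at e1
  have e0 : M.p (.inl 0) = .inl 1 := by rw [← e1, M.p_p]
  have e : rotUp^[2] M = M.relabel 1 (Equiv.refl _) (Sum.elim (fun _ => -1) 0) := by
    change rotUp (rotUp M) = _
    unfold rotUp
    rw [Link.relabel_relabel]
    refine Link.relabel_congr _ (fun x => ?_) (fun x => ?_)
    · rcases x with x | x
      · fin_cases x <;> rfl
      · rfl
    · congr 1
      · generalize M.p x = y
        rcases y with y | y
        · fin_cases y <;> rfl
        · rfl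
      · rcases x with y | y
        · fin_cases y <;> rfl
        · rfl
  have z : ∀ i : ZMod 2, i = 0 ∨ i = 1 := by decide
  rw [Function.comp_apply, hM, e, Link.relabel_congr (ρ' := Equiv.refl _) (r' := 0)]
  · exact Link.relabel_eq_self _ _ _ (fun _ => rfl) (fun _ => rfl)
  · intro _; rfl
  · rintro (i | a)
    · rcases z i with rfl | rfl
      · rw [e0]; simp
      · rw [e1]; simp
    · rcases h : M.p (.inr a) with i | b
      · exfalso
        rcases z i with rfl | rfl
        · have := M.p_p (.inr a); rw [h, e0] at this; simp at this
        · have := M.p_p (.inr a); rw [h, e1] at this; simp at this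
      · simp

/-- The left multiplication by diagrams satisfies the relations of the affine Temperley-Lieb
algebra. -/
theorem link_rels : Rels N β (linkE N d β) (linkOm N d) (linkOmInv N d) where
  mul_inv := by rw [linkOm, linkOmInv, wop_mul]; exact wop_id rotUp_rotDown (by simp)
  inv_mul := by rw [linkOm, linkOmInv, wop_mul]; exact wop_id rotDown_rotUp (by simp)
  rot h i := by
    rw [linkOm, linkE, linkE, wop_mul, wop_mul]
    exact wop_congr (rotUp_cup h i) (by simp [pops_rotUp])
  sq h i := by
    rw [linkE, wop_mul, wop_smul]
    exact wop_congr (fun L => cup_of_pops h i _ (pops_cup h i L)) (by simp [pops_cup])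
  up h h3 i := by
    rw [linkE, linkE, wop_mul, wop_mul]
    refine wop_congr (fun L => (tl_up h3 i _ (pops_cup h i L)).1) (fun L => ?_)
    obtain ⟨-, h1, h2⟩ := tl_up h3 i _ (pops_cup h i L)
    simp [h1, h2]
  down h h3 i := by
    obtain ⟨i, rfl⟩ : ∃ j, i = j + 1 := ⟨i - 1, by ring⟩
    rw [add_sub_cancel_right, linkE, linkE, wop_mul, wop_mul]
    refine wop_congr (fun L => (tl_down h3 i _ (pops_cup h _ L)).1) (fun L => ?_)
    obtain ⟨-, h1, h2⟩ := tl_down h3 i _ (pops_cup h _ L)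
    simp [h1, h2]
  comm h _ i j h1 h2 h4 := by
    rw [linkE, linkE, wop_mul, wop_mul]
    refine wop_congr (fun L => (cup_comm h i j h1 h2 h4 L).1) (fun L => ?_)
    obtain ⟨-, h5, h6⟩ := cup_comm h i j h1 h2 h4 L
    by_cases a1 : Pops i L <;> by_cases a2 : Pops j (cup h i L) <;>
      by_cases a3 : Pops j L <;> by_cases a4 : Pops i (cup h j L) <;> simp_all
  pow _ h3 := link_pow N d β h3
  powInv _ h3 := link_powInv N d β h3
  two_left h hN := by subst hN; exact link_two d β
  two_right h hN := by
    subst hN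
    have h2 : linkOm 2 d ^ 2 * linkE 2 d β h 1 = linkE 2 d β h 1 * linkOm 2 d ^ 2 := by
      have rot : ∀ i, linkOm 2 d * linkE 2 d β h i = linkE 2 d β h (i - 1) * linkOm 2 d := by
        intro i
        rw [linkOm, linkE, linkE, wop_mul, wop_mul]
        exact wop_congr (rotUp_cup h i) (by simp [pops_rotUp])
      rw [sq, mul_assoc, rot, ← mul_assoc, rot, mul_assoc]
      congr 2
    rw [← h2]; exact link_two d β

end Rels

/-! ### The cellular modules and their irreducible quotients -/

/-- The span of the diagrams with `N` left and `d` right sites, planar or not. -/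
def LinkSpace (N d : ℕ) (_β : ℂ) : Type := Link N d →₀ ℂ

section CellModules

variable {N d : ℕ} {β : ℂ}

noncomputable instance : AddCommGroup (LinkSpace N d β) :=
  inferInstanceAs (AddCommGroup (Link N d →₀ ℂ))
noncomputable instance : Module ℂ (LinkSpace N d β) := inferInstanceAs (Module ℂ (Link N d →₀ ℂ))

/-- The linear combination of diagrams underlying an element of `LinkSpace N d β`. -/
noncomputable def LinkSpace.vec : LinkSpace N d β ≃ₗ[ℂ] (Link N d →₀ ℂ) := LinearEquiv.refl ℂ _

noncomputable instance : Module (ATL N β) (LinkSpace N d β) :=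
  Module.compHom (Link N d →₀ ℂ) (ATL.lift (link_rels N d β)).toRingHom

theorem LinkSpace.vec_smul (a : ATL N β) (v : LinkSpace N d β) :
    LinkSpace.vec (a • v) = ATL.lift (link_rels N d β) a (LinkSpace.vec v) := rfl

instance : IsScalarTower ℂ (ATL N β) (LinkSpace N d β) :=
  ⟨fun c a v => LinkSpace.vec.injective <| by
    rw [LinkSpace.vec_smul, map_smul, map_smul, LinkSpace.vec_smul, LinearMap.smul_apply]⟩

/-- The diagram `L` as an element of the span of the diagrams. -/
noncomputable def diag (β : ℂ) (L : Link N d) : LinkSpace N d β :=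
  LinkSpace.vec.symm (Finsupp.single L 1)

namespace Link

/-- The position of the copy `(x, m)` on the boundary of the strip.  On the left side, the copies
of the site `i ∈ {1, …, N}` are at the heights `i + N m`, on the right side, the copies of the site
`a ∈ {1, …, d}` are at the heights `a + d m` (heights increase downwards).  The boundary is run
through downwards on the left, then upwards on the right. -/
def position : Site N d × ℤ → ℤ ⊕ₗ ℤᵒᵈ
  | (.inl i, m) => toLex (.inl ((i - 1).val + 1 + N * m))
  | (.inr a, m) => toLex (.inr (OrderDual.toDual (a + 1 + d * m)))

/-- The end of the line that starts at the copy `(x, m)`. -/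
def lineEnd (L : Link N d) : Site N d × ℤ → Site N d × ℤ
  | (x, m) => (L.p x, m + L.n x)

/-- The diagram can be drawn without crossings: no two lines cross in the strip, and if there are
non-contractible loops, no line goes from the left to the right side. -/
def IsPlanar (L : Link N d) : Prop :=
  (∀ x y, ¬ (position x < position y ∧ position y < position (L.lineEnd x) ∧
    position (L.lineEnd x) < position (L.lineEnd y))) ∧
  (L.loops ≠ 0 → ∀ i, (L.p (.inl i)).isLeft)

/-- The diagram is monic: it has `d` through lines, that is, every right site is linked to a left
one. -/
def IsMonic (L : Link N d) : Prop := ∀ a, (L.p (.inr a)).isLeft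

/-- Multiplication by `Ω_d` from the right, for `d ≥ 1`: the right site `a` becomes the right site
`a + 1`, where the right site `d` moves to the copy of the site `1` below. -/
def mulOmega (L : Link N d) : Link N d :=
  L.relabel 1 (Equiv.sumCongr (Equiv.refl _) (finRotate d))
    (Sum.elim 0 fun a => if (a : ℕ) + 1 = d then 1 else 0)

/-- Multiplication by `Ω_0`, the non-contractible loop. -/
def addLoop (L : Link N d) : Link N d := { L with loops := L.loops + 1 }

end Link

/-- The module spanned by the (planar) `(N,d)`-diagrams.  (The generators of the algebra map planar
diagrams to multiples of planar diagrams, so the linear span of the planar diagrams is this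
submodule.) -/
noncomputable def planarSpan (N d : ℕ) (β : ℂ) : Submodule (ATL N β) (LinkSpace N d β) :=
  Submodule.span (ATL N β) {v | ∃ L : Link N d, L.IsPlanar ∧ v = diag β L}

/-- The submodule spanned by the non-monic diagrams, by `v Ω_d - z v` for all diagrams `v` if
`d ≥ 1`, and by `v Ω_0 - (z + z⁻¹) v` if `d = 0`. -/
noncomputable def cellRelations (N d : ℕ) (β : ℂ) (z : ℂˣ) :
    Submodule (ATL N β) (LinkSpace N d β) :=
  Submodule.span (ATL N β) {v | ∃ L : Link N d, L.IsPlanar ∧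
    ((¬ L.IsMonic ∧ v = diag β L) ∨
      (d ≠ 0 ∧ v = diag β L.mulOmega - (z : ℂ) • diag β L) ∨
      (d = 0 ∧ v = diag β L.addLoop - ((z : ℂ) + (z : ℂ)⁻¹) • diag β L))}

/-- The cellular module `C_{N;d,z}`. -/
abbrev Cell (N d : ℕ) (β : ℂ) (z : ℂˣ) : Type :=
  planarSpan N d β ⧸ (cellRelations N d β z).submoduleOf (planarSpan N d β)

/-- The module `I_{N;d,z}`, the quotient of `C_{N;d,z}` by its radical, the intersection of its
maximal submodules. -/
abbrev Irr (N d : ℕ) (β : ℂ) (z : ℂˣ) : Type :=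
  Cell N d β z ⧸ Module.jacobson (ATL N β) (Cell N d β z)

end CellModules

/-! ### Loewy diagrams -/

section Loewy

variable (R : Type*) [Ring R]

/-- The (simple) module `S` is isomorphic to a composition factor of `M`, that is, to a quotient
`W / U` of submodules `U ≤ W` of `M`. -/
def HasCompFactor (M : Type*) [AddCommGroup M] [Module R M] (S : Type*) [AddCommGroup S]
    [Module R S] : Prop :=
  ∃ W U : Submodule R M, U ≤ W ∧ Nonempty ((W ⧸ U.submoduleOf W) ≃ₗ[R] S)

/-- For composition factors `S` and `T` of `M`: any submodule of `M` that contains the composition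
factor `S` also contains the composition factor `T` (so that `T` is not left over in the quotient
by the submodule). -/
def LoewyLE (M : Type*) [AddCommGroup M] [Module R M] (S T : Type*) [AddCommGroup S] [Module R S]
    [AddCommGroup T] [Module R T] : Prop :=
  ∀ U : Submodule R M, HasCompFactor R U S → ¬ HasCompFactor R (M ⧸ U) T

variable {R} {M : Type*} [AddCommGroup M] [Module R M]

/-- The `i`-th factor of a composition series of `M`; these factors are the nodes of the Loewy
diagram of `M`. -/
abbrev seriesFactor (s : CompositionSeries (Submodule R M)) (i : Fin s.length) : Type _ :=
  s i.succ ⧸ (s i.castSucc).submoduleOf (s i.succ)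

/-- The order of the nodes of the Loewy diagram of `M`. -/
def SeriesLE (s : CompositionSeries (Submodule R M)) (i j : Fin s.length) : Prop :=
  LoewyLE R M (seriesFactor s i) (seriesFactor s j)

/-- The arrows of the Loewy diagram of `M`: those relations between nodes that do not follow, by
transitivity, from others. -/
def LoewyArrow (s : CompositionSeries (Submodule R M)) (i j : Fin s.length) : Prop :=
  SeriesLE s i j ∧ IsEmpty (seriesFactor s i ≃ₗ[R] seriesFactor s j) ∧
    ∀ k, SeriesLE s i k → SeriesLE s k j →
      Nonempty (seriesFactor s k ≃ₗ[R] seriesFactor s i) ∨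
        Nonempty (seriesFactor s k ≃ₗ[R] seriesFactor s j)

variable (R M)

/-- The Loewy diagram of `M'` is obtained from that of `M` by flipping all arrows, without changing
the composition factors. -/
def LoewyReciprocal (M' : Type*) [AddCommGroup M'] [Module R M'] : Prop :=
  ∃ (s : CompositionSeries (Submodule R M)) (t : CompositionSeries (Submodule R M'))
    (σ : Fin s.length ≃ Fin t.length),
    s.head = ⊥ ∧ s.last = ⊤ ∧ t.head = ⊥ ∧ t.last = ⊤ ∧
    (∀ i, Nonempty (seriesFactor s i ≃ₗ[R] seriesFactor t (σ i))) ∧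
    ∀ i j, (SeriesLE s i j ↔ SeriesLE t (σ j) (σ i)) ∧ (LoewyArrow s i j ↔ LoewyArrow t (σ j) (σ i))

end Loewy

end AffineTL

open AffineTL

/-! The whole theorem rests on one anti-involution `ATL.sigma`, a ↦ Φ(a)†. It fixes Ω and sends e_i
to e_{-i}; hence it fixes e₀, and e₀, Ω, Ω⁻¹ generate the algebra. A nondegenerate pairing of
finite-dimensional modules M, M' in which a and σ(a) are adjoint identifies M' with (M⋆)∘. The
central fact is that every finite-dimensional simple module is its own dual in this sense
(`isDual_of_isSimple`).

Given this, the rest is formal. The isomorphisms of spin chains are explicit: spin flip, reflection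
of the chain, and transposition of matrices in the spin basis, the last one exchanging z and z⁻¹.
Transposition followed by reflection makes X⁺ and X⁻ with the same d and z dual with respect to σ.
Annihilators then reverse the lattice of submodules and turn W/U into the dual of W/U, which for a
composition factor is W/U itself; so all relations between factors are reversed
(`Duality.loewyReciprocal`). For the cellular modules, the quotient by the radical is semisimple,
hence an orthogonal sum of self-dual simple modules (`isDual_quotient_jacobson`). This needs finite
dimension (`finite_cell`): modulo the relations, every planar diagram reduces to one without loops
whose lines wind at most once.

Self-duality of a simple module V amounts to a nonzero symmetric form for which e₀ and Ω are
self-adjoint, and it is proved by induction from N-2 to N (`TLRel.hasSymmForm`). Write u = Ω and e_j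
= u⁻ʲ e₀ uʲ. For N ≥ 3 the element f = e₁e₂ is idempotent for every β, also for β = 0. The corner
fAf is generated by a translation, its inverse and one further element (`TLRel.corner_generated`),
and these satisfy the relations for N-2 sites (`TLRel.corner`). If e₀ does not act as zero, then fV
is a nonzero irreducible representation of the corner and has a form by induction. Although σ does
not fix f, it does so up to conjugation by u³, and a corrected version of σ is an anti-involution of
the corner fixing its generators. This yields a vector x and a functional ξ with ξ(t x) = ξ(σ(t) x)
for all t (`TLRel.adjoint_of_corner`), and B(t x, w) = ξ(σ(t) w) is the form on V
(`hasSymmForm_of_vector`). The induction starts with e₀ = 0, where u acts as a scalar, and with N =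
2, where words e₀ t e₀ reduce to palindromes. -/

namespace AffineTL

/-! ### The corner at the idempotent e₁e₂: elements, products and generators. -/

section Corner

variable {A : Type*} [Ring A]

/-- The conjugate `u⁻ʲ a uʲ`. -/
def tr (u : Aˣ) (a : A) (j : ℤ) : A := ↑(u ^ (-j)) * a * ↑(u ^ j)

@[simp] theorem tr_zero (u : Aˣ) (a : A) : tr u a 0 = a := by simp [tr]

theorem tr_tr (u : Aˣ) (a : A) (i j : ℤ) : tr u (tr u a i) j = tr u a (i + j) := by
  rw [tr, tr, tr, neg_add_rev, zpow_add, zpow_add]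
  simp only [Units.val_mul, mul_assoc]

theorem tr_mul (u : Aˣ) (a b : A) (j : ℤ) : tr u (a * b) j = tr u a j * tr u b j := by
  simp only [tr, zpow_neg, mul_assoc, Units.mul_inv_cancel_left]

theorem zpow_mul_tr (u : Aˣ) (a : A) (m j : ℤ) :
    (↑(u ^ m) : A) * tr u a j = tr u a (j - m) * ↑(u ^ m) := by
  have h1 : u ^ (-(j - m)) = u ^ m * u ^ (-j) := by rw [← zpow_add, neg_sub, sub_eq_add_neg]
  have h2 : u ^ j = u ^ (j - m) * u ^ m := by rw [← zpow_add, sub_add_cancel]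
  rw [tr, tr, h1, h2]
  simp only [Units.val_mul, mul_assoc]

theorem zpow_mul_tr_mul (u : Aˣ) (a : A) (m j : ℤ) (x : A) :
    (↑(u ^ m) : A) * (tr u a j * x) = tr u a (j - m) * (↑(u ^ m) * x) := by
  rw [← mul_assoc, zpow_mul_tr, mul_assoc]

theorem unit_mul_tr (u : Aˣ) (a : A) (j : ℤ) : (u : A) * tr u a j = tr u a (j - 1) * u := by
  simpa using zpow_mul_tr u a 1 j

theorem inv_mul_tr (u : Aˣ) (a : A) (j : ℤ) :
    (↑u⁻¹ : A) * tr u a j = tr u a (j + 1) * ↑u⁻¹ := by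
  simpa using zpow_mul_tr u a (-1) j

theorem unit_mul_tr_mul (u : Aˣ) (a : A) (j : ℤ) (x : A) :
    (u : A) * (tr u a j * x) = tr u a (j - 1) * (u * x) := by
  rw [← mul_assoc, unit_mul_tr, mul_assoc]

theorem inv_mul_tr_mul (u : Aˣ) (a : A) (j : ℤ) (x : A) :
    (↑u⁻¹ : A) * (tr u a j * x) = tr u a (j + 1) * (↑u⁻¹ * x) := by
  rw [← mul_assoc, inv_mul_tr, mul_assoc]

variable [Algebra ℂ A]

theorem tr_smul (u : Aˣ) (c : ℂ) (a : A) (j : ℤ) : tr u (c • a) j = c • tr u a j := by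
  simp [tr]

/-- Relations between `e = e₀` and the invertible element `u = Ω` that hold in the affine
Temperley-Lieb algebra with `N` sites. -/
structure TLRel (N : ℕ) (β : ℂ) (e : A) (u : Aˣ) : Prop where
  one : N = 1 → e = 0
  per : (↑(u ^ N) : A) * e = e * ↑(u ^ N)
  sq : e * e = β • e
  up : 3 ≤ N → e * tr u e 1 * e = e
  down : 3 ≤ N → e * tr u e (-1) * e = e
  comm : ∀ k : ℕ, 2 ≤ k → k + 2 ≤ N → e * tr u e k = tr u e k * e

namespace TLRel

variable {N : ℕ} {β : ℂ} {e : A} {u : Aˣ} (H : TLRel N β e u)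
include H

theorem tr_add (j : ℤ) : tr u e (j + N) = tr u e j := by
  have : tr u e N = e := by
    rw [tr, mul_assoc, zpow_natCast, ← H.per, zpow_neg, zpow_natCast, Units.inv_mul_cancel_left]
  rw [add_comm, ← tr_tr, this]

theorem tr_add_mul (j k : ℤ) : tr u e (j + N * k) = tr u e j := by
  induction k with
  | zero => simp
  | succ k ih => rw [mul_add, mul_one, ← add_assoc, H.tr_add, ih]
  | pred k ih => rw [← ih, ← H.tr_add]; congr 1; ring

theorem tr_sq (j : ℤ) : tr u e j * tr u e j = β • tr u e j := by
  rw [← tr_mul, H.sq, tr_smul]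

theorem tr_up (h : 3 ≤ N) (j : ℤ) : tr u e j * tr u e (j + 1) * tr u e j = tr u e j := by
  conv_rhs => rw [← H.up h]
  rw [tr_mul, tr_mul, tr_tr, add_comm]

theorem tr_down (h : 3 ≤ N) (j : ℤ) : tr u e (j + 1) * tr u e j * tr u e (j + 1) = tr u e (j + 1) := by
  conv_rhs => rw [← H.down h]
  rw [tr_mul, tr_mul, tr_tr, neg_add_cancel_comm_assoc]

theorem tr_comm (i j : ℤ) (h1 : i + 2 ≤ j) (h2 : j + 2 ≤ i + N) :
    tr u e i * tr u e j = tr u e j * tr u e i := by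
  obtain ⟨k, rfl⟩ := Int.le.dest h1
  have := congrArg (tr u · i) (H.comm (k + 2) (by omega) (by omega))
  simp only [tr_mul, tr_tr] at this
  convert this using 3 <;> push_cast <;> ring

end TLRel

/-- The idempotent `e₁ e₂`. -/
def crF (e : A) (u : Aˣ) : A := tr u e 1 * tr u e 2

/-- The translation `u e₂ = e₁ u` of the corner algebra. -/
def crG (e : A) (u : Aˣ) : A := u * tr u e 2

omit [Algebra ℂ A] in
theorem crG_eq (e : A) (u : Aˣ) : crG e u = tr u e 1 * u := by
  rw [crG, unit_mul_tr]; norm_num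

/-- The inverse `e₁ e₂ e₃ u⁻¹` of the translation of the corner algebra. -/
def crG' (e : A) (u : Aˣ) : A := tr u e 1 * tr u e 2 * tr u e 3 * ↑u⁻¹

/-- The elements `e_j e₁ e₂` of the corner algebra. -/
def crC (e : A) (u : Aˣ) (j : ℤ) : A := tr u e j * (tr u e 1 * tr u e 2)

/-- The element `e₁ e₀ e₂` of the corner algebra. -/
def crD (e : A) (u : Aˣ) : A := tr u e 1 * tr u e 0 * tr u e 2

namespace TLRel

variable {N : ℕ} {β : ℂ} {e : A} {u : Aˣ} (H : TLRel N β e u)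
include H

theorem rel_up (h : 3 ≤ N) (j : ℤ) (x : A) :
    tr u e j * (tr u e (j + 1) * (tr u e j * x)) = tr u e j * x := by
  simp only [← mul_assoc, H.tr_up h]

theorem rel_down (h : 3 ≤ N) (j : ℤ) (x : A) :
    tr u e (j + 1) * (tr u e j * (tr u e (j + 1) * x)) = tr u e (j + 1) * x := by
  simp only [← mul_assoc, H.tr_down h]

theorem rel_comm (i j : ℤ) (h1 : i + 2 ≤ j) (h2 : j + 2 ≤ i + N) (x : A) :
    tr u e i * (tr u e j * x) = tr u e j * (tr u e i * x) := by
  simp only [← mul_assoc, H.tr_comm i j h1 h2]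


/-- Only e₁e₂e₁ = e₁ is needed and nothing is divided by β. This is why e₁e₂ is used rather than a
multiple of a single e_i, which cannot be made idempotent when β = 0. -/
theorem f_f (h : 3 ≤ N) : crF e u * crF e u = crF e u := by
  simp only [crF, mul_assoc]; exact H.rel_up h 1 _

/-- From e₂e₁e₂ = e₂ one gets u e₂ · e₁e₂e₃ u⁻¹ = u e₂e₃ u⁻¹ = e₁e₂. So g is invertible in the
corner, whose unit is f, and plays the role of Ω there. -/
theorem g_g' (h : 3 ≤ N) : crG e u * crG' e u = crF e u := by
  have h1 := H.rel_down h 1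
  norm_num at h1
  simp only [crG, crG', mul_assoc]
  rw [h1, ← mul_assoc, unit_mul_tr, mul_assoc, ← mul_assoc, mul_assoc, ← mul_assoc (u : A),
    unit_mul_tr, mul_assoc]
  norm_num [crF]

theorem g'_g (h : 3 ≤ N) : crG' e u * crG e u = crF e u := by
  have h1 := H.tr_up h 2
  norm_num [mul_assoc] at h1
  simp only [crG, crG', mul_assoc, Units.inv_mul_cancel_left]
  rw [h1, crF]

theorem f_g (h : 3 ≤ N) : crF e u * crG e u = crG e u := by
  rw [crG_eq]; simp only [crF, mul_assoc]; exact H.rel_up h 1 _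

theorem g_f (h : 3 ≤ N) : crG e u * crF e u = crG e u := by
  have h1 := H.tr_down h 1
  norm_num [mul_assoc] at h1
  simp only [crF, crG, mul_assoc, h1]

theorem f_g' (h : 3 ≤ N) : crF e u * crG' e u = crG' e u := by
  simp only [crF, crG', mul_assoc]; exact H.rel_up h 1 _

theorem g'_f (h : 3 ≤ N) : crG' e u * crF e u = crG' e u := by
  rw [← H.g_g' h, ← mul_assoc, H.g'_g h, H.f_g' h]

theorem f_c (h : 3 ≤ N) (j : ℤ) (h1 : 3 ≤ j) (h2 : j + 1 ≤ N) : crF e u * crC e u j = crC e u j := by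
  simp only [crF, crC, mul_assoc]
  rw [← H.rel_comm 1 j (by omega) (by omega)]
  exact H.rel_up h 1 _

theorem c_f (h : 3 ≤ N) (j : ℤ) : crC e u j * crF e u = crC e u j := by
  rw [crC, ← crF, mul_assoc, H.f_f h]

theorem g_c (h : 3 ≤ N) (j : ℤ) (h1 : 3 ≤ j) (h2 : j + 2 ≤ N) :
    crG e u * crC e u (j + 1) = crC e u j * crG e u := by
  have h3 : crG e u * tr u e (j + 1) = tr u e j * crG e u := by
    rw [crG_eq, mul_assoc, unit_mul_tr, ← mul_assoc, ← mul_assoc, add_sub_cancel_right,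
      H.tr_comm 1 j (by omega) (by omega)]
  rw [crC, ← crF, crC, ← crF, mul_assoc, H.f_g h, ← mul_assoc, h3, mul_assoc, H.g_f h]

/-- The elements e_j f with 3 ≤ j ≤ N-1 are only N-3 of the N-2 cyclic generators that the corner
should have. Shifting e₃f once more, across the removed pair of sites, produces the missing one,
e₁e₀e₂. -/
theorem g_c_three (h : 4 ≤ N) : crG e u * crC e u 3 = crD e u * crG e u := by
  rw [crG_eq, crC, crD]
  have h1 := unit_mul_tr u e 1
  have h2 := unit_mul_tr u e 2
  have h3 := unit_mul_tr u e 3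
  norm_num at h1 h2 h3
  calc tr u e 1 * u * (tr u e 3 * (tr u e 1 * tr u e 2))
      = tr u e 1 * (u * tr u e 3) * (tr u e 1 * tr u e 2) := by simp only [mul_assoc]
    _ = tr u e 1 * tr u e 2 * (u * tr u e 1) * tr u e 2 := by rw [h3]; simp only [mul_assoc]
    _ = tr u e 1 * tr u e 2 * e * (u * tr u e 2) := by rw [h1]; simp only [mul_assoc]
    _ = tr u e 1 * (tr u e 2 * tr u e 0) * (tr u e 1 * u) := by rw [h2]; simp only [mul_assoc, tr_zero]
    _ = _ := by rw [← H.tr_comm 0 2 (by omega) (by omega)]; simp only [mul_assoc]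

theorem d_f (h : 3 ≤ N) : crD e u * crF e u = crD e u := by
  have h1 := H.tr_down h 1
  norm_num [mul_assoc] at h1
  simp only [crF, crD, mul_assoc, h1]

theorem d_eq (h : 4 ≤ N) : crD e u = crG e u * crC e u 3 * crG' e u := by
  rw [H.g_c_three h, mul_assoc, H.g_g' (by omega), H.d_f (by omega)]

theorem c_eq (h : 4 ≤ N) : crC e u 3 = crG' e u * crD e u * crG e u := by
  rw [mul_assoc, ← H.g_c_three h, ← mul_assoc, H.g'_g (by omega), H.f_c (by omega) 3 (by omega)
    (by omega)]

theorem c_succ (h : 3 ≤ N) (j : ℤ) (h1 : 3 ≤ j) (h2 : j + 2 ≤ N) :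
    crC e u (j + 1) = crG' e u * crC e u j * crG e u := by
  rw [mul_assoc, ← H.g_c h j h1 h2, ← mul_assoc, H.g'_g h, H.f_c h _ (by omega) (by omega)]

/-- All e_j f are translates of e₃f, so one generator besides the translation and its inverse is
enough. -/
theorem pow_c_pow (h : 4 ≤ N) (k : ℕ) (hk : k + 4 ≤ N) :
    crG' e u ^ k * crC e u 3 * crG e u ^ k = crC e u (3 + k) := by
  induction k with
  | zero => simp
  | succ k ih =>
    rw [pow_succ', pow_succ]
    have := H.c_succ (by omega) (3 + k) (by omega) (by omega)
    rw [← ih (by omega)] at this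
    push_cast
    rw [← add_assoc, this]
    simp only [mul_assoc]

/-! Multiplying the idempotent by a generator. -/

theorem e_mul_f (h : 3 ≤ N) (G : NonUnitalSubalgebra ℂ A) (hg : crG e u ∈ G) (hg' : crG' e u ∈ G)
    (hc : 4 ≤ N → crC e u 3 ∈ G) (m : ℤ) :
    ∃ k : ℤ, ∃ y ∈ G, tr u e m * crF e u = ↑(u ^ k) * y := by
  have hf : crF e u ∈ G := by rw [← H.g_g' h]; exact G.mul_mem hg hg'
  -- One period of indices suffices. Here e₀f = u g', e₁f = β f and e₂f = e₂ = u⁻¹ g, while e_j f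
  -- for j ≥ 3 lies in the corner and is a translate of e₃f.
  have key : ∀ j : ℤ, 0 ≤ j → j < N → ∃ k : ℤ, ∃ y ∈ G, tr u e j * crF e u = ↑(u ^ k) * y := by
    intro j h1 h2
    by_cases j0 : j = 0
    · subst j0
      refine ⟨1, crG' e u, hg', ?_⟩
      rw [zpow_one, crG', crF]
      simp only [mul_assoc, unit_mul_tr_mul, Units.mul_inv, mul_one]
      norm_num
    by_cases j1 : j = 1
    · subst j1
      refine ⟨0, β • crF e u, G.smul_mem β hf, ?_⟩
      rw [crF, ← mul_assoc, H.tr_sq]; simp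
    by_cases j2 : j = 2
    · subst j2
      refine ⟨-1, crG e u, hg, ?_⟩
      have h1 := H.tr_down h 1
      norm_num [mul_assoc] at h1
      rw [crF, h1, crG]; simp
    have : ∀ k : ℕ, k + 4 ≤ N → crC e u (3 + k) ∈ G := by
      intro k hk
      induction k with
      | zero => simpa using hc (by omega)
      | succ k ih =>
        push_cast
        rw [← add_assoc, H.c_succ h _ (by omega) (by omega)]
        exact G.mul_mem (G.mul_mem hg' (ih (by omega))) hg
    obtain ⟨k, rfl⟩ := Int.le.dest (show 3 ≤ j by omega)
    exact ⟨0, _, this k (by omega), by simp [crC, crF]⟩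
  have hN : (0 : ℤ) < N := by omega
  obtain ⟨k, y, hy, h1⟩ := key (m % N) (Int.emod_nonneg _ hN.ne') (Int.emod_lt_of_pos _ hN)
  refine ⟨k, y, hy, ?_⟩
  rw [← h1, ← H.tr_add_mul (m % N) (m / N), Int.emod_add_mul_ediv]

/-- As u^N is a scalar, only m modulo N matters. The residues -1 and -2 are computed directly, f u⁻¹
f = β g' and f u⁻² f = g'², and 0 ≤ m ≤ N-3 is treated by induction on m. -/
theorem f_zpow_f (h : 3 ≤ N) (G : NonUnitalSubalgebra ℂ A) (hg : crG e u ∈ G) (hg' : crG' e u ∈ G)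
    (hc : 4 ≤ N → crC e u 3 ∈ G) (lam : ℂ) (hlam : (↑(u ^ N) : A) = algebraMap ℂ A lam) (m : ℤ) :
    crF e u * ↑(u ^ m) * crF e u ∈ G := by
  have hf : crF e u ∈ G := by rw [← H.g_g' h]; exact G.mul_mem hg hg'
  have hlam' : ∃ mu : ℂ, (↑(u ^ (-(N : ℤ))) : A) = algebraMap ℂ A mu := by
    -- The scalar is the value of a unit, so it vanishes only in the trivial ring; otherwise u^{-N}
    -- is the inverse scalar.
    by_cases h0 : lam = 0
    · have : Subsingleton A := by
        have h1 : (↑(u ^ N) : A) * ↑(u ^ N)⁻¹ = 1 := Units.mul_inv _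
        rw [hlam, h0, map_zero, zero_mul] at h1
        exact subsingleton_of_zero_eq_one h1
      exact ⟨0, Subsingleton.elim _ _⟩
    · refine ⟨lam⁻¹, ?_⟩
      have h1 : (↑(u ^ N) : A) * algebraMap ℂ A lam⁻¹ = 1 := by
        rw [hlam, ← map_mul, mul_inv_cancel₀ h0, map_one]
      rw [zpow_neg, zpow_natCast]
      exact (Units.eq_inv_of_mul_eq_one_left h1).symm
  have hfree : ∀ (m : ℤ) (c : ℂ), crF e u * ↑(u ^ m) * crF e u ∈ G →
      crF e u * (↑(u ^ m) * algebraMap ℂ A c) * crF e u ∈ G := by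
    intro m c h
    rw [← Algebra.commutes, ← Algebra.smul_def, mul_smul_comm, smul_mul_assoc]
    exact G.smul_mem c h
  have hsucc : ∀ m : ℤ, crF e u * ↑(u ^ m) * crF e u ∈ G → crF e u * ↑(u ^ (m + N)) * crF e u ∈ G := by
    intro m hm
    rw [zpow_add, Units.val_mul, zpow_natCast, hlam]
    exact hfree m _ hm
  have hpred : ∀ m : ℤ, crF e u * ↑(u ^ m) * crF e u ∈ G → crF e u * ↑(u ^ (m - N)) * crF e u ∈ G := by
    intro m hm
    obtain ⟨mu, hmu⟩ := hlam'
    rw [sub_eq_add_neg, zpow_add, Units.val_mul, hmu]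
    exact hfree m _ hm
  have hall : ∀ (m k : ℤ), crF e u * ↑(u ^ m) * crF e u ∈ G →
      crF e u * ↑(u ^ (m + N * k)) * crF e u ∈ G := by
    intro m k hm
    induction k with
    | zero => simpa
    | succ k ih => rw [mul_add, mul_one, ← add_assoc]; exact hsucc _ ih
    | pred k ih => rw [mul_sub, mul_one, ← add_sub_assoc]; exact hpred _ ih
  have r3 : ∀ x, tr u e 3 * (tr u e 2 * (tr u e 3 * x)) = tr u e 3 * x := by
    have := H.rel_down h 2; norm_num at this; exact this
  have m1 : crF e u * ↑(u ^ (-1 : ℤ)) * crF e u = β • crG' e u := by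
    have := H.tr_sq 2
    simp only [crF, crG', zpow_neg_one, mul_assoc, inv_mul_tr_mul, inv_mul_tr]
    norm_num
    rw [← mul_assoc (tr u e 2), this, smul_mul_assoc, mul_smul_comm]
  have m2 : crF e u * ↑(u ^ (-2 : ℤ)) * crF e u = crG' e u * crG' e u := by
    have j3 : (↑u⁻¹ : A) * ↑u⁻¹ = ↑(u ^ (-2 : ℤ)) := by
      rw [← Units.val_mul, ← zpow_neg_one, ← zpow_add]; rfl
    simp only [crF, crG', mul_assoc, zpow_mul_tr_mul, inv_mul_tr_mul, zpow_mul_tr, j3]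
    norm_num only
    rw [r3]
  have small : ∀ m : ℕ, m + 3 ≤ N → crF e u * ↑(u ^ (m : ℤ)) * crF e u ∈ G := by
    intro m hm
    induction m with
    | zero => simpa [H.f_f h] using hf
    | succ m ih =>
      -- Moving u^{m+1} to the right past e₁ leaves e_{-m} next to f. For m > 0 this is e_{N-m},
      -- which commutes with e₁ and e₂; for m = 0 the product e₁e₂e₀ = e₁e₀e₂ is the exceptional
      -- element of the corner. Either way a factor from G splits off on the left and f u^m remains.
      have hD : ∀ j : ℤ, j = -m → ∃ y ∈ G, crF e u * tr u e j = y * crF e u := by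
        rintro j rfl
        by_cases m0 : m = 0
        · subst m0
          refine ⟨crD e u, ?_, ?_⟩
          · rw [H.d_eq (by omega)]; exact G.mul_mem (G.mul_mem hg (hc (by omega))) hg'
          · rw [H.d_f h, crD, crF]; simp only [mul_assoc]
            rw [H.tr_comm 0 2 (by omega) (by omega)]; simp
        · refine ⟨crC e u (-m + N * 1), ?_, ?_⟩
          · have := H.pow_c_pow (by omega) (N - 3 - m) (by omega)
            rw [show (-m + N * 1 : ℤ) = 3 + ((N - 3 - m : ℕ) : ℤ) by omega, ← this]
            have hpg : ∀ k y, y ∈ G → crG' e u ^ k * y * crG e u ^ k ∈ G := by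
              intro k y hy
              induction k with
              | zero => simpa
              | succ k ih =>
                rw [pow_succ', pow_succ, show crG' e u * crG' e u ^ k * y * (crG e u ^ k * crG e u) =
                  crG' e u * (crG' e u ^ k * y * crG e u ^ k) * crG e u by simp only [mul_assoc]]
                exact G.mul_mem (G.mul_mem hg' ih) hg
            exact hpg _ _ (hc (by omega))
          · rw [H.c_f h, ← H.tr_add_mul (-m) 1, crC, crF, mul_assoc,
              H.tr_comm 2 _ (by omega) (by omega), ← mul_assoc, H.tr_comm 1 _ (by omega) (by omega),
              mul_assoc]
      have e1 := zpow_mul_tr u e ((m + 1 : ℕ) : ℤ) 1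
      obtain ⟨y, hy, h1⟩ := hD (1 - (m + 1 : ℕ)) (by push_cast; ring)
      have : crF e u * ↑(u ^ ((m + 1 : ℕ) : ℤ)) * crF e u =
          y * (crF e u * ↑(u ^ (m : ℤ)) * crF e u) * crG e u := by
        have h2 : (↑(u ^ ((m + 1 : ℕ) : ℤ)) : A) = ↑(u ^ (m : ℤ)) * u := by
          rw [← Units.val_mul, ← zpow_add_one]; push_cast; rfl
        calc crF e u * ↑(u ^ ((m + 1 : ℕ) : ℤ)) * crF e u
            = crF e u * (↑(u ^ ((m + 1 : ℕ) : ℤ)) * tr u e 1) * tr u e 2 := by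
              simp only [mul_assoc]; rfl
          _ = y * crF e u * ↑(u ^ ((m + 1 : ℕ) : ℤ)) * tr u e 2 := by
              rw [e1, ← mul_assoc, h1]
          _ = y * (crF e u * ↑(u ^ (m : ℤ))) * (u * tr u e 2) := by
              rw [h2]; simp only [mul_assoc]
          _ = _ := by rw [← crG, ← H.f_g h]; simp only [mul_assoc]; rw [← mul_assoc (crF e u) (crF e u), H.f_f h]
      rw [this]
      exact G.mul_mem (G.mul_mem hy (ih (by omega))) hg
  have hN : (0 : ℤ) < N := by omega
  have h0 := Int.emod_nonneg m hN.ne'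
  have h1 := Int.emod_lt_of_pos m hN
  rw [← Int.emod_add_mul_ediv m N]
  refine hall _ _ ?_
  by_cases c1 : m % N = N - 1
  · rw [c1, show (N - 1 : ℤ) = -1 + N by ring]
    exact hsucc _ (by rw [m1]; exact G.smul_mem β hg')
  by_cases c2 : m % N = N - 2
  · rw [c2, show (N - 2 : ℤ) = -2 + N by ring]
    exact hsucc _ (by rw [m2]; exact G.mul_mem hg' hg')
  obtain ⟨k, hk⟩ := Int.eq_ofNat_of_zero_le h0
  rw [hk]
  exact small k (by omega)

/-- The corner algebra is generated by `crG`, `crG'` and `crC 3`. -/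
theorem corner_generated (h : 3 ≤ N) (G : NonUnitalSubalgebra ℂ A) (hg : crG e u ∈ G)
    (hg' : crG' e u ∈ G) (hc : 4 ≤ N → crC e u 3 ∈ G) (hfG : ∀ y ∈ G, crF e u * y = y) (lam : ℂ)
    (hlam : (↑(u ^ N) : A) = algebraMap ℂ A lam) {a : A}
    (ha : a ∈ Algebra.adjoin ℂ {e, (u : A), (↑u⁻¹ : A)}) : crF e u * a * crF e u ∈ G := by
  have hf : crF e u ∈ G := by rw [← H.g_g' h]; exact G.mul_mem hg hg'
  -- The span of all u^k y with y ∈ G contains f and is stable under left multiplication by the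
  -- generators, hence contains a f. Multiplying by f from the left then leads back to G by
  -- `f_zpow_f`.
  let M : Submodule ℂ A := Submodule.span ℂ {x | ∃ k : ℤ, ∃ y ∈ G, x = ↑(u ^ k) * y}
  have hM : ∀ a ∈ Algebra.adjoin ℂ {e, (u : A), (↑u⁻¹ : A)}, ∀ x ∈ M, a * x ∈ M := by
    intro a ha
    induction ha using Algebra.adjoin_induction with
    | algebraMap c => intro x hx; rw [← Algebra.smul_def]; exact M.smul_mem c hx
    | add a b _ _ h1 h2 => intro x hx; rw [add_mul]; exact M.add_mem (h1 x hx) (h2 x hx)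
    | mul a b _ _ h1 h2 => intro x hx; rw [mul_assoc]; exact h1 _ (h2 x hx)
    | mem a ha =>
      intro x hx
      induction hx using Submodule.span_induction with
      | zero => simp
      | add x y _ _ h1 h2 => rw [mul_add]; exact M.add_mem h1 h2
      | smul c x _ h1 => rw [mul_smul_comm]; exact M.smul_mem c h1
      | mem x hx =>
        obtain ⟨k, y, hy, rfl⟩ := hx
        rcases ha with rfl | rfl | rfl
        · obtain ⟨l, y', hy', h1⟩ := H.e_mul_f h G hg hg' hc k
          have h2 := zpow_mul_tr u a k k
          rw [sub_self, tr_zero] at h2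
          rw [← mul_assoc, ← h2, mul_assoc, ← hfG y hy, ← mul_assoc (tr u a k), h1, ← mul_assoc,
            ← mul_assoc, ← Units.val_mul, ← zpow_add, mul_assoc]
          exact Submodule.subset_span ⟨_, _, G.mul_mem hy' hy, rfl⟩
        · rw [← mul_assoc, ← Units.val_mul, ← zpow_one_add]
          exact Submodule.subset_span ⟨_, _, hy, rfl⟩
        · rw [← mul_assoc, ← Units.val_mul, ← zpow_neg_one, ← zpow_add]
          exact Submodule.subset_span ⟨_, _, hy, rfl⟩
  have h1 : a * crF e u ∈ M := hM a ha _ (Submodule.subset_span ⟨0, _, hf, by simp⟩)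
  rw [mul_assoc]
  generalize a * crF e u = x at h1
  induction h1 using Submodule.span_induction with
  | zero => simp
  | add x y _ _ h1 h2 => rw [mul_add]; exact G.add_mem h1 h2
  | smul c x _ h1 => rw [mul_smul_comm]; exact G.smul_mem c h1
  | mem x hx =>
    obtain ⟨k, y, hy, rfl⟩ := hx
    rw [← hfG y hy, ← mul_assoc, ← mul_assoc]
    exact G.mul_mem (H.f_zpow_f h G hg hg' hc lam hlam k) hy

end TLRel

end Corner

end AffineTL

namespace AffineTL

/-! ### The corner as a quotient with N-2 sites, and the anti-involution it inherits. -/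

section Corner

variable {A : Type*} [Ring A] [Algebra ℂ A]

/-- The generator `e₃ e₁ e₂` of the corner algebra (there is none for `N = 3`). -/
noncomputable def cornerE (N : ℕ) (e : A) (u : Aˣ) : A := if 4 ≤ N then crC e u 3 else 0

omit [Algebra ℂ A] in
theorem tr_prod {A' : Type*} [Ring A'] (e : A) (u : Aˣ) (e' : A') (u' : A'ˣ) (j : ℤ) :
    tr (MulEquiv.prodUnits.symm (u, u')) (e, e') j = (tr u e j, tr u' e' j) := by
  simp only [tr, ← map_zpow]
  rfl

namespace TLRel

variable {N : ℕ} {β : ℂ} {e : A} {u : Aˣ} (H : TLRel N β e u)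
include H

/-- This closes the cycle: after e₁e₀e₂ the translation continues with e_{N-1}f, so that the N-2
elements are permuted cyclically. -/
theorem g_d (h : 4 ≤ N) : crG e u * crD e u = crC e u (N - 1) * crG e u := by
  have h1 : tr u e (N - 1) = tr u e (-1) := by
    rw [show (N - 1 : ℤ) = -1 + N by ring, H.tr_add]
  rw [crC, ← crF, h1, mul_assoc, H.f_g (by omega), crG_eq, crD]
  simp only [mul_assoc, unit_mul_tr, unit_mul_tr_mul]
  norm_num only
  have a0 := H.rel_down (by omega) 0
  norm_num only at a0
  rw [H.rel_comm (-1) 1 (by omega) (by omega), a0]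

theorem c_up (h : 5 ≤ N) : crC e u 3 * crC e u 4 * crC e u 3 = crC e u 3 := by
  have h1 : crC e u 3 * crC e u 4 = tr u e 3 * crC e u 4 := by
    rw [crC, ← crF, mul_assoc, H.f_c (by omega) 4 (by omega) (by omega)]
  have h2 : crC e u 4 * crC e u 3 = tr u e 4 * crC e u 3 := by
    rw [crC, ← crF, mul_assoc, H.f_c (by omega) 3 (by omega) (by omega)]
  have := H.tr_up (by omega) 3
  norm_num only at this
  rw [h1, mul_assoc, h2, crC, ← mul_assoc, ← mul_assoc, this]

theorem c_down (h : 5 ≤ N) : crC e u 3 * crD e u * crC e u 3 = crC e u 3 := by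
  have a1 := H.rel_up (by omega) 1
  have a3 := H.rel_down (by omega) 2
  have a0 := H.rel_down (by omega) 0
  norm_num only at a1 a3 a0
  have c01 := H.rel_comm 0 2 (by omega) (by omega)
  have c13 := H.rel_comm 1 3 (by omega) (by omega)
  have c03 := H.rel_comm 0 3 (by omega) (by omega)
  simp only [crC, crD, mul_assoc]
  rw [a1, c01, ← c13, c03, a3, c13, a0]

/-- The generators of the corner algebra satisfy the relations for `N - 2` sites. -/
theorem corner (h : 3 ≤ N) {A' : Type*} [Ring A'] [Algebra ℂ A'] (ρ : A →ₗ[ℂ] A')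
    (hm : ∀ x y, x * crF e u = x → ρ (x * y) = ρ x * ρ y) (w : A'ˣ)
    (hw : (w : A') = ρ (crG e u)) (hw' : (↑w⁻¹ : A') = ρ (crG' e u)) :
    TLRel (N - 2) β (ρ (cornerE N e u)) w := by
  by_cases h4 : 4 ≤ N
  swap
  -- For N = 3 the corner has a single site, where `TLRel` requires the generator to be zero.
  · simp only [cornerE, h4, if_false, map_zero]
    constructor <;> simp [tr]
  simp only [cornerE, h4, if_true]
  have hc : ∀ j, crC e u j * crF e u = crC e u j := H.c_f h
  have htr : ∀ (x : A) (j : ℤ), tr w (tr w (ρ x) j) 1 = ↑w⁻¹ * tr w (ρ x) j * w := by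
    intro x j; simp [tr]
  -- Conjugation by w runs forwards through e₃f, e₄f, …, e_{N-1}f; one step backwards from e₃f gives
  -- e₁e₀e₂. All relations for N-2 sites are thus reduced to products of these explicit elements.
  have hk : ∀ k : ℕ, k + 4 ≤ N → tr w (ρ (crC e u 3)) k = ρ (crC e u (3 + k)) := by
    intro k hk
    induction k with
    | zero => simp
    | succ k ih =>
      push_cast
      rw [← tr_tr, htr, ih (by omega), ← add_assoc,
        H.c_succ h _ (by omega) (by omega), hw, hw', mul_assoc, mul_assoc,
        hm _ _ (H.g'_f h), hm _ _ (hc _)]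
  have hd : tr w (ρ (crC e u 3)) (-1) = ρ (crD e u) := by
    rw [H.d_eq h4, mul_assoc, hm _ _ (H.g_f h), hm _ _ (hc _), ← hw, ← hw']
    simp [tr, mul_assoc]
  have hd' : ρ (crD e u) = ↑w⁻¹ * ρ (crC e u (N - 1)) * w := by
    have := congrArg ρ (H.g_d h4)
    rw [hm _ _ (H.g_f h), hm _ _ (hc _), ← hw] at this
    rw [mul_assoc, ← this, Units.inv_mul_cancel_left]
  refine ⟨?_, ?_, ?_, ?_, ?_, ?_⟩
  · omega
  -- The element e₁e₀e₂ is reached by N-3 steps forwards and by one step backwards, so the period is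
  -- N-2.
  · have : tr w (ρ (crC e u 3)) (N - 2 : ℕ) = ρ (crC e u 3) := by
      have e1 : tr w (ρ (crC e u 3)) (N - 3 : ℕ) = tr w (ρ (crC e u 3)) (-1) := by
        rw [hd, hd', show ((N - 3 : ℕ) : ℤ) = (N - 4 : ℕ) + 1 by omega, ← tr_tr, htr,
          hk _ (by omega), show (3 + (N - 4 : ℕ) : ℤ) = N - 1 by omega]
      rw [show ((N - 2 : ℕ) : ℤ) = (N - 3 : ℕ) + 1 by omega, ← tr_tr, e1, tr_tr]
      simp
    rw [tr, zpow_neg, zpow_natCast, mul_assoc] at this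
    conv_lhs => rw [← this]
    rw [Units.mul_inv_cancel_left]
  · rw [← hm _ _ (hc _), ← map_smul, crC, ← crF]
    congr 1
    have := H.f_c h 3 (by omega) (by omega)
    rw [crC, ← crF] at this
    rw [mul_assoc, this, ← mul_assoc, H.tr_sq, smul_mul_assoc]
  · intro h5
    have := hk 1 (by omega)
    push_cast at this
    rw [this, ← hm _ _ (hc _), ← hm _ _ (by rw [mul_assoc, hc])]
    rw [H.c_up (by omega)]
  · intro h5
    rw [hd, ← hm _ _ (hc _), ← hm _ _ (by rw [mul_assoc, H.d_f h]), H.c_down (by omega)]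
  · intro k hk2 hk3
    rw [hk k (by omega), ← hm _ _ (hc _), ← hm _ _ (hc _)]
    congr 1
    have e1 : ∀ i j : ℤ, 3 ≤ j → j + 1 ≤ N → crC e u i * crC e u j = tr u e i * crC e u j := by
      intro i j h1 h2
      rw [crC, ← crF, mul_assoc, H.f_c h j h1 h2]
    rw [e1 _ _ (by omega) (by omega), e1 _ _ (by omega) (by omega), crC, crC, ← mul_assoc,
      H.tr_comm 3 (3 + k) (by omega) (by omega), mul_assoc]

-- In the opposite algebra the conjugate with index j becomes the one with index -j. The relations
-- `up` and `down` are therefore exchanged, and the others are symmetric under reversal.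
open MulOpposite in
theorem opposite : TLRel N β (op e) (Units.opEquiv.symm (op u)) := by
  have e1 : ∀ j, tr (Units.opEquiv.symm (MulOpposite.op u)) (MulOpposite.op e) j =
      MulOpposite.op (tr u e (-j)) := by
    intro j
    have e2 : ∀ k : ℤ, (↑(Units.opEquiv.symm (MulOpposite.op u) ^ k) : Aᵐᵒᵖ) =
        MulOpposite.op ↑(u ^ k) := by
      intro k; rw [← map_zpow, ← MulOpposite.op_zpow]; rfl
    simp only [tr, neg_neg, e2, ← MulOpposite.op_mul, mul_assoc]
  constructor
  · intro h; rw [H.one h]; rfl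
  · apply MulOpposite.unop_injective
    simpa [← map_pow, ← MulOpposite.op_pow] using H.per.symm
  · rw [← MulOpposite.op_mul, H.sq]; rfl
  · intro h; rw [e1, ← MulOpposite.op_mul, ← MulOpposite.op_mul, ← mul_assoc, H.down h]
  · intro h; rw [e1, ← MulOpposite.op_mul, ← MulOpposite.op_mul, ← mul_assoc, neg_neg, H.up h]
  · intro k h2 h3
    rw [e1, ← MulOpposite.op_mul, ← MulOpposite.op_mul]
    have := H.tr_comm (-k) 0 (by omega) (by omega)
    rw [tr_zero] at this
    rw [this]

theorem prod {A' : Type*} [Ring A'] [Algebra ℂ A'] {e' : A'} {u' : A'ˣ}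
    (H' : TLRel N β e' u') : TLRel N β (e, e') (MulEquiv.prodUnits.symm (u, u')) := by
  have e1 := tr_prod e u e' u'
  constructor
  · intro h; rw [H.one h, H'.one h]; rfl
  · rw [← map_pow]; exact Prod.ext H.per H'.per
  · exact Prod.ext H.sq H'.sq
  · intro h; rw [e1]; exact Prod.ext (H.up h) (H'.up h)
  · intro h; rw [e1]; exact Prod.ext (H.down h) (H'.down h)
  · intro k h2 h3; rw [e1]; exact Prod.ext (H.comm k h2 h3) (H'.comm k h2 h3)

end TLRel

/-- Let `σ` be an anti-involution that fixes the generators.  A form on a representation of the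
corner algebra that is invariant under the corresponding anti-involution of the corner algebra is
invariant under `σ`, up to a shift. -/
theorem TLRel.adjoint_of_corner {N : ℕ} {β : ℂ} {e : A} {u : Aˣ} (H : TLRel N β e u) (h : 3 ≤ N)
    (σ : A →ₗ[ℂ] A) (σm : ∀ a b, σ (a * b) = σ b * σ a) (σe : σ e = e) (σu : σ u = u)
    (σu' : σ ↑u⁻¹ = ↑u⁻¹) (lam : ℂ) (hlam : (↑(u ^ N) : A) = algebraMap ℂ A lam)
    {V : Type*} [AddCommGroup V] [Module ℂ V] (ρ : A →ₗ[ℂ] Module.End ℂ V)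
    (h1 : ρ (crF e u) = 1) (hm : ∀ x y, x * crF e u = x → ρ (x * y) = ρ x * ρ y)
    (B : V →ₗ[ℂ] V →ₗ[ℂ] ℂ) (Be : ∀ v w, B (ρ (cornerE N e u) v) w = B v (ρ (cornerE N e u) w))
    (Bg : ∀ v w, B (ρ (crG e u) v) w = B v (ρ (crG e u) w))
    {a : A} (ha : a ∈ Algebra.adjoin ℂ {e, (u : A), (↑u⁻¹ : A)}) (v w : V) :
    B (ρ (crG' e u * ↑(u ^ (-3 : ℤ)) * a * crF e u) v) w =
      B v (ρ (crG' e u * ↑(u ^ (-3 : ℤ)) * σ a * crF e u) w) := by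
  have σpow : ∀ k : ℕ, σ ↑(u ^ k) = ↑(u ^ k) ∧ σ ↑(u⁻¹ ^ k) = ↑(u⁻¹ ^ k) := by
    intro k
    induction k with
    | zero =>
      have : σ 1 = 1 := by
        rw [← Units.mul_inv u, σm, σu, σu']; simp
      simp [this]
    | succ k ih =>
      constructor
      · rw [pow_succ, Units.val_mul, σm, ih.1, σu, ← Units.val_mul, ← Units.val_mul, ← pow_succ', pow_succ]
      · rw [pow_succ, Units.val_mul, σm, ih.2, σu', ← Units.val_mul, ← Units.val_mul, ← pow_succ', pow_succ]
  have σz : ∀ k : ℤ, σ ↑(u ^ k) = ↑(u ^ k) := by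
    intro k
    obtain ⟨n, rfl | rfl⟩ := k.eq_nat_or_neg
    · exact_mod_cast (σpow n).1
    · rw [zpow_neg, ← inv_zpow]; exact_mod_cast (σpow n).2
  have σtr : ∀ j, σ (tr u e j) = tr u e (-j) := by
    intro j
    rw [tr, tr, σm, σm, σz, σz, σe, neg_neg, mul_assoc]
  let f := crF e u
  let g := crG e u
  let g' := crG' e u
  -- Since σ(f) = e_{-2}e_{-1}, conjugation by u³ brings it back to f, and y ↦ u⁻³ σ(y) u³ reverses
  -- products in the corner. It fixes g and g' but sends e₃f to e₁e₀e₂. As g' (e₁e₀e₂) g = e₃f,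
  -- conjugating by g gives a map τ that fixes all generators of the corner.
  let τ : A → A := fun y => g' * ↑(u ^ (-3 : ℤ)) * σ y * ↑(u ^ (3 : ℤ)) * g
  have zz : ∀ x : A, (↑(u ^ (-3 : ℤ)) : A) * (↑(u ^ (3 : ℤ)) * x) = x := by
    intro x; rw [← mul_assoc, ← Units.val_mul, ← zpow_add]; simp
  have zz' : ∀ x : A, (↑(u ^ (3 : ℤ)) : A) * (↑(u ^ (-3 : ℤ)) * x) = x := by
    intro x; rw [← mul_assoc, ← Units.val_mul, ← zpow_add]; simp
  have σf : σ f * ↑(u ^ (3 : ℤ)) = ↑(u ^ (3 : ℤ)) * f := by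
    simp only [f, crF, σm, σtr, zpow_mul_tr_mul, zpow_mul_tr, mul_assoc]
    norm_num only
  have σf' : (↑(u ^ (-3 : ℤ)) : A) * σ f = f * ↑(u ^ (-3 : ℤ)) := by
    simp only [f, crF, σm, σtr, zpow_mul_tr_mul, zpow_mul_tr, mul_assoc]
    norm_num only
  have σg : τ g = g := by
    have : (↑(u ^ (-3 : ℤ)) : A) * σ g * ↑(u ^ (3 : ℤ)) = g := by
      simp only [g]
      have e3 : (↑(u ^ (-3 : ℤ)) : A) * (u * ↑(u ^ (3 : ℤ))) = u := by
        rw [← Units.val_mul, ← Units.val_mul, ← zpow_one_add, ← zpow_add]; simp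
      rw [crG, σm, σtr, σu, ← mul_assoc, zpow_mul_tr, mul_assoc, mul_assoc, e3, ← crG, crG_eq]
      norm_num
    have e1 : τ g = g' * (↑(u ^ (-3 : ℤ)) * σ g * ↑(u ^ (3 : ℤ))) * g := by
      simp only [τ, mul_assoc]
    rw [e1, this, H.g'_g h, H.f_g h]
  have σg' : (↑(u ^ (-3 : ℤ)) : A) * σ g' * ↑(u ^ (3 : ℤ)) = g' := by
    have e1 : σ g' = ↑u⁻¹ * (tr u e (-3) * (tr u e (-2) * tr u e (-1))) := by
      simp only [g', crG', σm, σtr, σu']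
    have e2 : (↑(u ^ (-3 : ℤ)) : A) * ↑u⁻¹ = ↑u⁻¹ * ↑(u ^ (-3 : ℤ)) := by
      rw [← Units.val_mul, ← Units.val_mul, ← zpow_neg_one, ← zpow_add, ← zpow_add, add_comm]
    have e3 : (↑(u ^ (-3 : ℤ)) : A) * ↑(u ^ (3 : ℤ)) = 1 := by
      rw [← Units.val_mul, ← zpow_add]; simp
    rw [e1, ← mul_assoc, e2]
    simp only [mul_assoc, zpow_mul_tr_mul, inv_mul_tr_mul, zpow_mul_tr, e3, g', crG', mul_one]
    norm_num
  have τg' : τ g' = g' := by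
    have e1 : τ g' = g' * (↑(u ^ (-3 : ℤ)) * σ g' * ↑(u ^ (3 : ℤ))) * g := by
      simp only [τ, mul_assoc]
    rw [e1, σg', mul_assoc, H.g'_g h, H.g'_f h]
  have τc : τ (cornerE N e u) = cornerE N e u := by
    by_cases h4 : 4 ≤ N
    · have e1 : (↑(u ^ (-3 : ℤ)) : A) * σ (crC e u 3) * ↑(u ^ (3 : ℤ)) = crD e u := by
        have e3 : (↑(u ^ (-3 : ℤ)) : A) * ↑(u ^ (3 : ℤ)) = 1 := by
          rw [← Units.val_mul, ← zpow_add]; simp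
        simp only [crC, crD, σm, σtr, mul_assoc, zpow_mul_tr_mul, e3, mul_one]
        norm_num only
        rw [H.tr_comm 0 2 (by omega) (by omega)]
      simp only [cornerE, h4, if_true]
      have e2 : τ (crC e u 3) = g' * (↑(u ^ (-3 : ℤ)) * σ (crC e u 3) * ↑(u ^ (3 : ℤ))) * g := by
        simp only [τ, mul_assoc]
      rw [e2, e1, ← H.c_eq h4]
    · simp [cornerE, h4, τ]
  have τm : ∀ x y, f * y = y → τ (x * y) = τ y * τ x := by
    intro x y hy
    simp only [τ, σm, mul_assoc]
    rw [← mul_assoc g g', H.g_g' h, ← mul_assoc (crF e u) (↑(u ^ (-3 : ℤ)) : A), ← σf']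
    simp only [mul_assoc]
    rw [zz', ← mul_assoc (σ y) (σ f), ← σm, hy]
  have τf : ∀ x, τ x * f = τ x := by
    intro x
    simp only [τ, mul_assoc]; rw [H.g_f h]
  -- The corner elements y for which τ(y) is the adjoint of y form a subalgebra. It contains the
  -- generators, so `corner_generated` makes it the whole corner.
  let G : NonUnitalSubalgebra ℂ A :=
    { carrier := {y | f * y = y ∧ y * f = y ∧ ∀ v w, B (ρ y v) w = B v (ρ (τ y) w)}
      add_mem' := by
        rintro x y ⟨a1, a2, a3⟩ ⟨b1, b2, b3⟩
        refine ⟨by rw [mul_add, a1, b1], by rw [add_mul, a2, b2], fun v w => ?_⟩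
        have : τ (x + y) = τ x + τ y := by simp only [τ, map_add, mul_add, add_mul]
        simp [this, a3, b3]
      zero_mem' := ⟨by simp, by simp, by simp [τ]⟩
      mul_mem' := by
        rintro x y ⟨a1, a2, a3⟩ ⟨b1, b2, b3⟩
        refine ⟨by rw [← mul_assoc, a1], by rw [mul_assoc, b2], fun v w => ?_⟩
        rw [τm x y b1, hm x y a2, hm _ _ (τf _), Module.End.mul_apply, Module.End.mul_apply, a3, b3]
      smul_mem' := by
        rintro c x ⟨a1, a2, a3⟩
        refine ⟨by rw [mul_smul_comm, a1], by rw [smul_mul_assoc, a2], fun v w => ?_⟩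
        have : τ (c • x) = c • τ x := by simp only [τ, map_smul, mul_smul_comm, smul_mul_assoc]
        simp [this, a3] }
  have hgg : ρ g * ρ g' = 1 := by rw [← hm _ _ (H.g_f h), H.g_g' h, h1]
  have hgG : g ∈ G := ⟨H.f_g h, H.g_f h, by rw [σg]; exact Bg⟩
  have hgG' : g' ∈ G := by
    refine ⟨H.f_g' h, H.g'_f h, fun v w => ?_⟩
    rw [τg']
    conv_lhs => rw [← Module.End.one_apply (R := ℂ) w, ← hgg, Module.End.mul_apply, ← Bg,
      ← Module.End.mul_apply, hgg]
    rfl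
  have hcG : 4 ≤ N → crC e u 3 ∈ G := by
    intro h4
    simp only [cornerE, h4, if_true] at Be τc
    exact ⟨H.f_c h 3 (by omega) (by omega), H.c_f h 3, by rw [τc]; exact Be⟩
  have hu : (u : A) ∈ Algebra.adjoin ℂ {e, (u : A), (↑u⁻¹ : A)} :=
    Algebra.subset_adjoin (by simp)
  have hui : (↑u⁻¹ : A) ∈ Algebra.adjoin ℂ {e, (u : A), (↑u⁻¹ : A)} :=
    Algebra.subset_adjoin (by simp)
  have hz : ∀ k : ℤ, (↑(u ^ k) : A) ∈ Algebra.adjoin ℂ {e, (u : A), (↑u⁻¹ : A)} := by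
    intro k
    obtain ⟨n, rfl | rfl⟩ := k.eq_nat_or_neg
    · rw [zpow_natCast, Units.val_pow_eq_pow_val]; exact pow_mem hu n
    · rw [zpow_neg, ← inv_zpow, zpow_natCast, Units.val_pow_eq_pow_val]; exact pow_mem hui n
  have hE : ∀ k : ℤ, tr u e k ∈ Algebra.adjoin ℂ {e, (u : A), (↑u⁻¹ : A)} := fun k =>
    mul_mem (mul_mem (hz _) (Algebra.subset_adjoin (by simp))) (hz _)
  have key := H.corner_generated h G hgG hgG' hcG (fun y hy => hy.1) lam hlam
    (a := g' * ↑(u ^ (-3 : ℤ)) * a) (by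
      refine mul_mem (mul_mem ?_ (hz _)) ha
      exact mul_mem (mul_mem (mul_mem (hE _) (hE _)) (hE _)) hui)
  have e1 : crF e u * (g' * ↑(u ^ (-3 : ℤ)) * a) * crF e u = g' * ↑(u ^ (-3 : ℤ)) * a * f := by
    simp only [← mul_assoc]; rw [H.f_g' h]
  -- The map a ↦ g' u⁻³ a f into the corner intertwines σ with τ; this is what the shift by g' u⁻³
  -- is for.
  have e2 : τ (g' * ↑(u ^ (-3 : ℤ)) * a * f) = g' * ↑(u ^ (-3 : ℤ)) * σ a * f := by
    have : τ (g' * ↑(u ^ (-3 : ℤ)) * a * f) = g' * (↑(u ^ (-3 : ℤ)) * σ f) * σ a *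
        (↑(u ^ (-3 : ℤ)) * σ g' * ↑(u ^ (3 : ℤ))) * g := by
      simp only [τ, σm, σz, mul_assoc]
    rw [this, σf', σg', ← mul_assoc g' f, H.g'_f h, mul_assoc _ g' g, H.g'_g h]
  have := key.2.2 v w
  rwa [e1, e2] at this

end Corner

end AffineTL

namespace AffineTL

/-! ### Invariant symmetric forms on irreducible finite-dimensional representations. -/

section Operators

open MulOpposite

universe v
variable {V : Type v} [AddCommGroup V] [Module ℂ V]

/-- No proper nonzero subspace is invariant under `e`, `u` and `u⁻¹`. -/
def OpIrreducible (e : Module.End ℂ V) (u : (Module.End ℂ V)ˣ) : Prop :=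
  ∀ W : Submodule ℂ V, (∀ v ∈ W, e v ∈ W) → (∀ v ∈ W, (u : Module.End ℂ V) v ∈ W) →
    (∀ v ∈ W, (↑u⁻¹ : Module.End ℂ V) v ∈ W) → W = ⊥ ∨ W = ⊤

/-- Pairs of operators, where the second factor has the opposite multiplication. -/
abbrev OpPair (V : Type*) [AddCommGroup V] [Module ℂ V] : Type _ :=
  Module.End ℂ V × (Module.End ℂ V)ᵐᵒᵖ

/-- The pair of operators `(u, u)`. -/
def pairUnit (u : (Module.End ℂ V)ˣ) : (OpPair V)ˣ :=
  MulEquiv.prodUnits.symm (u, Units.opEquiv.symm (op u))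

/-- The algebra of the pairs `(a, a')` where `a` is a noncommutative polynomial in `e`, `u`, `u⁻¹`
and `a'` its reversal. -/
noncomputable def pairAlg (e : Module.End ℂ V) (u : (Module.End ℂ V)ˣ) : Subalgebra ℂ (OpPair V) :=
  Algebra.adjoin ℂ {((e, op e) : OpPair V), (pairUnit u : OpPair V), (↑(pairUnit u)⁻¹ : OpPair V)}

/-- The exchange of the two components of a pair. -/
noncomputable def pairSwap (V : Type*) [AddCommGroup V] [Module ℂ V] : OpPair V →ₗ[ℂ] OpPair V where
  toFun a := (a.2.unop, op a.1)
  map_add' _ _ := rfl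
  map_smul' _ _ := rfl

theorem pairSwap_mul (a b : OpPair V) : pairSwap V (a * b) = pairSwap V b * pairSwap V a := rfl

theorem pairSwap_mem {e : Module.End ℂ V} {u : (Module.End ℂ V)ˣ} {t : OpPair V}
    (ht : t ∈ pairAlg e u) : pairSwap V t ∈ pairAlg e u := by
  induction ht using Algebra.adjoin_induction with
  | algebraMap c => exact (pairAlg e u).algebraMap_mem c
  | add a b _ _ h1 h2 => rw [map_add]; exact add_mem h1 h2
  | mul a b _ _ h1 h2 => rw [pairSwap_mul]; exact mul_mem h2 h1
  | mem a ha =>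
    rcases ha with rfl | rfl | rfl
    · exact Algebra.subset_adjoin (Or.inl rfl)
    · exact Algebra.subset_adjoin (Or.inr (Or.inl rfl))
    · exact Algebra.subset_adjoin (Or.inr (Or.inr rfl))

/-- The vectors t x form a nonzero invariant subspace, which irreducibility makes the whole space.
-/
theorem exists_pair_apply {e : Module.End ℂ V} {u : (Module.End ℂ V)ˣ} (irr : OpIrreducible e u)
    {x : V} (hx : x ≠ 0) (v : V) : ∃ t ∈ pairAlg e u, t.1 x = v := by
  let W : Submodule ℂ V := (pairAlg e u).toSubmodule.map
    ((LinearMap.applyₗ x).comp (LinearMap.fst ℂ (Module.End ℂ V) (Module.End ℂ V)ᵐᵒᵖ))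
  have hW : ∀ s ∈ pairAlg e u, ∀ w ∈ W, s.1 w ∈ W := by
    rintro s hs _ ⟨t, ht, rfl⟩
    exact ⟨s * t, (pairAlg e u).mul_mem hs ht, rfl⟩
  have hxW : x ∈ W := ⟨1, one_mem (pairAlg e u), rfl⟩
  rcases irr W (hW (e, op e) (Algebra.subset_adjoin (Or.inl rfl)))
    (hW (pairUnit u) (Algebra.subset_adjoin (Or.inr (Or.inl rfl))))
    (hW ↑(pairUnit u)⁻¹ (Algebra.subset_adjoin (Or.inr (Or.inr rfl)))) with h | h
  · rw [h] at hxW; exact absurd hxW hx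
  · obtain ⟨t, ht, h1⟩ : v ∈ W := by rw [h]; trivial
    exact ⟨t, ht, h1⟩

/-- A nonzero symmetric form with respect to which `e` and `u` are self-adjoint. -/
def HasSymmForm (e : Module.End ℂ V) (u : (Module.End ℂ V)ˣ) : Prop :=
  ∃ B : V →ₗ[ℂ] V →ₗ[ℂ] ℂ, B ≠ 0 ∧ (∀ v w, B v w = B w v) ∧ (∀ v w, B (e v) w = B v (e w)) ∧
    ∀ v w, B ((u : Module.End ℂ V) v) w = B v ((u : Module.End ℂ V) w)

/-- The form is B(t x, w) = ξ(t' w), where t' is the reversal of t. One works with pairs (t, t')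
because the operator of a noncommutative polynomial need not determine the operator of its reversal.
Applied to products of a reversed pair with another pair, the hypothesis on ξ shows both that B does
not depend on the choice of t and that it is symmetric. -/
theorem hasSymmForm_of_vector {e : Module.End ℂ V} {u : (Module.End ℂ V)ˣ}
    (irr : OpIrreducible e u) {x : V} (hx : x ≠ 0) {ξ : V →ₗ[ℂ] ℂ} (hξ : ξ ≠ 0)
    (h : ∀ t ∈ pairAlg e u, ξ (t.1 x) = ξ (t.2.unop x)) : HasSymmForm e u := by
  let F : pairAlg e u →ₗ[ℂ] V := ((LinearMap.applyₗ x).comp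
    (LinearMap.fst ℂ (Module.End ℂ V) (Module.End ℂ V)ᵐᵒᵖ)).comp (pairAlg e u).val.toLinearMap
  have hF : ∀ t, F t = (t : OpPair V).1 x := fun t => rfl
  have hsurj : LinearMap.range F = ⊤ := by
    rw [LinearMap.range_eq_top]
    intro v
    obtain ⟨t, ht, h1⟩ := exists_pair_apply irr hx v
    exact ⟨⟨t, ht⟩, h1⟩
  -- A linear choice of t for each vector makes the form bilinear by construction; `main` then shows
  -- that any other choice gives the same value.
  obtain ⟨s, hs⟩ := F.exists_rightInverse_of_surjective hsurj
  have hs' : ∀ v, (s v : OpPair V).1 x = v := fun v => LinearMap.congr_fun hs v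
  let B : V →ₗ[ℂ] V →ₗ[ℂ] ℂ := LinearMap.mk₂ ℂ (fun v w => ξ ((s v : OpPair V).2.unop w))
    (by intros; simp) (by intros; simp) (by intros; simp) (by intros; simp)
  have hB : ∀ v w, B v w = ξ ((s v : OpPair V).2.unop w) := fun v w => rfl
  have key : ∀ t ∈ pairAlg e u, ∀ r ∈ pairAlg e u,
      ξ (t.2.unop (r.1 x)) = ξ (r.2.unop (t.1 x)) := fun t ht r hr =>
    h (pairSwap V t * r) (mul_mem (pairSwap_mem ht) hr)
  have main : ∀ t ∈ pairAlg e u, ∀ w, B (t.1 x) w = ξ (t.2.unop w) := by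
    intro t ht w
    obtain ⟨r, hr, rfl⟩ := exists_pair_apply irr hx w
    rw [hB, key _ (s (t.1 x)).2 r hr, hs', key t ht r hr]
  have adj : ∀ a ∈ pairAlg e u, ∀ v w, B (a.1 v) w = B v (a.2.unop w) := by
    intro a ha v w
    obtain ⟨t, ht, rfl⟩ := exists_pair_apply irr hx v
    rw [main t ht]
    exact main (a * t) (mul_mem ha ht) w
  refine ⟨B, ?_, ?_, adj (e, op e) (Algebra.subset_adjoin (Or.inl rfl)),
    adj (pairUnit u) (Algebra.subset_adjoin (Or.inr (Or.inl rfl)))⟩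
  · intro h0
    apply hξ
    ext w
    have := main 1 (one_mem _) w
    rw [h0] at this
    simpa using this.symm
  · intro v w
    obtain ⟨t, ht, rfl⟩ := exists_pair_apply irr hx v
    obtain ⟨r, hr, rfl⟩ := exists_pair_apply irr hx w
    rw [main t ht, main r hr, key t ht r hr]

theorem TLRel.pair {N : ℕ} {β : ℂ} {e : Module.End ℂ V} {u : (Module.End ℂ V)ˣ}
    (H : TLRel N β e u) : TLRel N β ((e, op e) : OpPair V) (pairUnit u) :=
  H.prod H.opposite

variable [FiniteDimensional ℂ V] [Nontrivial V]

/-- Schur's lemma: an eigenspace of an operator commuting with e and u is invariant under e, u and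
u⁻¹. -/
theorem OpIrreducible.exists_scalar {e : Module.End ℂ V} {u : (Module.End ℂ V)ˣ}
    (irr : OpIrreducible e u) (z : Module.End ℂ V) (he : z * e = e * z) (hu : z * u = u * z) :
    ∃ c : ℂ, z = algebraMap ℂ (Module.End ℂ V) c := by
  obtain ⟨c, hc⟩ := Module.End.exists_eigenvalue z
  have hu' : z * ↑u⁻¹ = ↑u⁻¹ * z := ((show Commute z u from hu).units_inv_right).eq
  have key : ∀ a : Module.End ℂ V, z * a = a * z → ∀ v ∈ z.eigenspace c, a v ∈ z.eigenspace c := by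
    intro a ha v hv
    rw [Module.End.mem_eigenspace_iff] at *
    rw [← Module.End.mul_apply, ha, Module.End.mul_apply, hv, map_smul]
  refine ⟨c, LinearMap.ext fun v => ?_⟩
  rcases irr _ (key e he) (key u hu) (key _ hu') with h | h
  · exact absurd h hc
  · have : v ∈ z.eigenspace c := by rw [h]; trivial
    rw [Module.End.mem_eigenspace_iff] at this
    rw [this]; rfl

omit [FiniteDimensional ℂ V] [Nontrivial V] in
theorem exists_dual_ne_zero {x : V} (hx : x ≠ 0) : ∃ ξ : V →ₗ[ℂ] ℂ, ξ x ≠ 0 := by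
  by_contra! h
  exact hx ((Module.forall_dual_apply_eq_zero_iff ℂ x).mp h)

/-- With e = 0 the operators u and u⁻¹ commute with everything, so they are scalars. Then all pairs
are scalars, equal to their reversals, and any ξ not vanishing at x will do. -/
theorem hasSymmForm_of_zero {u : (Module.End ℂ V)ˣ} (irr : OpIrreducible (0 : Module.End ℂ V) u) :
    HasSymmForm 0 u := by
  obtain ⟨c, hc⟩ := irr.exists_scalar u (by simp) rfl
  have hc' : ∃ c', (↑u⁻¹ : Module.End ℂ V) = algebraMap ℂ (Module.End ℂ V) c' :=
    irr.exists_scalar _ (by simp) (by simp)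
  obtain ⟨c', hc'⟩ := hc'
  obtain ⟨x, hx⟩ := exists_ne (0 : V)
  obtain ⟨ξ, hξ⟩ := exists_dual_ne_zero hx
  refine hasSymmForm_of_vector irr hx (ξ := ξ) (fun h => hξ (by rw [h]; rfl)) fun t ht => ?_
  obtain ⟨k, rfl⟩ : ∃ k, t = algebraMap ℂ (OpPair V) k := by
    have : t ∈ (⊥ : Subalgebra ℂ (OpPair V)) := by
      refine Algebra.adjoin_le ?_ ht
      rintro _ (rfl | rfl | rfl)
      · exact zero_mem _
      · exact ⟨c, Prod.ext hc.symm (congrArg op hc.symm)⟩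
      · exact ⟨c', Prod.ext hc'.symm (congrArg op hc'.symm)⟩
    obtain ⟨k, hk⟩ := this
    exact ⟨k, hk.symm⟩
  rfl

/-- Two sites are too few for e₁e₂, but u² is a scalar here. Hence E t E is a combination of the
palindromes (E U)^m E and equals its own reversal. So x = e v₀ and ξ = ξ₀ ∘ e satisfy the hypothesis
of `hasSymmForm_of_vector`. -/
theorem TLRel.hasSymmForm_two {β : ℂ} {e : Module.End ℂ V} {u : (Module.End ℂ V)ˣ}
    (H : TLRel 2 β e u) (irr : OpIrreducible e u) (he : e ≠ 0) : HasSymmForm e u := by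
  obtain ⟨lam, hlam⟩ := irr.exists_scalar ↑(u ^ 2) H.per (by
    rw [← Units.val_mul, ← Units.val_mul, ← pow_succ, ← pow_succ'])
  obtain ⟨v0, hv0⟩ : ∃ v, e v ≠ 0 := by
    by_contra! h; exact he (LinearMap.ext h)
  obtain ⟨ξ0, hξ0⟩ := exists_dual_ne_zero hv0
  have H' := H.pair
  let E : OpPair V := (e, op e)
  let U : OpPair V := pairUnit u
  have hU2 : U * U = algebraMap ℂ (OpPair V) lam := by
    rw [pow_two] at hlam
    exact Prod.ext hlam (congrArg op hlam)
  let P : Submodule ℂ (OpPair V) := Submodule.span ℂ (Set.range fun m : ℕ => (E * U) ^ m * E)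
  have hP : ∀ p ∈ P, E * p ∈ P ∧ E * (U * p) ∈ P := by
    intro p hp
    induction hp using Submodule.span_induction with
    | zero => simp
    | add x y _ _ h1 h2 =>
      simp only [mul_add]; exact ⟨P.add_mem h1.1 h2.1, P.add_mem h1.2 h2.2⟩
    | smul c x _ h1 =>
      simp only [mul_smul_comm]; exact ⟨P.smul_mem c h1.1, P.smul_mem c h1.2⟩
    | mem x hx =>
      obtain ⟨m, rfl⟩ := hx
      have e1 : E * (U * ((E * U) ^ m * E)) = (E * U) ^ (m + 1) * E := by
        rw [pow_succ']; simp only [mul_assoc]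
      refine ⟨?_, by rw [e1]; exact Submodule.subset_span ⟨m + 1, rfl⟩⟩
      have e2 : E * ((E * U) ^ m * E) = β • ((E * U) ^ m * E) := by
        have := H'.sq
        cases m with
        | zero => rw [pow_zero, one_mul]; exact this
        | succ m =>
          rw [pow_succ', mul_assoc, mul_assoc, ← mul_assoc E E, this, smul_mul_assoc]
      rw [e2]; exact P.smul_mem _ (Submodule.subset_span ⟨m, rfl⟩)
  have hswapP : ∀ p ∈ P, pairSwap V p = p := by
    intro p hp
    induction hp using Submodule.span_induction with
    | zero => simp
    | add x y _ _ h1 h2 => rw [map_add, h1, h2]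
    | smul c x _ h1 => rw [map_smul, h1]
    | mem x hx =>
      obtain ⟨m, rfl⟩ := hx
      have : ∀ m, pairSwap V ((E * U) ^ m) = (U * E) ^ m := by
        intro m
        induction m with
        | zero => rfl
        | succ m ih => rw [pow_succ, pairSwap_mul, ih, pow_succ']; rfl
      have e1 : pairSwap V ((E * U) ^ m * E) = E * (U * E) ^ m := by
        rw [pairSwap_mul, this]; rfl
      rw [e1]
      exact ((SemiconjBy.pow_right (show SemiconjBy E (U * E) (E * U) from
        (mul_assoc _ _ _).symm)) m).eq
  -- The space P + U P is stable under all pairs: E maps it into P, and U exchanges the two summands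
  -- up to the nonzero scalar U².
  have hall : ∀ t ∈ pairAlg e u, ∀ p ∈ P, ∀ p' ∈ P, ∃ r ∈ P, ∃ r' ∈ P,
      t * (p + U * p') = r + U * r' := by
    intro t ht
    induction ht using Algebra.adjoin_induction with
    | algebraMap c =>
      intro p hp p' hp'
      exact ⟨c • p, P.smul_mem c hp, c • p', P.smul_mem c hp', by
        rw [← Algebra.smul_def, smul_add, mul_smul_comm]⟩
    | add a b _ _ h1 h2 =>
      intro p hp p' hp'
      obtain ⟨r, hr, r', hr', e1⟩ := h1 p hp p' hp'
      obtain ⟨s, hs, s', hs', e2⟩ := h2 p hp p' hp'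
      exact ⟨r + s, P.add_mem hr hs, r' + s', P.add_mem hr' hs', by
        rw [add_mul, e1, e2, mul_add]; abel⟩
    | mul a b _ _ h1 h2 =>
      intro p hp p' hp'
      obtain ⟨r, hr, r', hr', e1⟩ := h2 p hp p' hp'
      rw [mul_assoc, e1]
      exact h1 r hr r' hr'
    | mem a ha =>
      intro p hp p' hp'
      have hUU : ∀ q ∈ P, U * (U * q) = lam • q := fun q _ => by
        rw [← mul_assoc, hU2, ← Algebra.smul_def]
      rcases ha with rfl | rfl | rfl
      · exact ⟨E * p + E * (U * p'), P.add_mem (hP p hp).1 (hP p' hp').2, 0, P.zero_mem, by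
          rw [mul_add]; simp [E]⟩
      · exact ⟨lam • p', P.smul_mem _ hp', p, hp, by
          rw [mul_add]; change U * p + U * (U * p') = _; rw [hUU p' hp', add_comm]⟩
      · have hlam0 : lam ≠ 0 := by
          rintro rfl
          rw [map_zero] at hlam
          exact (u ^ 2).ne_zero hlam
        refine ⟨p', hp', lam⁻¹ • p, P.smul_mem _ hp, ?_⟩
        have : (p + U * p') = U * (p' + U * (lam⁻¹ • p)) := by
          rw [mul_add, mul_smul_comm, mul_smul_comm, hUU p hp, smul_smul, inv_mul_cancel₀ hlam0, one_smul,
            add_comm]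
        rw [this]; exact Units.inv_mul_cancel_left _ _
  refine hasSymmForm_of_vector irr hv0 (ξ := ξ0 ∘ₗ e) ?_ fun t ht => ?_
  · intro h0
    have hne : ∃ t ∈ pairAlg e u, t.1 (e v0) = v0 := exists_pair_apply irr hv0 v0
    obtain ⟨t, -, ht⟩ := hne
    have := LinearMap.congr_fun h0 v0
    exact hξ0 this
  · have hE : E ∈ P := Submodule.subset_span ⟨0, by simp⟩
    obtain ⟨r, hr, r', hr', e1⟩ := hall t ht E hE 0 P.zero_mem
    have e2 : E * (t * E) ∈ P := by
      simp only [mul_zero, add_zero] at e1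
      rw [e1, mul_add]
      exact P.add_mem (hP r hr).1 (hP r' hr').2
    have e3 := hswapP _ e2
    have e4 : (E * (t * E)).1 v0 = (pairSwap V (E * (t * E))).1 v0 := by rw [e3]
    exact congrArg ξ0 e4

/-- The projection onto the range of an idempotent, as a map to operators on the range. -/
noncomputable def compress (f : Module.End ℂ V) :
    OpPair V →ₗ[ℂ] Module.End ℂ (LinearMap.range f) where
  toFun a := f.rangeRestrict ∘ₗ a.1 ∘ₗ (LinearMap.range f).subtype
  map_add' a b := by simp [LinearMap.add_comp, LinearMap.comp_add]
  map_smul' c a := by simp [LinearMap.smul_comp, LinearMap.comp_smul]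

omit [FiniteDimensional ℂ V] [Nontrivial V] in
theorem compress_apply (f : Module.End ℂ V) (a : OpPair V) (v : LinearMap.range f) :
    (compress f a v : V) = f (a.1 v) := rfl

omit [FiniteDimensional ℂ V] [Nontrivial V] in
theorem crF_pair (e : Module.End ℂ V) (u : (Module.End ℂ V)ˣ) :
    (crF ((e, op e) : OpPair V) (pairUnit u)).1 = crF e u := by
  simp only [crF, pairUnit, tr_prod]; rfl

omit [FiniteDimensional ℂ V] [Nontrivial V] in
theorem compress_crF {N : ℕ} {β : ℂ} {e : Module.End ℂ V} {u : (Module.End ℂ V)ˣ}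
    (H : TLRel N β e u) (h : 3 ≤ N) :
    compress (crF e u) (crF ((e, op e) : OpPair V) (pairUnit u)) = 1 := by
  refine LinearMap.ext fun v => Subtype.ext ?_
  rw [compress_apply, crF_pair]
  obtain ⟨v, w, rfl⟩ := v
  simp only [← Module.End.mul_apply, H.f_f h]
  rfl

-- Compression to the range of f is not multiplicative in general; it is when the left factor ends
-- in f, since then f may be inserted between the factors.
omit [FiniteDimensional ℂ V] [Nontrivial V] in
theorem compress_mul (e : Module.End ℂ V) (u : (Module.End ℂ V)ˣ) (x y : OpPair V)
    (hx : x * crF ((e, op e) : OpPair V) (pairUnit u) = x) :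
    compress (crF e u) (x * y) = compress (crF e u) x * compress (crF e u) y := by
  refine LinearMap.ext fun v => Subtype.ext ?_
  rw [Module.End.mul_apply, compress_apply, compress_apply, compress_apply]
  have h1 : x.1 * crF e u = x.1 := by rw [← crF_pair]; exact congrArg Prod.fst hx
  conv_lhs => rw [Prod.fst_mul, ← h1]
  rfl

/-- The simple modules of the affine Temperley-Lieb algebra have an invariant form. -/
theorem TLRel.hasSymmForm {β : ℂ} (N : ℕ) (hN : 1 ≤ N) : ∀ (V : Type v) [AddCommGroup V] [Module ℂ V]
    [FiniteDimensional ℂ V] [Nontrivial V] (e : Module.End ℂ V) (u : (Module.End ℂ V)ˣ),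
    TLRel N β e u → OpIrreducible e u → HasSymmForm e u := by
  induction N using Nat.strong_induction_on with
  | _ N ih =>
  intro V _ _ _ _ e u H irr
  by_cases he : e = 0
  · subst he; exact hasSymmForm_of_zero irr
  by_cases h1 : N = 1
  · exact absurd (H.one h1) he
  by_cases h2 : N = 2
  · subst h2; exact H.hasSymmForm_two irr he
  have h : 3 ≤ N := by omega
  obtain ⟨lam, hlam⟩ := irr.exists_scalar ↑(u ^ N) H.per (by
    rw [← Units.val_mul, ← Units.val_mul, ← pow_succ, ← pow_succ'])
  let E : OpPair V := (e, op e)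
  let U : (OpPair V)ˣ := pairUnit u
  have H' : TLRel N β E U := H.pair
  have hlam' : (↑(U ^ N) : OpPair V) = algebraMap ℂ (OpPair V) lam := by
    simp only [U, pairUnit, ← map_pow]
    exact Prod.ext hlam (congrArg op hlam)
  let ρ := compress (crF e u)
  have ρ1 : ρ (crF E U) = 1 := compress_crF H h
  have ρm : ∀ x y, x * crF E U = x → ρ (x * y) = ρ x * ρ y := compress_mul e u
  let w : (Module.End ℂ (LinearMap.range (crF e u)))ˣ :=
    { val := ρ (crG E U)
      inv := ρ (crG' E U)
      val_inv := by rw [← ρm _ _ (H'.g_f h), H'.g_g' h, ρ1]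
      inv_val := by rw [← ρm _ _ (H'.g'_f h), H'.g'_g h, ρ1] }
  have Hc : TLRel (N - 2) β (ρ (cornerE N E U)) w := H'.corner h ρ ρm w rfl rfl
  have hfix : ∀ v ∈ LinearMap.range (crF e u), crF e u v = v := by
    rintro _ ⟨v, rfl⟩
    rw [← Module.End.mul_apply, H.f_f h]
  -- If f were zero, then e₁ = e₁e₂e₁ = f e₁ would vanish, and with it its conjugate e.
  have hnt : Nontrivial (LinearMap.range (crF e u)) := by
    rw [Submodule.nontrivial_iff_ne_bot, Ne, LinearMap.range_eq_bot]
    intro h0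
    have e1 : tr u e 1 = 0 := by
      have := H.tr_up h 1
      norm_num only at this
      rw [← this, ← crF, h0, zero_mul]
    apply he
    have e2 := tr_tr u e 1 (-1)
    rw [e1] at e2
    simpa [tr] using e2.symm
  -- For x ≠ 0 in W and y in the range of f, irreducibility of V gives t with t x = y. Then f t f
  -- also maps x to y and preserves W, because it belongs to the corner and the generators of the
  -- corner preserve W.
  have irr' : OpIrreducible (ρ (cornerE N E U)) w := by
    intro W h1 h2 h3
    rw [or_iff_not_imp_left]
    intro hW
    obtain ⟨x, hx, hx0⟩ := W.exists_mem_ne_zero_of_ne_bot hW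
    have hx0' : (x : V) ≠ 0 := fun h0 => hx0 (Subtype.ext h0)
    rw [eq_top_iff]
    rintro y -
    obtain ⟨t, ht, hty⟩ := exists_pair_apply irr hx0' (y : V)
    let G : NonUnitalSubalgebra ℂ (OpPair V) :=
      { carrier := {y | crF E U * y = y ∧ y * crF E U = y ∧ ∀ v ∈ W, ρ y v ∈ W}
        add_mem' := by
          rintro x y ⟨a1, a2, a3⟩ ⟨b1, b2, b3⟩
          refine ⟨by rw [mul_add, a1, b1], by rw [add_mul, a2, b2], fun v hv => ?_⟩
          rw [map_add]; exact W.add_mem (a3 v hv) (b3 v hv)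
        zero_mem' := ⟨by simp, by simp, by simp⟩
        mul_mem' := by
          rintro x y ⟨a1, a2, a3⟩ ⟨b1, b2, b3⟩
          refine ⟨by rw [← mul_assoc, a1], by rw [mul_assoc, b2], fun v hv => ?_⟩
          rw [ρm x y a2]; exact a3 _ (b3 v hv)
        smul_mem' := by
          rintro c x ⟨a1, a2, a3⟩
          refine ⟨by rw [mul_smul_comm, a1], by rw [smul_mul_assoc, a2], fun v hv => ?_⟩
          rw [map_smul]; exact W.smul_mem c (a3 v hv) }
    have key := H'.corner_generated h G ⟨H'.f_g h, H'.g_f h, h2⟩ ⟨H'.f_g' h, H'.g'_f h, h3⟩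
      (fun h4 => by
        simp only [cornerE, h4, if_true] at h1
        exact ⟨H'.f_c h 3 (by omega) (by omega), H'.c_f h 3, h1⟩)
      (fun y hy => hy.1) lam hlam' ht
    have := key.2.2 x hx
    rw [mul_assoc, ρm _ _ (H'.f_f h), ρ1, one_mul] at this
    convert this
    refine Subtype.ext ?_
    rw [compress_apply, Prod.fst_mul, Module.End.mul_apply, crF_pair, hfix x x.2, hty, hfix y y.2]
  obtain ⟨B, B0, Bs, Be, Bg⟩ := ih (N - 2) (by omega) (by omega) _ _ _ Hc irr'
  have key := @TLRel.adjoint_of_corner _ _ _ _ _ _ _ H' h (pairSwap V) pairSwap_mul rfl rfl rfl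
    lam hlam' _ _ _ ρ ρ1 ρm B Be Bg
  obtain ⟨x, hx⟩ : ∃ x, B x ≠ 0 := by
    by_contra! h0; exact B0 (LinearMap.ext h0)
  obtain ⟨y, hy⟩ : ∃ y, B x y ≠ 0 := by
    by_contra! h0; exact hx (LinearMap.ext h0)
  have hx0 : (x : V) ≠ 0 := fun h0 => hx (by
    rw [show x = 0 from Subtype.ext h0, map_zero])
  -- The functional is ξ(v) = B(x, f h' v). On vectors t x it is B(x, ρ(h' t f) x), to which
  -- `adjoint_of_corner` and the symmetry of B apply.
  let h' : OpPair V := crG' E U * ↑(U ^ (-3 : ℤ))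
  have hξ : ∀ t : OpPair V, B x ((crF e u).rangeRestrict (h'.1 (t.1 x))) =
      B x (ρ (h' * t * crF E U) x) := by
    intro t
    congr 1
    refine Subtype.ext ?_
    have e1 : (h' * t * crF E U).1 = h'.1 * t.1 * crF e u := by
      rw [Prod.fst_mul, crF_pair]; rfl
    rw [compress_apply, e1, Module.End.mul_apply, hfix x x.2]
    rfl
  refine hasSymmForm_of_vector irr hx0 (ξ := B x ∘ₗ (crF e u).rangeRestrict ∘ₗ h'.1) ?_
    fun t ht => ?_
  · intro h0
    apply hy
    -- To see that ξ ≠ 0, evaluate it at u³ g y: since g' u⁻³ · u³ g = f, the value is B(x, y) ≠ 0.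
    have := LinearMap.congr_fun h0 ((↑(U ^ (3 : ℤ)) * crG E U : OpPair V).1 y)
    have e1 : h' * (↑(U ^ (3 : ℤ)) * crG E U) = crF E U := by
      simp only [h', mul_assoc]
      rw [← mul_assoc (↑(U ^ (-3 : ℤ)) : OpPair V), ← Units.val_mul, ← zpow_add]
      simp [H'.g'_g h]
    have e2 : h'.1 ((↑(U ^ (3 : ℤ)) * crG E U : OpPair V).1 y) = crF e u y := by
      rw [← Module.End.mul_apply, ← Prod.fst_mul, e1, crF_pair]
    rw [LinearMap.comp_apply, LinearMap.comp_apply, e2, hfix y y.2] at this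
    rw [show y = (crF e u).rangeRestrict y from Subtype.ext (hfix y y.2).symm]
    exact this
  · have e1 := hξ t
    have e2 := hξ (pairSwap V t)
    rw [LinearMap.comp_apply, LinearMap.comp_apply, LinearMap.comp_apply, LinearMap.comp_apply]
    rw [e1, Bs, key ht]
    exact e2.symm

end Operators

end AffineTL

namespace AffineTL

set_option linter.unusedSectionVars false

/-! ### Dual modules, annihilators and the reversal of Loewy diagrams. -/

section Duality

variable {A : Type*} [Ring A] [Algebra ℂ A]

/-- A nondegenerate pairing between two modules for which `σ a` is the adjoint of `a`. -/
structure Duality (σ : A → A) (M M' : Type*) [AddCommGroup M] [Module ℂ M] [Module A M]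
    [AddCommGroup M'] [Module ℂ M'] [Module A M'] where
  form : M →ₗ[ℂ] M' →ₗ[ℂ] ℂ
  smul_left : ∀ (a : A) v w, form (a • v) w = form v (σ a • w)
  smul_right : ∀ (a : A) v w, form v (a • w) = form (σ a • v) w
  left : ∀ v, (∀ w, form v w = 0) → v = 0
  right : ∀ w, (∀ v, form v w = 0) → w = 0

/-- Two modules are dual to each other with respect to `σ`. -/
def IsDual (σ : A → A) (M M' : Type*) [AddCommGroup M] [Module ℂ M] [Module A M]
    [AddCommGroup M'] [Module ℂ M'] [Module A M'] : Prop := Nonempty (Duality σ M M')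

variable {σ : A → A} {M M' M₁ M₂ : Type*}
  [AddCommGroup M] [Module ℂ M] [Module A M] [IsScalarTower ℂ A M]
  [AddCommGroup M'] [Module ℂ M'] [Module A M'] [IsScalarTower ℂ A M']
  [AddCommGroup M₁] [Module ℂ M₁] [Module A M₁] [IsScalarTower ℂ A M₁]
  [AddCommGroup M₂] [Module ℂ M₂] [Module A M₂] [IsScalarTower ℂ A M₂]

namespace Duality

/-- Exchange the two modules. -/
def symm (D : Duality σ M M') : Duality σ M' M where
  form := D.form.flip
  smul_left a v w := D.smul_right a w v
  smul_right a v w := D.smul_left a w v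
  left := D.right
  right := D.left

/-- Transport a pairing to two subquotients. -/
theorem subquotient (D : Duality σ M M') {X X' P P' : Type*} [AddCommGroup X] [Module ℂ X]
    [Module A X] [IsScalarTower ℂ A X] [AddCommGroup X'] [Module ℂ X'] [Module A X']
    [IsScalarTower ℂ A X'] [AddCommGroup P] [Module ℂ P] [Module A P] [IsScalarTower ℂ A P]
    [AddCommGroup P'] [Module ℂ P'] [Module A P'] [IsScalarTower ℂ A P']
    (i : X →ₗ[A] M) (j : X' →ₗ[A] M') (p : X →ₗ[A] P) (p' : X' →ₗ[A] P')
    (hp : Function.Surjective p) (hp' : Function.Surjective p')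
    (h1 : ∀ v, p v = 0 ↔ ∀ w, D.form (i v) (j w) = 0)
    (h2 : ∀ w, p' w = 0 ↔ ∀ v, D.form (i v) (j w) = 0) : IsDual σ P P' := by
  -- Linear sections of p and p' define the induced form; it does not depend on them because the
  -- kernels of p and p' pair to zero with everything.
  obtain ⟨s, hs⟩ := (p.restrictScalars ℂ).exists_rightInverse_of_surjective
    (LinearMap.range_eq_top.mpr hp)
  obtain ⟨s', hs'⟩ := (p'.restrictScalars ℂ).exists_rightInverse_of_surjective
    (LinearMap.range_eq_top.mpr hp')
  have es : ∀ x, p (s x) = x := fun x => LinearMap.congr_fun hs x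
  have es' : ∀ x, p' (s' x) = x := fun x => LinearMap.congr_fun hs' x
  let B := D.form.compl₁₂ ((i.restrictScalars ℂ) ∘ₗ s) ((j.restrictScalars ℂ) ∘ₗ s')
  have hB : ∀ v w, B (p v) (p' w) = D.form (i v) (j w) := by
    intro v w
    have e1 : D.form (i (s (p v) - v)) (j (s' (p' w))) = 0 :=
      (h1 _).mp (by rw [map_sub, es, sub_self]) _
    have e2 : D.form (i v) (j (s' (p' w) - w)) = 0 :=
      (h2 _).mp (by rw [map_sub, es', sub_self]) _
    rw [map_sub, map_sub, LinearMap.sub_apply, sub_eq_zero] at e1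
    rw [map_sub, map_sub, sub_eq_zero] at e2
    exact e1.trans e2
  refine ⟨⟨B, fun a v w => ?_, fun a v w => ?_, fun v hv => ?_, fun w hw => ?_⟩⟩
  · obtain ⟨v, rfl⟩ := hp v
    obtain ⟨w, rfl⟩ := hp' w
    rw [← map_smul, ← map_smul, hB, hB, i.map_smul, j.map_smul, D.smul_left]
  · obtain ⟨v, rfl⟩ := hp v
    obtain ⟨w, rfl⟩ := hp' w
    rw [← map_smul, ← map_smul, hB, hB, i.map_smul, j.map_smul, D.smul_right]
  · obtain ⟨v, rfl⟩ := hp v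
    exact (h1 v).mpr fun w => by rw [← hB, hv]
  · obtain ⟨w, rfl⟩ := hp' w
    exact (h2 w).mpr fun v => by rw [← hB, hw]

/-- The annihilator of a submodule. -/
def perp (D : Duality σ M M') (U : Submodule A M) : Submodule A M' where
  carrier := {w | ∀ u ∈ U, D.form u w = 0}
  add_mem' {v w} hv hw u hu := by rw [map_add, hv u hu, hw u hu, add_zero]
  zero_mem' u _ := map_zero _
  smul_mem' a w hw u hu := by rw [D.smul_right, hw _ (U.smul_mem _ hu)]

theorem perp_anti (D : Duality σ M M') {U W : Submodule A M} (h : U ≤ W) :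
    D.perp W ≤ D.perp U := fun _ hw u hu => hw u (h hu)

/-- Nondegeneracy embeds each space into the dual of the other. This makes M' finite-dimensional and
the dimensions equal, so the embeddings are onto. -/
theorem bijective_flip [FiniteDimensional ℂ M] (D : Duality σ M M') :
    Function.Bijective D.form.flip := by
  have h1 : Function.Injective D.form.flip := by
    refine (injective_iff_map_eq_zero _).mpr fun w hw => D.right w fun v => ?_
    exact LinearMap.congr_fun hw v
  have h2 : Function.Injective D.form := by
    refine (injective_iff_map_eq_zero _).mpr fun w hw => D.left w fun v => ?_
    exact LinearMap.congr_fun hw v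
  have : FiniteDimensional ℂ M' := FiniteDimensional.of_injective _ h1
  refine ⟨h1, ?_⟩
  refine (LinearMap.injective_iff_surjective_of_finrank_eq_finrank ?_).mp h1
  refine le_antisymm (LinearMap.finrank_le_finrank_of_injective h1) ?_
  have := LinearMap.finrank_le_finrank_of_injective h2
  rwa [Subspace.dual_finrank_eq] at this ⊢

theorem finite_right [FiniteDimensional ℂ M] (D : Duality σ M M') : FiniteDimensional ℂ M' :=
  FiniteDimensional.of_injective _ D.bijective_flip.1

/-- A vector outside U is detected by a functional vanishing on U, and by `bijective_flip` this
functional is the pairing with an element of M'. -/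
theorem perp_perp [FiniteDimensional ℂ M] (D : Duality σ M M') (U : Submodule A M) :
    D.symm.perp (D.perp U) = U := by
  refine le_antisymm (fun v hv => ?_) fun u hu w hw => hw u hu
  by_contra h
  obtain ⟨f, hf, hU⟩ := (U.restrictScalars ℂ).exists_le_ker_of_notMem
    (v := v) (by rwa [Submodule.restrictScalars_mem])
  obtain ⟨w, rfl⟩ := D.bijective_flip.2 f
  exact hf (hv w fun u hu => hU hu)

theorem perp_le_perp [FiniteDimensional ℂ M] (D : Duality σ M M') {U W : Submodule A M} :
    D.perp W ≤ D.perp U ↔ U ≤ W :=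
  ⟨fun h => by rw [← D.perp_perp U, ← D.perp_perp W]; exact D.symm.perp_anti h, D.perp_anti⟩

/-- Annihilators define an anti-isomorphism between the lattices of submodules. -/
def perpIso [FiniteDimensional ℂ M] (D : Duality σ M M') :
    Submodule A M ≃o (Submodule A M')ᵒᵈ where
  toFun U := OrderDual.toDual (D.perp U)
  invFun W := D.symm.perp (OrderDual.ofDual W)
  left_inv U := D.perp_perp U
  right_inv W := by
    have := D.finite_right
    exact congrArg OrderDual.toDual (D.symm.perp_perp (OrderDual.ofDual W))
  map_rel_iff' := by
    intro U W
    exact D.perp_le_perp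

theorem perp_covBy [FiniteDimensional ℂ M] (D : Duality σ M M') {U W : Submodule A M}
    (h : U ⋖ W) : D.perp W ⋖ D.perp U := by
  have := (apply_covBy_apply_iff D.perpIso).mpr h
  exact toDual_covBy_toDual_iff.mp this

theorem isDual_subquotient [FiniteDimensional ℂ M] (D : Duality σ M M') (W U : Submodule A M) :
    IsDual σ (W ⧸ U.submoduleOf W) (D.perp U ⧸ (D.perp W).submoduleOf (D.perp U)) := by
  refine D.subquotient W.subtype (D.perp U).subtype (Submodule.mkQ _) (Submodule.mkQ _)
    (Submodule.mkQ_surjective _) (Submodule.mkQ_surjective _) (fun v => ?_) fun w => ?_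
  · rw [Submodule.mkQ_apply, Submodule.Quotient.mk_eq_zero]
    change (v : M) ∈ U ↔ _
    conv_lhs => rw [← D.perp_perp U]
    exact ⟨fun h w => h w w.2, fun h w hw => h ⟨w, hw⟩⟩
  · rw [Submodule.mkQ_apply, Submodule.Quotient.mk_eq_zero]
    exact ⟨fun h v => h v v.2, fun h v hv => h ⟨v, hv⟩⟩

theorem isDual_quotient [FiniteDimensional ℂ M] (D : Duality σ M M') (U : Submodule A M) :
    IsDual σ (M ⧸ U) (D.perp U) := by
  refine D.subquotient LinearMap.id (D.perp U).subtype (Submodule.mkQ _) LinearMap.id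
    (Submodule.mkQ_surjective _) Function.surjective_id (fun v => ?_) fun w => ?_
  · rw [Submodule.mkQ_apply, Submodule.Quotient.mk_eq_zero]
    conv_lhs => rw [← D.perp_perp U]
    exact ⟨fun h w => h w w.2, fun h w hw => h ⟨w, hw⟩⟩
  · exact ⟨fun h v => by rw [show w = 0 from h]; simp, fun h => Subtype.ext (D.right w h)⟩

theorem isDual_submodule (D : Duality σ M M') (U : Submodule A M) :
    IsDual σ U (M' ⧸ D.perp U) := by
  refine D.subquotient U.subtype LinearMap.id LinearMap.id (Submodule.mkQ _)
    Function.surjective_id (Submodule.mkQ_surjective _) (fun v => ?_) fun w => ?_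
  · exact ⟨fun h w => by rw [show v = 0 from h]; simp, fun h => Subtype.ext (D.left v h)⟩
  · rw [Submodule.mkQ_apply, Submodule.Quotient.mk_eq_zero]
    exact ⟨fun h v => h v v.2, fun h v hv => h ⟨v, hv⟩⟩

end Duality

theorem IsDual.congr (h : IsDual σ M M') (f : M ≃ₗ[A] M₁) (g : M' ≃ₗ[A] M₂) : IsDual σ M₁ M₂ := by
  obtain ⟨D⟩ := h
  refine D.subquotient LinearMap.id LinearMap.id f.toLinearMap g.toLinearMap f.surjective
    g.surjective (fun v => ?_) fun w => ?_
  · exact f.map_eq_zero_iff.trans ⟨fun h w => by rw [h]; simp, fun h => D.left v h⟩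
  · exact g.map_eq_zero_iff.trans ⟨fun h w => by rw [h]; simp, fun h => D.right w h⟩

/-- A finite-dimensional module has only one dual. -/
theorem IsDual.nonempty_equiv [FiniteDimensional ℂ M] (h₁ : IsDual σ M M₁) (h₂ : IsDual σ M M₂) :
    Nonempty (M₁ ≃ₗ[A] M₂) := by
  obtain ⟨D₁⟩ := h₁
  obtain ⟨D₂⟩ := h₂
  let e := (LinearEquiv.ofBijective _ D₁.bijective_flip).trans
    (LinearEquiv.ofBijective _ D₂.bijective_flip).symm
  have he : ∀ v w, D₂.form v (e w) = D₁.form v w := by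
    intro v w
    exact LinearMap.congr_fun ((LinearEquiv.ofBijective _ D₂.bijective_flip).apply_symm_apply
      (LinearEquiv.ofBijective _ D₁.bijective_flip w)) v
  refine ⟨{ e with map_smul' := fun a w => ?_ }⟩
  refine D₂.bijective_flip.1 (LinearMap.ext fun v => ?_)
  change D₂.form v (e (a • w)) = D₂.form v (a • e w)
  rw [he, D₁.smul_right, D₂.smul_right, he]

theorem finite_submodule [FiniteDimensional ℂ M] (W : Submodule A M) : FiniteDimensional ℂ W :=
  FiniteDimensional.of_injective (W.subtype.restrictScalars ℂ) W.injective_subtype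

theorem finite_of_equiv [FiniteDimensional ℂ M] (f : M ≃ₗ[A] M') : FiniteDimensional ℂ M' :=
  Module.Finite.equiv (f.restrictScalars ℂ)

section Loewy

variable {S T : Type*} [AddCommGroup S] [Module ℂ S] [Module A S] [IsScalarTower ℂ A S]
  [AddCommGroup T] [Module ℂ T] [Module A T] [IsScalarTower ℂ A T]

/-- The subquotient W/U of M is dual to U^⊥/W^⊥ in M'. As duals are unique and S is its own dual, a
copy of S in M gives one in M'. -/
theorem HasCompFactor.of_isDual [FiniteDimensional ℂ M] (h : HasCompFactor A M S)
    (hM : IsDual σ M M') (hS : IsDual σ S S) : HasCompFactor A M' S := by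
  obtain ⟨W, U, hUW, ⟨f⟩⟩ := h
  obtain ⟨D⟩ := hM
  have := finite_submodule W
  have := finite_of_equiv f
  exact ⟨D.perp U, D.perp W, D.perp_anti hUW, IsDual.nonempty_equiv
    ((D.isDual_subquotient W U).congr f (LinearEquiv.refl A _)) hS⟩

/-- For a submodule U of M', its annihilator in M is dual to M'/U, and the quotient of M by that
annihilator is dual to U. Thus containing T but not all of S becomes containing S but not all of T.
-/
theorem Duality.loewyLE [FiniteDimensional ℂ M] (D : Duality σ M M') (hS : IsDual σ S S)
    (hT : IsDual σ T T) (h : LoewyLE A M S T) : LoewyLE A M' T S := by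
  intro U hU hU'
  have := D.finite_right
  have := finite_submodule U
  refine h (D.symm.perp U) (hU'.of_isDual (D.symm.isDual_quotient U) hS) ?_
  exact hU.of_isDual (D.symm.isDual_submodule U) hT

theorem Duality.loewyLE_iff [FiniteDimensional ℂ M] (D : Duality σ M M') (hS : IsDual σ S S)
    (hT : IsDual σ T T) : LoewyLE A M S T ↔ LoewyLE A M' T S :=
  have := D.finite_right
  ⟨D.loewyLE hS hT, D.symm.loewyLE hT hS⟩

theorem LoewyLE.congr {S' T' : Type*} [AddCommGroup S'] [Module A S'] [AddCommGroup T']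
    [Module A T'] (f : S ≃ₗ[A] S') (g : T ≃ₗ[A] T') (h : LoewyLE A M S T) : LoewyLE A M S' T' := by
  rintro U ⟨W, V, hV, ⟨k⟩⟩ ⟨W', V', hV', ⟨k'⟩⟩
  exact h U ⟨W, V, hV, ⟨k.trans f.symm⟩⟩ ⟨W', V', hV', ⟨k'.trans g.symm⟩⟩

/-- Dual modules all of whose composition factors are self-dual have opposite Loewy diagrams. -/
theorem Duality.loewyReciprocal [FiniteDimensional ℂ M] (D : Duality σ M M')
    (hM : ∀ U W : Submodule A M, U ⋖ W → IsDual σ (W ⧸ U.submoduleOf W) (W ⧸ U.submoduleOf W)) :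
    LoewyReciprocal A M M' := by
  have hA : IsNoetherian A M := isNoetherian_of_tower ℂ inferInstance
  have hA' : IsArtinian A M := isArtinian_of_tower ℂ inferInstance
  obtain ⟨s, s0, s1⟩ := exists_compositionSeries_of_isNoetherian_isArtinian A M
  -- The annihilators of a composition series of M, in reverse order, form a composition series of
  -- M', and `Fin.rev` matches the factors.
  let t : CompositionSeries (Submodule A M') := ⟨s.length, fun i => D.perp (s i.rev), fun i => by
    rw [Fin.rev_castSucc, Fin.rev_succ]
    exact D.perp_covBy (s.step i.rev)⟩
  have hs : ∀ i, IsDual σ (seriesFactor s i) (seriesFactor s i) := fun i => hM _ _ (s.step i)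
  have hfin : ∀ i, FiniteDimensional ℂ (seriesFactor s i) := fun i => by
    have := finite_submodule (s i.succ)
    infer_instance
  have hst : ∀ i : Fin s.length, Nonempty (seriesFactor s i ≃ₗ[A] seriesFactor t i.rev) := by
    intro i
    have key : ∀ W' U' : Submodule A M', W' = D.perp (s i.castSucc) → U' = D.perp (s i.succ) →
        Nonempty (seriesFactor s i ≃ₗ[A] (W' ⧸ U'.submoduleOf W')) := by
      rintro _ _ rfl rfl
      have := hfin i
      exact (hs i).nonempty_equiv (D.isDual_subquotient _ _)
    refine key _ _ ?_ ?_
    · change D.perp (s (Fin.rev (Fin.succ (Fin.rev i)))) = _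
      rw [Fin.rev_succ, Fin.rev_rev]
    · change D.perp (s (Fin.rev (Fin.castSucc (Fin.rev i)))) = _
      rw [Fin.rev_castSucc, Fin.rev_rev]
  have f := fun i => (hst i).some
  have hle : ∀ i j : Fin s.length, SeriesLE s i j ↔ SeriesLE t j.rev i.rev := by
    intro i j
    refine (D.loewyLE_iff (hs i) (hs j)).trans ⟨fun h => ?_, fun h => ?_⟩
    · exact h.congr (f j) (f i)
    · exact h.congr (f j).symm (f i).symm
  have hiso : ∀ i j : Fin s.length, Nonempty (seriesFactor s i ≃ₗ[A] seriesFactor s j) ↔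
      Nonempty (seriesFactor t i.rev ≃ₗ[A] seriesFactor t j.rev) := fun i j =>
    ⟨fun ⟨g⟩ => ⟨((f i).symm.trans g).trans (f j)⟩,
      fun ⟨g⟩ => ⟨((f i).trans g).trans (f j).symm⟩⟩
  have hsymm : ∀ i j : Fin s.length, Nonempty (seriesFactor s i ≃ₗ[A] seriesFactor s j) ↔
      Nonempty (seriesFactor s j ≃ₗ[A] seriesFactor s i) := fun i j =>
    ⟨fun ⟨g⟩ => ⟨g.symm⟩, fun ⟨g⟩ => ⟨g.symm⟩⟩
  refine ⟨s, t, Fin.revPerm, s0, s1, ?_, ?_, hst, fun i j => ⟨hle i j, ?_⟩⟩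
  · change D.perp (s (Fin.rev 0)) = ⊥
    rw [Fin.rev_zero]
    change D.perp s.last = ⊥
    rw [s1]
    exact (Submodule.eq_bot_iff _).mpr fun w hw => D.right w fun v => hw v trivial
  · change D.perp (s (Fin.rev (Fin.last _))) = ⊤
    rw [Fin.rev_last]
    change D.perp s.head = ⊤
    rw [s0]
    refine Submodule.eq_top_iff'.mpr fun w u hu => ?_
    rw [(Submodule.mem_bot A).mp hu]
    simp
  · change (_ ∧ _ ∧ _) ↔ (_ ∧ _ ∧ _)
    refine and_congr (hle i j) (and_congr ?_ ?_)
    · rw [← not_nonempty_iff, ← not_nonempty_iff, hsymm, hiso]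
      rfl
    · refine Fin.revPerm.forall_congr fun k => ?_
      change (SeriesLE s i k → SeriesLE s k j → _) ↔ (SeriesLE t j.rev k.rev →
        SeriesLE t k.rev i.rev → Nonempty (seriesFactor t k.rev ≃ₗ[A] seriesFactor t j.rev) ∨
        Nonempty (seriesFactor t k.rev ≃ₗ[A] seriesFactor t i.rev))
      rw [hle i k, hle k j, hiso, hiso]
      tauto

end Loewy

/-- A finite-dimensional semisimple module is self-dual if its simple submodules are. -/
theorem isDual_of_isSemisimple [FiniteDimensional ℂ M] [IsSemisimpleModule A M]
    (hM : ∀ S : Submodule A M, IsSimpleModule A S → IsDual σ S S) : IsDual σ M M := by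
  have hA : IsNoetherian A M := isNoetherian_of_tower ℂ inferInstance
  obtain ⟨n, S, e, hS⟩ := IsSemisimpleModule.exists_linearEquiv_fin_dfinsupp A M
  have D := fun i => (hM (S i) (hS i)).some
  let π : ∀ i, M →ₗ[A] S i := fun i => (DFinsupp.lapply i) ∘ₗ e.toLinearMap
  have hπ : ∀ v, (∀ i, π i v = 0) → v = 0 := fun v hv =>
    e.map_eq_zero_iff.mp (DFinsupp.ext hv)
  have hι : ∀ i x, ∃ v, π i v = x ∧ ∀ j, j ≠ i → π j v = 0 := fun i x => by
    refine ⟨e.symm (DFinsupp.single i x), ?_, fun j hj => ?_⟩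
    · simp [π]
    · simp [π, DFinsupp.single_eq_of_ne hj]
  -- The orthogonal sum of the forms of the simple summands; only nondegeneracy of each one is used,
  -- so isotypic components need no separate treatment.
  let B : M →ₗ[ℂ] M →ₗ[ℂ] ℂ :=
    ∑ i, (D i).form.compl₁₂ ((π i).restrictScalars ℂ) ((π i).restrictScalars ℂ)
  have hB : ∀ v w, B v w = ∑ i, (D i).form (π i v) (π i w) := fun v w => by
    simp [B, LinearMap.sum_apply]
  refine ⟨⟨B, fun a v w => ?_, fun a v w => ?_, fun v hv => ?_, fun w hw => ?_⟩⟩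
  · simp only [hB, map_smul, (D _).smul_left]
  · simp only [hB, map_smul, (D _).smul_right]
  · refine hπ v fun i => (D i).left _ fun x => ?_
    obtain ⟨w, hw, hw'⟩ := hι i x
    have := hv w
    rwa [hB, Finset.sum_eq_single i (fun j _ hj => by rw [hw' j hj, map_zero]) (by simp), hw]
      at this
  · refine hπ w fun i => (D i).right _ fun x => ?_
    obtain ⟨v, hv, hv'⟩ := hι i x
    have := hw v
    rwa [hB, Finset.sum_eq_single i (fun j _ hj => by rw [hv' j hj]; simp) (by simp), hv]
      at this

end Duality

end AffineTL

namespace AffineTL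

/-! ### Passage to modules over the affine Temperley-Lieb algebra: simple modules are self-dual. -/

section SimpleModules

theorem Rels.map {N : ℕ} {β : ℂ} {A B : Type*} [Ring A] [Algebra ℂ A] [Ring B] [Algebra ℂ B]
    {e : 2 ≤ N → ZMod N → A} {o oi : A} (H : Rels N β e o oi) (ρ : A →ₐ[ℂ] B) :
    Rels N β (fun h i => ρ (e h i)) (ρ o) (ρ oi) where
  mul_inv := by rw [← map_mul, H.mul_inv, map_one]
  inv_mul := by rw [← map_mul, H.inv_mul, map_one]
  rot h i := by rw [← map_mul, H.rot, map_mul]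
  sq h i := by rw [← map_mul, H.sq, map_smul]
  up h h3 i := by rw [← map_mul, ← map_mul, H.up h h3]
  down h h3 i := by rw [← map_mul, ← map_mul, H.down h h3]
  comm h h3 i j h1 h2 h4 := by rw [← map_mul, H.comm h h3 i j h1 h2 h4, map_mul]
  pow h h3 := by rw [← map_mul, ← map_pow, H.pow h h3, map_mul, map_pow]
  powInv h h3 := by rw [← map_mul, ← map_pow, H.powInv h h3, map_mul, map_pow]
  two_left h h2 := by rw [← map_pow, ← map_mul, H.two_left h h2]
  two_right h h2 := by rw [← map_pow, ← map_mul, H.two_right h h2]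

section
variable {N : ℕ} {β : ℂ} {A : Type*} [Ring A] [Algebra ℂ A]
  {e : 2 ≤ N → ZMod N → A} {o oi : A} (H : Rels N β e o oi)

/-- The unit `Ω`. -/
@[simps] def Rels.unit : Aˣ := ⟨o, oi, H.mul_inv, H.inv_mul⟩

theorem Rels.tr_unit (h i) (j : ℤ) : tr H.unit (e h i) j = e h (i + j) := by
  have key : (↑(H.unit ^ (-j)) : A) * e h i = e h (i + j) * ↑(H.unit ^ (-j)) := by
    obtain ⟨m, rfl | rfl⟩ := j.eq_nat_or_neg
    · have e1 : (↑(H.unit ^ (-(m : ℤ))) : A) = oi ^ m := by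
        rw [zpow_neg, zpow_natCast, ← inv_pow, Units.val_pow_eq_pow_val]; rfl
      rw [e1, ATL.omInv_pow_e H]
      simp
    · have e1 : (↑(H.unit ^ (-(-(m : ℤ)))) : A) = o ^ m := by
        rw [neg_neg, zpow_natCast, Units.val_pow_eq_pow_val]; rfl
      rw [e1, ATL.om_pow_e H]
      simp [sub_eq_add_neg]
  rw [tr, key, zpow_neg, mul_assoc, Units.inv_mul, mul_one]

/-- The generator `e 0`, or zero if `N ≤ 1`. -/
def Rels.base (_H : Rels N β e o oi) : A := if h : 2 ≤ N then e h 0 else 0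

theorem Rels.base_of_le (h : 2 ≤ N) : H.base = e h 0 := dif_pos h

/-- Since all e_i are conjugates of e₀ by powers of Ω, the relations needed in the induction can be
stated through e₀ and Ω alone. -/
theorem Rels.tLRel : TLRel N β H.base H.unit := by
  by_cases h : 2 ≤ N
  · rw [H.base_of_le h]
    refine ⟨fun h1 => by omega, ?_, H.sq h 0, fun h3 => ?_, fun h3 => ?_, fun k hk hk' => ?_⟩
    · rw [Units.val_pow_eq_pow_val]
      change o ^ N * _ = _ * o ^ N
      rw [ATL.om_pow_e H]
      simp
    · rw [H.tr_unit]
      simpa using H.up h h3 0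
    · rw [H.tr_unit]
      simpa [sub_eq_add_neg] using H.down h h3 0
    · rw [H.tr_unit]
      -- As 2 ≤ k ≤ N-2, none of k-1, k, k+1 is divisible by N, so sites 0 and k are neither equal
      -- nor neighbours on the circle.
      have hc : ∀ m : ℕ, m ≤ N → m ≠ 0 → m ≠ N → (m : ZMod N) ≠ 0 := by
        intro m h1 h2 h3 h4
        have := Nat.le_of_dvd (by omega) ((ZMod.natCast_eq_zero_iff _ _).mp h4)
        omega
      refine H.comm h (by omega) _ _ ?_ ?_ ?_
      · have := hc k (by omega) (by omega) (by omega)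
        simpa using this.symm
      · intro h1
        refine hc (k - 1) (by omega) (by omega) (by omega) ?_
        rw [Nat.cast_sub (by omega)]
        push_cast at h1 ⊢
        linear_combination h1
      · intro h1
        refine hc (k + 1) (by omega) (by omega) (by omega) ?_
        push_cast at h1 ⊢
        linear_combination h1
  · rw [Rels.base, dif_neg h]
    refine ⟨fun _ => rfl, by simp, by simp, by simp, by simp, by simp⟩

end

namespace ATL

variable (N : ℕ) (β : ℂ)

/-- The anti-involution that fixes `Ω` and maps `e i` to `e (-i)`. -/
noncomputable def sigma (a : ATL N β) : ATL N β := (dagger N β (flip N β a)).unop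

variable {N β}

theorem sigma_mul (a b : ATL N β) : sigma N β (a * b) = sigma N β b * sigma N β a := by
  simp [sigma]

theorem sigma_add (a b : ATL N β) : sigma N β (a + b) = sigma N β a + sigma N β b := by
  simp [sigma]

theorem sigma_algebraMap (c : ℂ) : sigma N β (algebraMap ℂ _ c) = algebraMap ℂ _ c := by
  simp [sigma]

theorem sigma_e (h i) : sigma N β (gen N β (.e h i)) = gen N β (.e h (-i)) := by
  rw [sigma, flip, lift_e, dagger, lift_e, MulOpposite.unop_op]

theorem sigma_om : sigma N β (gen N β .om) = gen N β .om := by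
  rw [sigma, flip, lift_om, dagger, lift_omInv, MulOpposite.unop_op]

theorem sigma_omInv : sigma N β (gen N β .omInv) = gen N β .omInv := by
  rw [sigma, flip, lift_omInv, dagger, lift_om, MulOpposite.unop_op]

theorem sigma_sigma (a : ATL N β) : sigma N β (sigma N β a) = a := by
  induction a using ATL.induction with
  | hc c => rw [sigma_algebraMap, sigma_algebraMap]
  | ha a b iha ihb => rw [sigma_add, sigma_add, iha, ihb]
  | hm a b iha ihb => rw [sigma_mul, sigma_mul, iha, ihb]
  | hg g =>
    cases g with
    | e h i => rw [sigma_e, sigma_e, neg_neg]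
    | om => rw [sigma_om, sigma_om]
    | omInv => rw [sigma_omInv, sigma_omInv]

/-- The generators `e 0`, `Ω`, `Ω⁻¹` generate the algebra. -/
theorem induction_base [NeZero N] {P : ATL N β → Prop} (h0 : P (gen_rels N β).base)
    (h1 : P (gen N β .om)) (h2 : P (gen N β .omInv))
    (hc : ∀ c : ℂ, P (algebraMap ℂ _ c)) (ha : ∀ a b, P a → P b → P (a + b))
    (hm : ∀ a b, P a → P b → P (a * b)) (a : ATL N β) : P a := by
  refine ATL.induction (fun g => ?_) hc ha hm a
  have hpow : ∀ x, P x → ∀ m : ℕ, P (x ^ m) := by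
    intro x hx m
    induction m with
    | zero => simpa using hc 1
    | succ m ih => rw [pow_succ]; exact hm _ _ ih hx
  cases g with
  | om => exact h1
  | omInv => exact h2
  | e h i =>
    rw [Rels.base_of_le _ h] at h0
    have e1 := (gen_rels N β).tr_unit h 0 (i.val : ℤ)
    rw [tr, zpow_neg, zpow_natCast, ← inv_pow, Units.val_pow_eq_pow_val,
      Units.val_pow_eq_pow_val] at e1
    rw [zero_add, Int.cast_natCast, ZMod.natCast_zmod_val] at e1
    rw [← e1]
    exact hm _ _ (hm _ _ (hpow _ h2 _) h0) (hpow _ h1 _)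

end ATL

variable {N : ℕ} {β : ℂ}

/-- Adjointness for the generators implies adjointness for the whole algebra. -/
theorem adjoint_of_gen [NeZero N] {M M' : Type*} [AddCommGroup M] [Module ℂ M] [Module (ATL N β) M]
    [IsScalarTower ℂ (ATL N β) M] [AddCommGroup M'] [Module ℂ M'] [Module (ATL N β) M']
    [IsScalarTower ℂ (ATL N β) M'] (B : M →ₗ[ℂ] M' →ₗ[ℂ] ℂ)
    (h0 : ∀ v w, B ((ATL.gen_rels N β).base • v) w = B v ((ATL.gen_rels N β).base • w))
    (h1 : ∀ v w, B (ATL.gen N β .om • v) w = B v (ATL.gen N β .om • w))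
    (a : ATL N β) (v : M) (w : M') : B (a • v) w = B v (ATL.sigma N β a • w) := by
  induction a using ATL.induction_base generalizing v w with
  | h0 =>
    rw [h0]
    by_cases h : 2 ≤ N
    · rw [Rels.base_of_le _ h, ATL.sigma_e, neg_zero]
    · rw [Rels.base, dif_neg h]
      simp [ATL.sigma]
  | h1 => rw [h1, ATL.sigma_om]
  | h2 =>
    have H := ATL.gen_rels N β
    rw [ATL.sigma_omInv]
    -- Self-adjointness of Ω, applied to Ω⁻¹v and Ω⁻¹w, is self-adjointness of Ω⁻¹.
    have := h1 (ATL.gen N β .omInv • v) (ATL.gen N β .omInv • w)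
    rwa [← mul_smul, H.mul_inv, one_smul, ← mul_smul, H.mul_inv, one_smul, eq_comm] at this
  | hc c =>
    rw [ATL.sigma_algebraMap, algebraMap_smul, algebraMap_smul, map_smul, map_smul,
      LinearMap.smul_apply]
  | ha a b iha ihb =>
    rw [add_smul, map_add, LinearMap.add_apply, iha, ihb, ATL.sigma_add, add_smul, map_add]
  | hm a b iha ihb => rw [mul_smul, iha, ihb, ATL.sigma_mul, mul_smul]

/-- Every finite-dimensional simple module is self-dual. -/
theorem isDual_of_isSimple [NeZero N] (S : Type*) [AddCommGroup S] [Module ℂ S]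
    [Module (ATL N β) S] [IsScalarTower ℂ (ATL N β) S] [FiniteDimensional ℂ S]
    [IsSimpleModule (ATL N β) S] : IsDual (ATL.sigma N β) S S := by
  let ρ : ATL N β →ₐ[ℂ] Module.End ℂ S := Algebra.lsmul ℂ ℂ S
  let H := (ATL.gen_rels N β).map ρ
  have hbase : H.base = ρ (ATL.gen_rels N β).base := by
    by_cases h : 2 ≤ N
    · rw [Rels.base_of_le _ h, Rels.base_of_le _ h]
    · rw [Rels.base, Rels.base, dif_neg h, dif_neg h, map_zero]
  have hnt : Nontrivial S := IsSimpleModule.nontrivial (ATL N β) S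
  have irr : OpIrreducible H.base H.unit := by
    intro W h0 h1 h2
    have hW : ∀ (a : ATL N β), ∀ v ∈ W, a • v ∈ W := by
      intro a
      induction a using ATL.induction_base with
      | h0 => intro v hv; have := h0 v hv; rwa [hbase] at this
      | h1 => exact h1
      | h2 => exact h2
      | hc c => intro v hv; rw [algebraMap_smul]; exact W.smul_mem c hv
      | ha a b iha ihb => intro v hv; rw [add_smul]; exact W.add_mem (iha v hv) (ihb v hv)
      | hm a b iha ihb => intro v hv; rw [mul_smul]; exact iha _ (ihb v hv)
    let W' : Submodule (ATL N β) S := { W with smul_mem' := fun a v hv => hW a v hv }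
    rcases eq_bot_or_eq_top W' with h | h
    · left
      refine (Submodule.eq_bot_iff _).mpr fun v hv => ?_
      have : v ∈ W' := hv
      rwa [h, Submodule.mem_bot] at this
    · right
      refine Submodule.eq_top_iff'.mpr fun v => ?_
      have : v ∈ W' := h ▸ Submodule.mem_top
      exact this
  obtain ⟨B, hB, hs, he, hu⟩ := TLRel.hasSymmForm N (Nat.pos_of_ne_zero (NeZero.ne N)) S _ _
    H.tLRel irr
  rw [hbase] at he
  have hadj := adjoint_of_gen B he hu
  -- The radical of an invariant form is a submodule, and B ≠ 0 keeps it from being everything;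
  -- simplicity makes it zero.
  have hleft : ∀ v, (∀ w, B v w = 0) → v = 0 := by
    let K : Submodule (ATL N β) S :=
      { carrier := {v | ∀ w, B v w = 0}
        add_mem' := fun {v v'} h h' w => by rw [map_add, LinearMap.add_apply, h w, h' w, add_zero]
        zero_mem' := fun w => by simp
        smul_mem' := fun a v h w => by rw [hadj, h] }
    rcases eq_bot_or_eq_top K with h | h
    · intro v hv
      have : v ∈ K := hv
      rwa [h, Submodule.mem_bot] at this
    · refine absurd (LinearMap.ext fun v => LinearMap.ext fun w => ?_) hB
      have : v ∈ K := h ▸ Submodule.mem_top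
      exact this w
  refine ⟨⟨B, hadj, fun a v w => ?_, hleft, fun w hw => hleft w fun v => by rw [hs, hw]⟩⟩
  rw [hadj, ATL.sigma_sigma]

/-- The pairing between a module and its twisted dual. -/
theorem isDual_circTwist_starDual (M : Type*) [AddCommGroup M] [Module ℂ M]
    [Module (ATL N β) M] [IsScalarTower ℂ (ATL N β) M] :
    IsDual (ATL.sigma N β) M (CircTwist (StarDual M)) := by
  let B : M →ₗ[ℂ] CircTwist (StarDual M) →ₗ[ℂ] ℂ :=
    (((StarDual.equiv M).toLinearMap ∘ₗ (CircTwist.equiv (StarDual M)).toLinearMap)).flip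
  have hB : ∀ v f, B v f = StarDual.equiv M (CircTwist.equiv _ f) v := fun v f => rfl
  have hr : ∀ (a : ATL N β) v f, B v (a • f) = B (ATL.sigma N β a • v) f := by
    intro a v f
    rw [hB, CircTwist.equiv_smul, StarDual.smul_apply]
    rfl
  refine ⟨⟨B, fun a v f => ?_, hr, fun v hv => ?_, fun f hf => ?_⟩⟩
  · rw [hr, ATL.sigma_sigma]
  · refine (Module.forall_dual_apply_eq_zero_iff ℂ v).mp fun f => ?_
    exact hv ((CircTwist.equiv (StarDual M)).symm ((StarDual.equiv M).symm f))
  · exact (CircTwist.equiv _).injective (StarDual.ext' M fun v => hf v)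

end SimpleModules

end AffineTL

namespace AffineTL

set_option linter.unusedSectionVars false

/-! ### The isomorphisms between spin chains and the opposite Loewy diagrams of X⁺ and X⁻. -/

section SpinChain

namespace ATL

variable {N : ℕ} {β : ℂ}

theorem dagger_dagger (a : ATL N β) : (dagger N β (dagger N β a).unop).unop = a := by
  induction a using ATL.induction with
  | hc c => simp
  | ha a b iha ihb => simp [iha, ihb]
  | hm a b iha ihb => simp [iha, ihb]
  | hg g =>
    cases g with
    | e h i =>
      rw [dagger, lift_e, MulOpposite.unop_op, lift_e, MulOpposite.unop_op]
    | om => rw [dagger, lift_om, MulOpposite.unop_op, lift_omInv, MulOpposite.unop_op]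
    | omInv => rw [dagger, lift_omInv, MulOpposite.unop_op, lift_om, MulOpposite.unop_op]

theorem dagger_base : dagger N β (gen_rels N β).base = .op (gen_rels N β).base := by
  by_cases h : 2 ≤ N
  · rw [Rels.base_of_le _ h, dagger, lift_e]
  · rw [Rels.base, dif_neg h, map_zero, MulOpposite.op_zero]

theorem flip_base : flip N β (gen_rels N β).base = (gen_rels N β).base := by
  by_cases h : 2 ≤ N
  · rw [Rels.base_of_le _ h, flip, lift_e, neg_zero]
  · rw [Rels.base, dif_neg h, map_zero]

end ATL

variable {N : ℕ} {β : ℂ}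

/-- A linear map that commutes with `e 0` and `Ω` up to an algebra homomorphism `φ`. -/
theorem map_smul_of_gen [NeZero N] {M M' : Type*} [AddCommGroup M] [Module ℂ M]
    [Module (ATL N β) M] [IsScalarTower ℂ (ATL N β) M] [AddCommGroup M'] [Module ℂ M']
    [Module (ATL N β) M'] [IsScalarTower ℂ (ATL N β) M'] (φ : ATL N β →ₐ[ℂ] ATL N β)
    (f : M →ₗ[ℂ] M')
    (h0 : ∀ v, f (φ (ATL.gen_rels N β).base • v) = (ATL.gen_rels N β).base • f v)
    (h1 : ∀ v, f (φ (ATL.gen N β .om) • v) = ATL.gen N β .om • f v)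
    (a : ATL N β) (v : M) : f (φ a • v) = a • f v := by
  have H := ATL.gen_rels N β
  induction a using ATL.induction_base generalizing v with
  | h0 => exact h0 v
  | h1 => exact h1 v
  | h2 =>
    have := h1 (φ (ATL.gen N β .omInv) • v)
    rw [← mul_smul, ← map_mul, H.mul_inv, map_one, one_smul] at this
    rw [this, ← mul_smul, H.inv_mul, one_smul]
  | hc c => rw [AlgHom.commutes, algebraMap_smul, algebraMap_smul, map_smul]
  | ha a b iha ihb => rw [map_add, add_smul, map_add, iha, ihb, add_smul]
  | hm a b iha ihb => rw [map_mul, mul_smul, iha, ihb, mul_smul]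

variable {q z : ℂˣ} {ε : ℤˣ}

theorem XXZ.vec_om (v : XXZ N q z ε) :
    XXZ.vec (ATL.gen N (beta q) .om • v) = xxzOm N z (XXZ.vec v) := by
  rw [XXZ.vec_smul, ATL.lift_om]

theorem XXZ.vec_omInv (v : XXZ N q z ε) :
    XXZ.vec (ATL.gen N (beta q) .omInv • v) = xxzOmInv N z (XXZ.vec v) := by
  rw [XXZ.vec_smul, ATL.lift_omInv]

theorem XXZ.vec_base (h : 2 ≤ N) (v : XXZ N q z ε) :
    XXZ.vec ((ATL.gen_rels N (beta q)).base • v) = xxzE q z ε 0 (XXZ.vec v) := by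
  rw [Rels.base_of_le _ h, XXZ.vec_smul, ATL.lift_e]

theorem base_eq_zero (h : ¬ 2 ≤ N) : (ATL.gen_rels N β).base = 0 := dif_neg h

variable [NeZero N]

instance : FiniteDimensional ℂ (XXZ N q z ε) :=
  Module.Finite.equiv (XXZ.vec (N := N) (q := q) (z := z) (ε := ε)).symm

instance (d : ℤ) : FiniteDimensional ℂ (XXZd N q z ε d) := finite_submodule _

theorem mem_XXZd {d : ℤ} {v : XXZ N q z ε} :
    v ∈ XXZd N q z ε d ↔ totalSpin N (XXZ.vec v) = ((d : ℂ) / 2) • XXZ.vec v := Iff.rfl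

/-! ### The spin flip -/

theorem spinFlip_spinFlip (v : SpinSpace N) : spinFlip N (spinFlip N v) = v := by
  have : spinFlip N * spinFlip N = 1 := ket_ext fun x => by simp [spinFlip]
  exact LinearMap.congr_fun this v

theorem spinFlip_om : spinFlip N * xxzOm N z = xxzOm N z⁻¹ * spinFlip N := by
  refine ket_ext fun x => ?_
  simp only [spinFlip, xxzOm, Module.End.mul_apply, onKets_ket, map_smul, Pi.neg_apply]
  congr 1
  simp

theorem spinFlip_e (h : 2 ≤ N) (i : ZMod N) :
    spinFlip N * xxzE q z ε i = xxzE q z⁻¹ (-ε) i * spinFlip N := by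
  have hq : (q : ℂ) ≠ 0 := q.ne_zero
  have ht : (twist z i : ℂ) ≠ 0 := (twist z i).ne_zero
  have htz : (twist z⁻¹ i : ℂ) = (twist z i : ℂ)⁻¹ := by
    simp only [twist]
    split_ifs <;> simp
  have hn : (-1 : ℤˣ) ≠ 1 := by decide
  have hp : ∀ (x : ZMod N → ℤˣ) a, -put x i (i + 1) a = put (-x) i (i + 1) (-a) := by
    intro x a
    funext j
    simp only [put, Function.update_apply, Pi.neg_apply, neg_neg]
    split_ifs <;> simp
  refine ket_ext fun x => ?_
  simp only [Module.End.mul_apply, xxzE_ket q z ε h, spinFlip, onKets_ket,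
    xxzE_ket q z⁻¹ (-ε) h, Pi.neg_apply, neg_inj]
  split_ifs with h1
  · simp only [singlet, map_smul, map_add, onKets_ket, hp, neg_neg]
    rcases Int.units_eq_one_or ε with rfl | rfl <;>
    rcases Int.units_eq_one_or (x i) with h2 | h2 <;>
    simp [h2, cpl, cph, htz, hn, smul_smul] <;> field_simp <;> rw [add_comm]
  · simp

theorem totalSpin_spinFlip (v : SpinSpace N) :
    totalSpin N (spinFlip N v) = -spinFlip N (totalSpin N v) := by
  have : totalSpin N * spinFlip N = -(spinFlip N * totalSpin N) := by
    refine ket_ext fun x => ?_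
    simp only [spinFlip, Module.End.mul_apply, LinearMap.neg_apply, onKets_ket, totalSpin_ket,
      map_smul, Pi.neg_apply, Units.val_neg, Finset.sum_neg_distrib, ← neg_smul]
    congr 1
    push_cast
    ring
  exact LinearMap.congr_fun this v

/-- The spin flip intertwines `X^ε_z` and `X^{-ε}_{z⁻¹}`. -/
noncomputable def spinFlipEquiv (N : ℕ) [NeZero N] (q z : ℂˣ) (ε : ℤˣ) (d : ℤ) :
    XXZd N q z ε d ≃ₗ[ATL N (beta q)] XXZd N q z⁻¹ (-ε) (-d) where
  toFun v := ⟨XXZ.vec.symm (spinFlip N (XXZ.vec (v : XXZ N q z ε))), by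
    rw [mem_XXZd, LinearEquiv.apply_symm_apply, totalSpin_spinFlip, mem_XXZd.mp v.2, map_smul,
      ← neg_smul]
    congr 1
    push_cast
    ring⟩
  map_add' v w := Subtype.ext (by simp)
  map_smul' a v := by
    refine Subtype.ext ?_
    refine map_smul_of_gen (.id ℂ _) (XXZ.vec.symm.toLinearMap ∘ₗ spinFlip N ∘ₗ
      (XXZ.vec (N := N) (q := q) (z := z) (ε := ε)).toLinearMap : XXZ N q z ε →ₗ[ℂ]
        XXZ N q z⁻¹ (-ε)) (fun v => ?_) (fun v => ?_) a v
    · by_cases h : 2 ≤ N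
      · refine XXZ.vec.injective ?_
        rw [XXZ.vec_base h]
        have := LinearMap.congr_fun (spinFlip_e (q := q) (z := z) (ε := ε) h 0) (XXZ.vec v)
        refine Eq.trans ?_ this
        rw [AlgHom.id_apply]
        exact congrArg (spinFlip N) (XXZ.vec_base h v)
      · simp [base_eq_zero h]
    · refine XXZ.vec.injective ?_
      rw [XXZ.vec_om]
      have := LinearMap.congr_fun (spinFlip_om (N := N) (z := z)) (XXZ.vec v)
      refine Eq.trans ?_ this
      rw [AlgHom.id_apply]
      exact congrArg (spinFlip N) (XXZ.vec_om v)
  invFun v := ⟨XXZ.vec.symm (spinFlip N (XXZ.vec (v : XXZ N q z⁻¹ (-ε)))), by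
    rw [mem_XXZd, LinearEquiv.apply_symm_apply, totalSpin_spinFlip, mem_XXZd.mp v.2, map_smul,
      ← neg_smul]
    congr 1
    push_cast
    ring⟩
  left_inv v := Subtype.ext (by simp [spinFlip_spinFlip])
  right_inv v := Subtype.ext (by simp [spinFlip_spinFlip])

/-! ### The reflection -/

theorem totalSpin_reflect (v : SpinSpace N) :
    totalSpin N (reflect N v) = reflect N (totalSpin N v) := by
  have : totalSpin N * reflect N = reflect N * totalSpin N := by
    refine ket_ext fun x => ?_
    simp only [reflect, Module.End.mul_apply, onKets_ket, totalSpin_ket, map_smul]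
    rw [show ∑ j, (x (1 - j) : ℤ) = ∑ j, (x j : ℤ) from
      Equiv.sum_comp (Equiv.subLeft (1 : ZMod N)) fun j => (x j : ℤ)]
  exact LinearMap.congr_fun this v

theorem reflect_reflect_apply (v : SpinSpace N) : reflect N (reflect N v) = v :=
  LinearMap.congr_fun reflect_reflect v

/-- The reflection intertwines `(X^ε_z)∘` and `X^{-ε}_{z⁻¹}`. -/
noncomputable def reflectEquiv (N : ℕ) [NeZero N] (q z : ℂˣ) (ε : ℤˣ) (d : ℤ) :
    CircTwist (XXZd N q z ε d) ≃ₗ[ATL N (beta q)] XXZd N q z⁻¹ (-ε) d where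
  toFun v := ⟨XXZ.vec.symm (reflect N (XXZ.vec (CircTwist.equiv (XXZd N q z ε d) v : XXZ N q z ε))), by
    rw [mem_XXZd, LinearEquiv.apply_symm_apply, totalSpin_reflect,
      mem_XXZd.mp (CircTwist.equiv _ v).2, map_smul]⟩
  map_add' v w := Subtype.ext (by simp)
  map_smul' a v := by
    refine Subtype.ext ?_
    rw [CircTwist.equiv_smul]
    refine map_smul_of_gen (ATL.flip N (beta q)) (XXZ.vec.symm.toLinearMap ∘ₗ reflect N ∘ₗ
      (XXZ.vec (N := N) (q := q) (z := z) (ε := ε)).toLinearMap : XXZ N q z ε →ₗ[ℂ]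
        XXZ N q z⁻¹ (-ε)) (fun v => ?_) (fun v => ?_) a _
    · by_cases h : 2 ≤ N
      · refine XXZ.vec.injective ?_
        rw [XXZ.vec_base h, ATL.flip_base]
        have := LinearMap.congr_fun (reflect_e q z ε h) (XXZ.vec v)
        refine Eq.trans ?_ this
        exact congrArg (reflect N) (XXZ.vec_base h v)
      · simp [base_eq_zero h]
    · refine XXZ.vec.injective ?_
      rw [XXZ.vec_om, ATL.flip, ATL.lift_om]
      have := LinearMap.congr_fun (reflect_om (N := N) z) (XXZ.vec v)
      refine Eq.trans ?_ this
      exact congrArg (reflect N) (XXZ.vec_omInv v)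
  invFun v := (CircTwist.equiv _).symm
    ⟨XXZ.vec.symm (reflect N (XXZ.vec (v : XXZ N q z⁻¹ (-ε)))), by
      rw [mem_XXZd, LinearEquiv.apply_symm_apply, totalSpin_reflect, mem_XXZd.mp v.2, map_smul]⟩
  left_inv v := (CircTwist.equiv _).injective (Subtype.ext (by simp [reflect_reflect_apply]))
  right_inv v := Subtype.ext (by simp [reflect_reflect_apply])

/-! ### The transposition -/

/-- The bilinear form for which the spin basis is orthonormal. -/
noncomputable def ketForm (N : ℕ) : SpinSpace N →ₗ[ℂ] SpinSpace N →ₗ[ℂ] ℂ :=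
  Finsupp.linearCombination ℂ fun x => Finsupp.lapply x

theorem ketForm_ket (x : ZMod N → ℤˣ) (w : SpinSpace N) : ketForm N (ket x) w = w x := by
  simp [ketForm, ket]

theorem ketForm_symm (v w : SpinSpace N) : ketForm N v w = ketForm N w v := by
  have : ketForm N = (ketForm N).flip := by
    refine ket_ext fun x => ket_ext fun y => ?_
    rw [LinearMap.flip_apply, ketForm_ket, ketForm_ket, ket, ket, Finsupp.single_apply,
      Finsupp.single_apply]
    simp only [eq_comm]
  exact LinearMap.congr_fun₂ this v w

theorem put_eq_iff (h : 2 ≤ N) {x y : ZMod N → ℤˣ} {i : ZMod N} {a : ℤˣ} :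
    put x i (i + 1) a = y ↔
      y i = a ∧ y (i + 1) = -y i ∧ ∀ j, j ≠ i → j ≠ i + 1 → x j = y j := by
  constructor
  · rintro rfl
    exact ⟨put_fst h x i a, by rw [put_snd, put_fst h],
      fun j h1 h2 => (put_of_ne x a h1 h2).symm⟩
  · rintro ⟨rfl, h1, h2⟩
    funext j
    by_cases h3 : j = i
    · rw [h3, put_fst h]
    by_cases h4 : j = i + 1
    · rw [h4, put_snd, h1]
    rw [put_of_ne x _ h3 h4, h2 j h3 h4]

/-- On the spins at i and i+1 the operator has rank one, so a nonzero matrix element is a factor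
depending on the old spin times one depending on the new spin. Comparing with the transposed matrix
is then a check over the values of two spins. -/
theorem xxzE_ket_apply (h : 2 ≤ N) (i : ZMod N) (x y : ZMod N → ℤˣ) :
    xxzE q z ε i (ket x) y =
      if x (i + 1) = -x i ∧ y (i + 1) = -y i ∧ ∀ j, j ≠ i → j ≠ i + 1 → x j = y j then
        cph q z ε i (x i) * cpl q z ε i (y i) else 0 := by
  have hn : (-1 : ℤˣ) ≠ 1 := by decide
  rw [xxzE_ket q z ε h]
  by_cases hx : x (i + 1) = -x i
  · rw [if_pos hx]
    simp only [hx, true_and, singlet, Finsupp.smul_apply, Finsupp.add_apply, ket,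
      Finsupp.single_apply, put_eq_iff h, smul_eq_mul]
    by_cases hy : y (i + 1) = -y i ∧ ∀ j, j ≠ i → j ≠ i + 1 → x j = y j
    · simp only [hy.1, true_and]
      rcases Int.units_eq_one_or (y i) with h2 | h2 <;> simp [h2, hn, hn.symm]
    · simp only [hy, and_false, if_false]
      simp
  · rw [if_neg hx, if_neg (fun h => hx h.1)]
    rfl

/-- Transposition exchanges the two hopping terms, hence z² and z⁻² in their coefficients, and
leaves the diagonal terms alone; so z is inverted while ε stays. -/
theorem ketForm_e (h : 2 ≤ N) (i : ZMod N) (v w : SpinSpace N) :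
    ketForm N (xxzE q z ε i v) w = ketForm N v (xxzE q z⁻¹ ε i w) := by
  have hq : (q : ℂ) ≠ 0 := q.ne_zero
  have ht : (twist z i : ℂ) ≠ 0 := (twist z i).ne_zero
  have htz : (twist z⁻¹ i : ℂ) = (twist z i : ℂ)⁻¹ := by
    simp only [twist]
    split_ifs <;> simp
  have hn : (-1 : ℤˣ) ≠ 1 := by decide
  have key : ketForm N ∘ₗ xxzE q z ε i = (ketForm N).compl₂ (xxzE q z⁻¹ ε i) := by
    refine ket_ext fun x => ket_ext fun y => ?_
    rw [LinearMap.comp_apply, LinearMap.compl₂_apply, ketForm_symm, ketForm_ket, ketForm_ket,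
      xxzE_ket_apply h, xxzE_ket_apply h]
    refine if_congr ?_ ?_ rfl
    · rw [← and_assoc, and_comm (a := x (i + 1) = _), and_assoc]
      simp only [eq_comm]
    · rcases Int.units_eq_one_or ε with rfl | rfl <;>
      rcases Int.units_eq_one_or (x i) with h2 | h2 <;>
      rcases Int.units_eq_one_or (y i) with h3 | h3 <;>
      simp [h2, h3, cpl, cph, htz, hn] <;> field_simp
  exact LinearMap.congr_fun₂ key v w

theorem ketForm_om (v w : SpinSpace N) :
    ketForm N (xxzOm N z v) w = ketForm N v (xxzOmInv N z⁻¹ w) := by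
  have key : ketForm N ∘ₗ xxzOm N z = (ketForm N).compl₂ (xxzOmInv N z⁻¹) := by
    refine ket_ext fun x => ket_ext fun y => ?_
    rw [LinearMap.comp_apply, LinearMap.compl₂_apply, ketForm_ket, xxzOm, xxzOmInv, onKets_ket,
      onKets_ket, map_smul, LinearMap.smul_apply, ketForm_ket, Finsupp.smul_apply, ket, ket,
      Finsupp.single_apply, Finsupp.single_apply]
    have : (y = fun j => x (j + 1)) ↔ (fun j => y (j - 1)) = x := by
      constructor
      · rintro rfl
        simp
      · rintro rfl
        simp
    by_cases h : y = fun j => x (j + 1)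
    · rw [if_pos h, if_pos (this.mp h), h]
      simp
    · rw [if_neg h, if_neg (mt this.mpr h)]
      simp
  exact LinearMap.congr_fun₂ key v w

theorem totalSpin_apply (v : SpinSpace N) (x : ZMod N → ℤˣ) :
    totalSpin N v x = (((∑ i, (x i : ℤ) : ℤ) : ℂ) / 2) * v x := by
  have : Finsupp.lapply x ∘ₗ totalSpin N = (((∑ i, (x i : ℤ) : ℤ) : ℂ) / 2) • Finsupp.lapply x := by
    refine ket_ext fun y => ?_
    rw [LinearMap.comp_apply, totalSpin_ket, map_smul, LinearMap.smul_apply]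
    by_cases h : y = x
    · rw [h]
    · simp [ket, Finsupp.single_eq_of_ne (Ne.symm h)]
  exact LinearMap.congr_fun this v

/-- The eigenvalue equation kills every coefficient at a configuration whose spins do not add up to
d, so pairing with the remaining kets detects all vectors. -/
theorem XXZd_eq_zero {d : ℤ} {v : XXZ N q z ε} (hv : v ∈ XXZd N q z ε d)
    (h : ∀ x, ∑ i, (x i : ℤ) = d → XXZ.vec v x = 0) : v = 0 := by
  refine XXZ.vec.map_eq_zero_iff.mp (Finsupp.ext fun x => ?_)
  by_cases hx : ∑ i, (x i : ℤ) = d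
  · exact h x hx
  · have := congrArg (fun f : SpinSpace N => f x) (mem_XXZd.mp hv)
    simp only [totalSpin_apply, Finsupp.smul_apply, smul_eq_mul] at this
    rcases mul_eq_mul_right_iff.mp this with h1 | h1
    · refine absurd ?_ hx
      rw [div_left_inj' two_ne_zero] at h1
      exact_mod_cast h1
    · exact h1

theorem ket_mem_XXZd {d : ℤ} {x : ZMod N → ℤˣ} (hx : ∑ i, (x i : ℤ) = d) :
    (XXZ.vec.symm (ket x) : XXZ N q z ε) ∈ XXZd N q z ε d := by
  rw [mem_XXZd, LinearEquiv.apply_symm_apply, totalSpin_ket, hx]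

/-- The contravariant pairing between `X^ε_z` and `X^ε_{z⁻¹}`. -/
theorem isDual_dagger_XXZd (d : ℤ) :
    IsDual (fun a => (ATL.dagger N (beta q) a).unop) (XXZd N q z ε d) (XXZd N q z⁻¹ ε d) := by
  let B : XXZd N q z ε d →ₗ[ℂ] XXZd N q z⁻¹ ε d →ₗ[ℂ] ℂ := (ketForm N).compl₁₂
    (XXZ.vec.toLinearMap ∘ₗ (XXZd N q z ε d).subtype.restrictScalars ℂ)
    (XXZ.vec.toLinearMap ∘ₗ (XXZd N q z⁻¹ ε d).subtype.restrictScalars ℂ)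
  have hB : ∀ v w, B v w = ketForm N (XXZ.vec (v : XXZ N q z ε)) (XXZ.vec (w : XXZ N q z⁻¹ ε)) :=
    fun v w => rfl
  have hl : ∀ (a : ATL N (beta q)) v w, B (a • v) w = B v ((ATL.dagger N (beta q) a).unop • w) := by
    intro a
    have H := ATL.gen_rels N (beta q)
    have hom : ∀ v w, B (ATL.gen N (beta q) .om • v) w = B v (ATL.gen N (beta q) .omInv • w) := by
      intro v w
      rw [hB, hB, Submodule.coe_smul, Submodule.coe_smul, XXZ.vec_om, XXZ.vec_omInv, ketForm_om]
    induction a using ATL.induction_base with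
    | h0 =>
      intro v w
      rw [ATL.dagger_base, MulOpposite.unop_op]
      by_cases h : 2 ≤ N
      · rw [hB, hB, Submodule.coe_smul, Submodule.coe_smul, XXZ.vec_base h, XXZ.vec_base h,
          ketForm_e h]
      · simp [base_eq_zero h]
    | h1 =>
      intro v w
      rw [hom, ATL.dagger, ATL.lift_om, MulOpposite.unop_op]
    | h2 =>
      intro v w
      rw [ATL.dagger, ATL.lift_omInv, MulOpposite.unop_op]
      have := hom (ATL.gen N (beta q) .omInv • v) (ATL.gen N (beta q) .om • w)
      rwa [← mul_smul, H.mul_inv, one_smul, ← mul_smul, H.inv_mul, one_smul, eq_comm] at this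
    | hc c =>
      intro v w
      simp [algebraMap_smul]
    | ha a b iha ihb =>
      intro v w
      rw [add_smul, map_add, LinearMap.add_apply, iha, ihb, map_add, MulOpposite.unop_add,
        add_smul, map_add]
    | hm a b iha ihb =>
      intro v w
      rw [mul_smul, iha, ihb, map_mul, MulOpposite.unop_mul, mul_smul]
  refine ⟨⟨B, hl, fun a v w => ?_, fun v hv => ?_, fun w hw => ?_⟩⟩
  · rw [hl, ATL.dagger_dagger]
  · refine Subtype.ext (XXZd_eq_zero v.2 fun x hx => ?_)
    have := hv ⟨_, ket_mem_XXZd hx⟩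
    rwa [hB, LinearEquiv.apply_symm_apply, ketForm_symm, ketForm_ket] at this
  · refine Subtype.ext (XXZd_eq_zero w.2 fun x hx => ?_)
    have := hw ⟨_, ket_mem_XXZd hx⟩
    rwa [hB, LinearEquiv.apply_symm_apply, ketForm_ket] at this

theorem isDual_starDual (M : Type*) [AddCommGroup M] [Module ℂ M]
    [Module (ATL N β) M] [IsScalarTower ℂ (ATL N β) M] :
    IsDual (fun a => (ATL.dagger N β a).unop) M (StarDual M) := by
  let B : M →ₗ[ℂ] StarDual M →ₗ[ℂ] ℂ := (StarDual.equiv M).toLinearMap.flip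
  have hB : ∀ v f, B v f = StarDual.equiv M f v := fun v f => rfl
  have hr : ∀ (a : ATL N β) v f, B v (a • f) = B ((ATL.dagger N β a).unop • v) f :=
    fun a v f => StarDual.smul_apply M a f v
  refine ⟨⟨B, fun a v f => ?_, hr, fun v hv => ?_, fun f hf => ?_⟩⟩
  · rw [hr, ATL.dagger_dagger]
  · exact (Module.forall_dual_apply_eq_zero_iff ℂ v).mp fun f => hv ((StarDual.equiv M).symm f)
  · exact StarDual.ext' M fun v => hf v

/-- By definition σ(a) is Φ(a)†, so twisting one side of a contravariant pairing by Φ changes the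
adjoint from † to σ. -/
theorem IsDual.circTwist {M M' : Type*} [AddCommGroup M] [Module ℂ M] [Module (ATL N β) M]
    [AddCommGroup M'] [Module ℂ M'] [Module (ATL N β) M']
    [IsScalarTower ℂ (ATL N β) M'] (h : IsDual (fun a => (ATL.dagger N β a).unop) M M') :
    IsDual (ATL.sigma N β) M (CircTwist M') := by
  obtain ⟨D⟩ := h
  let B : M →ₗ[ℂ] CircTwist M' →ₗ[ℂ] ℂ := D.form.compl₂ (CircTwist.equiv M').toLinearMap
  have hr : ∀ (a : ATL N β) v w, B v (a • w) = B (ATL.sigma N β a • v) w :=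
    fun a v w => D.smul_right (ATL.flip N β a) v (CircTwist.equiv M' w)
  refine ⟨⟨B, fun a v f => ?_, hr, fun v hv => ?_, fun f hf => ?_⟩⟩
  · rw [hr, ATL.sigma_sigma]
  · exact D.left v fun w => hv ((CircTwist.equiv M').symm w)
  · exact (CircTwist.equiv M').injective (D.right _ hf)

/-- The Loewy diagrams of `X^+` and `X^-` are opposite to each other. -/
theorem loewyReciprocal_XXZd (N : ℕ) [NeZero N] (q z : ℂˣ) (d : ℤ) :
    LoewyReciprocal (ATL N (beta q)) (XXZd N q z 1 d) (XXZd N q z (-1) d) := by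
  -- The contravariant dual of X⁺ at z is X⁺ at z⁻¹, and its twist is by reflection X⁻ at z again:
  -- the two inversions of z cancel.
  have h : IsDual (ATL.sigma N (beta q)) (XXZd N q z 1 d) (XXZd N q z⁻¹⁻¹ (-1) d) :=
    (isDual_dagger_XXZd d).circTwist.congr (LinearEquiv.refl _ _) (reflectEquiv N q z⁻¹ 1 d)
  rw [inv_inv] at h
  obtain ⟨D⟩ := h
  refine D.loewyReciprocal fun U W hUW => ?_
  have := (covBy_iff_quot_is_simple hUW.le).mp hUW
  have : IsSimpleModule (ATL N (beta q)) (W ⧸ U.submoduleOf W) := this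
  have := finite_submodule W
  exact isDual_of_isSimple _

end SpinChain

end AffineTL

namespace AffineTL

/-! ### Noncrossing pairings, expressed by parities. -/

section Noncrossing

variable {X : Type*}

/-- The chords `{P, f P}` do not cross; `b P Q` tells whether `P` is below `Q`. -/
def Noncrossing (b : X → X → ZMod 2) (f : X → X) : Prop :=
  ∀ P Q, Q ≠ P → Q ≠ f P → b P Q + b (f P) Q = b P (f Q) + b (f P) (f Q)

theorem zmodTwo_add_self (x : ZMod 2) : x + x = 0 := CharTwo.add_self_eq_zero x

/-- Cutting the chords at neighbouring points and joining the ends creates no crossing. -/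
theorem Noncrossing.join {b : X → X → ZMod 2} (hb : ∀ P Q, P ≠ Q → b P Q + b Q P = 1)
    {f f' g : X → X} {E : X → Prop} (nc : Noncrossing b f) (ff : ∀ P, f (f P) = P)
    (ff' : ∀ P, f' (f' P) = P) (gg : ∀ P, E P → g (g P) = P) (gE : ∀ P, E P → E (g P))
    (adj : ∀ P, E P → ∀ Q, Q ≠ P → Q ≠ g P → b P Q = b (g P) Q)
    (h1 : ∀ P, E P → f' P = g P) (h2 : ∀ P, ¬ E P → E (f P) → f' P = f (g (f P)))
    (h3 : ∀ P, ¬ E P → ¬ E (f P) → f' P = f P)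
    (h4 : ∀ P, ¬ E P → E (f P) → ¬ E (f (g (f P)))) : Noncrossing b f' := by
  have adj' : ∀ P, E P → ∀ Q, Q ≠ P → Q ≠ g P → b Q P = b Q (g P) := by
    intro P hP Q hQ hQ'
    have e1 := adj P hP Q hQ hQ'
    have e2 := hb Q P hQ
    have e3 := hb Q (g P) hQ'
    linear_combination e2 - e3 - e1
  -- The chord at P is untouched. If the chord at Q is rerouted, add the conditions for its two old
  -- pieces; the two points of the joint are neighbours, so they lie on the same side of the chord
  -- at P and cancel modulo 2.
  have old : ∀ P Q, ¬ E P → ¬ E (f P) → ¬ E Q → Q ≠ P → Q ≠ f' P →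
      b P Q + b (f' P) Q = b P (f' Q) + b (f' P) (f' Q) := by
    intro P Q hP hP' hQ n1 n2
    rw [h3 P hP hP'] at n2 ⊢
    have e1 := nc P Q n1 n2
    by_cases hQ' : E (f Q)
    · rw [h2 Q hQ hQ']
      have hE := gE _ hQ'
      have ne : ∀ A B, E A → ¬ E B → A ≠ B := fun A B hA hB h => hB (h ▸ hA)
      have e2 := nc P (g (f Q)) (ne _ _ hE hP) (ne _ _ hE hP')
      have e3 := adj' (f Q) hQ' P (ne _ _ hQ' hP).symm (ne _ _ hE hP).symm
      have e4 := adj' (f Q) hQ' (f P) (ne _ _ hQ' hP').symm (ne _ _ hE hP').symm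
      linear_combination e1 + e2 + e3 + e4
    · rw [h3 Q hQ hQ']
      exact e1
  intro P Q n1 n2
  have n3 : f' Q ≠ P := fun h => n2 (by rw [← h, ff'])
  have n4 : f' Q ≠ f' P := fun h => n1 (by rw [← ff' Q, h, ff'])
  by_cases hQ : E Q
  · rw [h1 Q hQ] at n3 n4 ⊢
    rw [adj' Q hQ P n1.symm n3.symm, adj' Q hQ (f' P) n2.symm n4.symm]
  by_cases hP : E P
  · rw [h1 P hP] at n2 n4 ⊢
    rw [adj P hP Q n1 n2, adj P hP (f' Q) n3 n4, zmodTwo_add_self, zmodTwo_add_self]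
  by_cases hP' : E (f P)
  swap
  · exact old P Q hP hP' hQ n1 n2
  by_cases hQ' : E (f Q)
  swap
  -- Here only the chord at P is rerouted. Being noncrossing is symmetric in the two chords, since
  -- by `hb` exchanging the arguments of b adds 1 to each of the four terms.
  · have e := old Q P hQ hQ' hP n1.symm n3.symm
    have e1 := hb P Q n1.symm
    have e2 := hb (f' P) Q n2.symm
    have e3 := hb P (f' Q) n3.symm
    have e4 := hb (f' P) (f' Q) n4.symm
    have z1 := zmodTwo_add_self (b P (f' Q))
    have z2 := zmodTwo_add_self (b (f' P) Q)
    linear_combination e1 - e4 + e2 - e3 - e - z2 + z1 + 2 * (e3 - e2) + 2 * (z2 - z1)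
  have ne : ∀ A B, E A → ¬ E B → A ≠ B := fun A B hA hB h => hB (h ▸ hA)
  have hA := gE _ hP'
  have hC := gE _ hQ'
  -- A rerouted chord passes through only one joint: its far end lies outside E, so it is unaffected
  -- by the neighbour relation.
  have fA := h4 P hP hP'
  have fC := h4 Q hQ hQ'
  rw [h2 P hP hP'] at n2 n4 ⊢
  rw [h2 Q hQ hQ'] at n3 n4 ⊢
  have m1 : f Q ≠ f P := fun h => n1 (by rw [← ff Q, h, ff])
  have m2 : f Q ≠ g (f P) := fun h => n2 (by rw [← h, ff])
  have m3 : g (f Q) ≠ f P := fun h => m2 (by rw [← h, gg _ hQ'])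
  have m4 : g (f Q) ≠ g (f P) := fun h => m1 (by rw [← gg _ hQ', h, gg _ hP'])
  have e1 := nc P Q n1 (ne _ _ hP' hQ).symm
  have e2 := adj (f P) hP' Q (ne _ _ hP' hQ).symm (ne _ _ hA hQ).symm
  have e3 := adj (f P) hP' (f Q) m1 m2
  have e4 := nc (g (f P)) Q (ne _ _ hA hQ).symm n2
  have e5 := adj' (f Q) hQ' P (ne _ _ hQ' hP).symm (ne _ _ hC hP).symm
  have e6 := adj' (f Q) hQ' (f (g (f P))) (ne _ _ hQ' fA).symm (ne _ _ hC fA).symm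
  have e7 := nc P (g (f Q)) (ne _ _ hC hP) m3
  have e8 := adj (f P) hP' (g (f Q)) m3 m4
  have e9 := adj (f P) hP' (f (g (f Q))) (ne _ _ hP' fC).symm (ne _ _ hA fC).symm
  have e10 := nc (g (f P)) (g (f Q)) m4 (ne _ _ hC fA)
  -- The rerouted chord at P separates neither of the two old pieces that make up the rerouted chord
  -- at Q. Summing over these pieces, with the joint of Q cancelling, gives the claim.
  have k1 : b P Q + b (f (g (f P))) Q = b P (f Q) + b (f (g (f P))) (f Q) := by
    have z1 := zmodTwo_add_self (b (g (f P)) Q)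
    have z2 := zmodTwo_add_self (b (g (f P)) (f Q))
    linear_combination e1 + e4 - e2 + e3 - z1 + z2
  have k2 : b P (g (f Q)) + b (f (g (f P))) (g (f Q)) =
      b P (f (g (f Q))) + b (f (g (f P))) (f (g (f Q))) := by
    have z1 := zmodTwo_add_self (b (g (f P)) (g (f Q)))
    have z2 := zmodTwo_add_self (b (g (f P)) (f (g (f Q))))
    linear_combination e7 + e10 - e8 + e9 - z1 + z2
  linear_combination k1 + e5 + e6 + k2

variable {Y : Type*} [LinearOrder Y] (pos : X → Y)

/-- The indicator of `pos P < pos Q`. -/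
def below (P Q : X) : ZMod 2 := if pos P < pos Q then 1 else 0

variable {pos}

theorem below_add_below (inj : Function.Injective pos) {P Q : X} (h : P ≠ Q) :
    below pos P Q + below pos Q P = 1 := by
  rcases lt_or_gt_of_ne (inj.ne h) with h | h <;> simp [below, h, h.not_gt]

/-- The parity b P Q + b (f P) Q tells whether Q lies between the ends of the chord at P, so the
identity says that both ends of the chord at Q lie on the same side. The inequalities express the
same for one choice of names of the four ends; all choices are obtained by varying x and y. -/
theorem noncrossing_below_iff (inj : Function.Injective pos) {f : X → X} (ff : ∀ P, f (f P) = P)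
    (fne : ∀ P, f P ≠ P) : Noncrossing (below pos) f ↔
      ∀ x y, ¬ (pos x < pos y ∧ pos y < pos (f x) ∧ pos (f x) < pos (f y)) := by
  constructor
  · rintro h x y ⟨h1, h2, h3⟩
    have := h x y (fun e => by rw [e] at h1; exact h1.false) (fun e => by rw [e] at h2; exact h2.false)
    simp only [below, if_pos h1, if_pos h3, if_neg h2.not_gt, if_pos (h1.trans (h2.trans h3))] at this
    exact absurd this (by decide)
  · intro h P Q n1 n2
    have n3 : f Q ≠ P := fun e => n2 (by rw [← e, ff])
    have n4 : f Q ≠ f P := fun e => n1 (by rw [← ff Q, e, ff])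
    have c1 := h P Q
    have c2 := h (f P) Q
    have c3 := h P (f Q)
    have c4 := h (f P) (f Q)
    have c5 := h Q P
    have c6 := h (f Q) P
    have c7 := h Q (f P)
    have c8 := h (f Q) (f P)
    simp only [ff] at c1 c2 c3 c4 c5 c6 c7 c8
    have d1 := inj.ne n1
    have d2 := inj.ne n2
    have d3 := inj.ne n3
    have d4 := inj.ne n4
    have d5 := inj.ne (fne P)
    have d6 := inj.ne (fne Q)
    clear h n1 n2 n3 n4
    simp only [below]
    generalize pos P = a at *
    generalize pos (f P) = a' at *
    generalize pos Q = c at *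
    generalize pos (f Q) = c' at *
    by_cases k1 : a < c <;> by_cases k2 : a' < c <;> by_cases k3 : a < c' <;>
      by_cases k4 : a' < c' <;> simp only [k1, k2, k3, k4, if_true, if_false] <;>
      first | decide | (exfalso; grind)

end Noncrossing

/-! ### Planar diagrams stay planar under the generators. -/

namespace Link

variable {N d : ℕ}

theorem lineEnd_lineEnd (L : Link N d) (x) : L.lineEnd (L.lineEnd x) = x := by
  obtain ⟨x, m⟩ := x
  simp [lineEnd, L.p_p, L.n_p]

theorem lineEnd_ne (L : Link N d) (x) : L.lineEnd x ≠ x := by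
  obtain ⟨x, m⟩ := x
  exact fun h => L.p_ne x (congrArg Prod.fst h)

/-- The height of the copy `(i, m)` of the left site `i`. -/
def leftHeight (i : ZMod N) (m : ℤ) : ℤ := (i - 1).val + 1 + N * m

theorem position_inl_lt {i j : ZMod N} {m k : ℤ} :
    position ((.inl i, m) : Site N d × ℤ) < position ((.inl j, k) : Site N d × ℤ) ↔
      leftHeight i m < leftHeight j k := by
  simp [position, leftHeight]

theorem position_inl_lt_inr {i : ZMod N} {a : Fin d} {m k : ℤ} :
    position ((.inl i, m) : Site N d × ℤ) < position ((.inr a, k) : Site N d × ℤ) := by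
  simp [position]

theorem not_position_inr_lt_inl {i : ZMod N} {a : Fin d} {m k : ℤ} :
    ¬ position ((.inr a, k) : Site N d × ℤ) < position ((.inl i, m) : Site N d × ℤ) :=
  position_inl_lt_inr.not_gt

theorem position_inr_lt {a b : Fin d} {m k : ℤ} :
    position ((.inr a, m) : Site N d × ℤ) < position ((.inr b, k) : Site N d × ℤ) ↔
      (b : ℤ) + 1 + d * k < a + 1 + d * m := by
  simp only [position, Sum.Lex.inr_lt_inr_iff, OrderDual.toDual_lt_toDual]

theorem eq_of_add_mul_eq {n : ℕ} {v w : ℕ} (hv : v < n) (hw : w < n) {m k : ℤ}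
    (h : (v : ℤ) + n * m = w + n * k) : v = w ∧ m = k := by
  have hmk : m = k := by
    rcases lt_trichotomy m k with h1 | h1 | h1
    · nlinarith
    · exact h1
    · nlinarith
  subst hmk
  exact ⟨by exact_mod_cast add_right_cancel h, rfl⟩

variable [NeZero N]

theorem leftHeight_inj {i j : ZMod N} {m k : ℤ} (h : leftHeight i m = leftHeight j k) :
    i = j ∧ m = k := by
  obtain ⟨h1, h2⟩ := eq_of_add_mul_eq (i - 1).val_lt (j - 1).val_lt (m := m) (k := k)
    (by unfold leftHeight at h; linear_combination h)
  exact ⟨sub_left_injective (ZMod.val_injective N h1), h2⟩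

theorem position_injective : Function.Injective (position (N := N) (d := d)) := by
  rintro ⟨x | a, m⟩ ⟨y | b, k⟩ h
  · obtain ⟨rfl, rfl⟩ := leftHeight_inj (i := x) (j := y) (m := m) (k := k)
      (by simpa [position, leftHeight] using h)
    rfl
  · exact absurd h position_inl_lt_inr.ne
  · exact absurd h position_inl_lt_inr.ne'
  · obtain ⟨h1, h2⟩ := eq_of_add_mul_eq a.isLt b.isLt (m := m) (k := k) (by
      have : (a : ℤ) + 1 + d * m = b + 1 + d * k :=
        OrderDual.toDual.injective (Sum.inr_injective (toLex.injective h))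
      linear_combination this)
    rw [Fin.ext h1, h2]

theorem noncrossing_iff {L : Link N d} : Noncrossing (below position) L.lineEnd ↔
    ∀ x y, ¬ (position x < position y ∧ position y < position (L.lineEnd x) ∧
      position (L.lineEnd x) < position (L.lineEnd y)) :=
  noncrossing_below_iff position_injective L.lineEnd_lineEnd L.lineEnd_ne

/-- The correction of the copy at site 1 is exactly what makes Ω shift every left point by one unit
of height, also across the boundary of the rectangle. Hence Ω preserves the order of the boundary
points. -/
theorem leftHeight_sub_one (i : ZMod N) (m : ℤ) :
    leftHeight (i - 1) (m + if i = 1 then -1 else 0) = leftHeight i m - 1 := by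
  have : ((i - 1 - 1).val : ℤ) = (i - 1).val - 1 + if i = 1 then (N : ℤ) else 0 := by
    have hN := NeZero.pos N
    by_cases h1 : i = 1
    · subst h1
      have : (-1 : ZMod N) = ((N - 1 : ℕ) : ZMod N) := by
        rw [Nat.cast_sub hN]; simp
      rw [sub_self, zero_sub, if_pos rfl, this, ZMod.val_cast_of_lt (by omega), ZMod.val_zero]
      push_cast [hN]
      ring
    · have h0 : i - 1 ≠ 0 := sub_ne_zero.mpr h1
      have h2 : (i - 1).val ≠ 0 := fun h => h0 ((ZMod.val_eq_zero _).mp h)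
      have hlt := (i - 1).val_lt
      have : i - 1 - 1 = (((i - 1).val - 1 : ℕ) : ZMod N) := by
        rw [Nat.cast_sub (by omega), ZMod.natCast_zmod_val, Nat.cast_one]
      rw [this, ZMod.val_cast_of_lt (by omega), if_neg h1]
      push_cast [Nat.one_le_iff_ne_zero.mpr h2]
      ring
  unfold leftHeight
  rw [this]
  split_ifs <;> ring

theorem leftHeight_add_one (i : ZMod N) (m : ℤ) :
    leftHeight (i + 1) (m + if i = 0 then 1 else 0) = leftHeight i m + 1 := by
  have := leftHeight_sub_one (i + 1) (m + if i = 0 then 1 else 0)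
  rw [add_sub_cancel_right] at this
  have e : (m + if i = 0 then 1 else 0) + (if i + 1 = 1 then -1 else 0) = m := by
    by_cases h : i = 0 <;> simp [h]
  rw [e] at this
  rw [this]
  ring

-- A relabelling that preserves the order of the boundary points carries any crossing back to a
-- crossing of the original diagram, and one preserving the sides does not change which lines are
-- through lines.
omit [NeZero N] in
theorem isPlanar_relabel {L : Link N d} (hL : L.IsPlanar) {ρ : Site N d ≃ Site N d}
    {r : Site N d → ℤ} (hρ : ∀ x, (ρ x).isLeft = x.isLeft)
    (hpos : ∀ x y m k, position (ρ x, m + r x) < position (ρ y, k + r y) ↔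
      position (x, m) < position (y, k)) : (L.relabel 1 ρ r).IsPlanar := by
  have hend : ∀ x m, (L.relabel 1 ρ r).lineEnd (ρ x, m + r x) =
      (ρ (L.p x), (m + L.n x) + r (L.p x)) := by
    intro x m
    simp only [lineEnd, relabel_p, relabel_n]
    congr 1
    push_cast
    ring
  constructor
  · rintro ⟨x, m⟩ ⟨y, k⟩
    obtain ⟨x, rfl⟩ := ρ.surjective x
    obtain ⟨y, rfl⟩ := ρ.surjective y
    obtain ⟨m, rfl⟩ : ∃ m', m = m' + r x := ⟨m - r x, by ring⟩
    obtain ⟨k, rfl⟩ : ∃ k', k = k' + r y := ⟨k - r y, by ring⟩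
    rw [hend, hend, hpos, hpos, hpos]
    exact hL.1 (x, m) (y, k)
  · intro h i
    have hi : ((.inl i : Site N d)).isLeft = true := rfl
    obtain ⟨x, hx⟩ := ρ.surjective (.inl i)
    rw [← hx, hρ] at hi
    obtain ⟨j, rfl⟩ := Sum.isLeft_iff.mp hi
    rw [← hx, relabel_p, hρ]
    exact hL.2 h j

theorem IsPlanar.rotUp {L : Link N d} (hL : L.IsPlanar) : (AffineTL.rotUp L).IsPlanar := by
  refine isPlanar_relabel hL (fun x => ?_) fun x y m k => ?_
  · rcases x with x | x <;> rfl
  · rcases x with i | a <;> rcases y with j | b <;>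
      simp only [rotSite, Equiv.sumCongr_apply, Sum.map_inl, Sum.map_inr, Equiv.subRight_apply,
        Equiv.refl_apply, Sum.elim_inl, Sum.elim_inr, Pi.zero_apply, add_zero, position_inl_lt,
        leftHeight_sub_one, position_inl_lt_inr, not_position_inr_lt_inl, position_inr_lt]
    omega

theorem IsPlanar.rotDown {L : Link N d} (hL : L.IsPlanar) : (AffineTL.rotDown L).IsPlanar := by
  refine isPlanar_relabel hL (fun x => ?_) fun x y m k => ?_
  · rcases x with x | x <;> rfl
  · rcases x with i | a <;> rcases y with j | b <;>
      simp only [rotSite, Equiv.sumCongr_symm, Equiv.sumCongr_apply, Sum.map_inl, Sum.map_inr,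
        Equiv.subRight_symm_apply, Equiv.refl_symm, Equiv.refl_apply, Sum.elim_inl, Sum.elim_inr,
        Pi.zero_apply, add_zero, position_inl_lt, leftHeight_add_one, position_inl_lt_inr,
        not_position_inr_lt_inl, position_inr_lt]
    omega

omit [NeZero N] in
/-- The height of a right site after `Ω_d`. -/
theorem rightHeight_finRotate (a : Fin d) (m : ℤ) :
    ((finRotate d a : Fin d) : ℤ) + 1 + d * (m + if (a : ℕ) + 1 = d then 1 else 0) =
      a + 1 + d * m + 1 := by
  obtain ⟨d, rfl⟩ : ∃ e, d = e + 1 := ⟨d - 1, by have := a.isLt; omega⟩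
  by_cases h : (a : ℕ) + 1 = d + 1
  · obtain rfl : a = Fin.last d := Fin.ext (by simpa using h)
    rw [finRotate_last, if_pos h]
    simp
    ring
  · rw [coe_finRotate_of_ne_last (fun h' => h (by rw [h']; rfl)), if_neg h]
    push_cast
    ring

omit [NeZero N] in
theorem IsPlanar.mulOmega {L : Link N d} (hL : L.IsPlanar) : L.mulOmega.IsPlanar := by
  refine isPlanar_relabel hL (fun x => ?_) fun x y m k => ?_
  · rcases x with x | x <;> rfl
  · rcases x with i | a <;> rcases y with j | b <;>
      simp only [Equiv.sumCongr_apply, Sum.map_inl, Sum.map_inr, Equiv.refl_apply, Sum.elim_inl,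
        Sum.elim_inr, Pi.zero_apply, add_zero, position_inl_lt, position_inl_lt_inr,
        not_position_inr_lt_inl, position_inr_lt, rightHeight_finRotate]
    omega

/-- The inverse of `mulOmega`. -/
def mulOmegaInv (L : Link N d) : Link N d :=
  L.relabel 1 (Equiv.sumCongr (Equiv.refl _) (finRotate d).symm)
    (Sum.elim 0 fun a => if ((finRotate d).symm a : ℕ) + 1 = d then -1 else 0)

omit [NeZero N] in
theorem mulOmega_mulOmegaInv (L : Link N d) : L.mulOmegaInv.mulOmega = L := by
  rw [mulOmega, mulOmegaInv, relabel_relabel]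
  refine relabel_eq_self _ _ _ (fun x => ?_) (fun x => ?_)
  · rcases x with x | x <;> simp
  · rcases x with x | x
    · simp
    · simp only [Sum.elim_inr, Equiv.sumCongr_apply, Sum.map_inr, Units.val_one, one_mul]
      split_ifs <;> simp

omit [NeZero N] in
theorem IsPlanar.mulOmegaInv {L : Link N d} (hL : L.IsPlanar) : L.mulOmegaInv.IsPlanar := by
  have key : ∀ (a : Fin d) (m : ℤ), (((finRotate d).symm a : Fin d) : ℤ) + 1 +
      d * (m + if ((finRotate d).symm a : ℕ) + 1 = d then -1 else 0) = a + 1 + d * m - 1 := by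
    intro a m
    obtain ⟨a, rfl⟩ := (finRotate d).surjective a
    rw [Equiv.symm_apply_apply]
    have := rightHeight_finRotate a (m + if (a : ℕ) + 1 = d then -1 else 0)
    have e : (m + if (a : ℕ) + 1 = d then -1 else 0) + (if (a : ℕ) + 1 = d then 1 else 0) = m := by
      split_ifs <;> ring
    rw [e] at this
    rw [this]
    ring
  refine isPlanar_relabel hL (fun x => ?_) fun x y m k => ?_
  · rcases x with x | x <;> rfl
  · rcases x with i | a <;> rcases y with j | b <;>
      simp only [Equiv.sumCongr_apply, Sum.map_inl, Sum.map_inr, Equiv.refl_apply, Sum.elim_inl,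
        Sum.elim_inr, Pi.zero_apply, add_zero, position_inl_lt, position_inl_lt_inr,
        not_position_inr_lt_inl, position_inr_lt, key]
    omega

/-- If a non-contractible loop closes at neighbouring sites, there are no through lines. -/
theorem IsPlanar.isLeft_of_loop {L : Link N d} (hL : L.IsPlanar) (h : 2 ≤ N) {i : ZMod N}
    (h1 : L.p (.inl i) = .inl (i + 1)) (h2 : L.n (.inl i) ≠ if i = 0 then 1 else 0) (j : ZMod N) :
    (L.p (.inl j)).isLeft := by
  set s : ℤ := if i = 0 then 1 else 0 with hs
  have hV : ∀ k, leftHeight (i + 1) (k + s) = leftHeight i 0 + 1 + N * k := by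
    intro k
    rw [leftHeight_add_one]
    unfold leftHeight
    ring
  have hU : ∀ k, leftHeight i k = leftHeight i 0 + N * k := by
    intro k
    unfold leftHeight
    ring
  have h3 : L.p (.inl (i + 1)) = .inl i := by rw [← h1, L.p_p]
  have h4 : L.n (.inl (i + 1)) = -L.n (.inl i) := by rw [← h1, L.n_p]
  obtain ⟨k, hk⟩ : ∃ k, L.n (.inl i) = k + s := ⟨_, (sub_add_cancel _ s).symm⟩
  rw [hk] at h4 h2
  have hN : (2 : ℤ) ≤ N := by exact_mod_cast h
  -- Let the line from i overshoot the direct connection to i+1 by k periods. For k ≥ 1 or k ≤ -2 it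
  -- would cross its own translate by one period, and k = 0 would make the loop contractible.
  have hk' : k = -1 := by
    rcases lt_trichotomy k (-1) with h5 | h5 | h5
    · exfalso
      refine hL.1 (.inl (i + 1), k + s) (.inl (i + 1), k + 1 + s) ⟨?_, ?_, ?_⟩
      · rw [position_inl_lt, hV, hV]
        nlinarith
      · simp only [lineEnd, h3, h4, position_inl_lt, hV, add_neg_cancel]
        nlinarith
      · simp only [lineEnd, h3, h4, position_inl_lt]
        rw [add_neg_cancel, show k + 1 + s + -(k + s) = 1 by ring, hU 1]
        linarith
    · exact h5
    · exfalso
      have h6 : 1 ≤ k := by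
        rcases eq_or_ne k 0 with h7 | h7
        · exact absurd (by rw [h7, zero_add]) h2
        · omega
      refine hL.1 (.inl i, 0) (.inl i, 1) ⟨?_, ?_, ?_⟩
      · rw [position_inl_lt, hU 1]
        linarith
      · simp only [lineEnd, h1, hk, position_inl_lt, hV, hU 1, zero_add]
        nlinarith
      · simp only [lineEnd, h1, hk, position_inl_lt, hV, zero_add]
        rw [← add_assoc, hV]
        linarith
  by_contra hj
  by_cases hji : j = i
  · rw [hji, h1] at hj
    exact hj rfl
  by_cases hji' : j = i + 1
  · rw [hji', h3] at hj
    exact hj rfl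
  obtain ⟨c, hc⟩ : ∃ c, L.p (.inl j) = .inr c := by
    rcases hp : L.p (.inl j) with x | c
    · rw [hp] at hj
      exact absurd rfl hj
    · exact ⟨c, rfl⟩
  set a := leftHeight i 0
  have hj0 : ∀ m, leftHeight j m = leftHeight j 0 + N * m := by
    intro m
    unfold leftHeight
    ring
  -- For k = -1 the line joins the heights a+1-N and a. Every site other than i and i+1 has a copy
  -- strictly between them, and a through line starting there would have to cross this line.
  obtain ⟨m, m1, m2⟩ : ∃ m : ℤ, N * m ≤ a - leftHeight j 0 ∧ a - leftHeight j 0 < N * m + N :=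
    ⟨_, Int.mul_ediv_self_le (by omega), Int.lt_mul_ediv_self_add (by omega)⟩
  have m3 : leftHeight j m ≠ a := fun h => hji (leftHeight_inj h).1
  have m4 : leftHeight j m ≠ leftHeight (i + 1) (k + s) := fun h => hji' (leftHeight_inj h).1
  rw [hV] at m4
  rw [hj0] at m3 m4
  refine hL.1 (.inl (i + 1), k + s) (.inl j, m) ⟨?_, ?_, ?_⟩
  · rw [position_inl_lt, hV, hj0]
    subst hk'
    omega
  · simp only [lineEnd, h3, h4, position_inl_lt, add_neg_cancel]
    rw [hj0]
    omega
  · simp only [lineEnd, h3, hc]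
    exact position_inl_lt_inr

theorem IsPlanar.cup {L : Link N d} (hL : L.IsPlanar) (h : 2 ≤ N) (i : ZMod N) :
    (AffineTL.cup h i L).IsPlanar := by
  have hne := inl_ne (d := d) h i
  set s : ℤ := if i = 0 then 1 else 0 with hs
  have hp := L.p_p
  have hpn := L.p_ne
  have hn := L.n_p
  constructor
  · rw [← noncrossing_iff]
    -- The joints of the cup: g exchanges the copies of i and i+1 that are adjacent on the left
    -- boundary, the shift s accounting for the step from site N to site 1.
    let g : Site N d × ℤ → Site N d × ℤ := fun P =>
      if P.1 = .inl i then (.inl (i + 1), P.2 + s) else (.inl i, P.2 - s)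
    have hadj : ∀ (m : ℤ) (Q : Site N d × ℤ), Q ≠ (.inl i, m) → Q ≠ (.inl (i + 1), m + s) →
        below position (.inl i, m) Q = below position (.inl (i + 1), m + s) Q := by
      rintro m ⟨j | a, k⟩ n1 n2
      · have h1 : leftHeight j k ≠ leftHeight i m := fun e => n1 (by
          obtain ⟨rfl, rfl⟩ := leftHeight_inj e; rfl)
        have h2 : leftHeight j k ≠ leftHeight (i + 1) (m + s) := fun e => n2 (by
          obtain ⟨rfl, rfl⟩ := leftHeight_inj e; rfl)
        have h3 := leftHeight_add_one i m
        rw [← hs] at h3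
        simp only [below, position_inl_lt]
        refine if_congr ?_ rfl rfl
        omega
      · simp only [below, position_inl_lt_inr, if_true]
    refine Noncrossing.join (f := L.lineEnd) (g := g) (E := fun P => P.1 = .inl i ∨
      P.1 = .inl (i + 1)) (fun P Q => below_add_below position_injective)
      (noncrossing_iff.mpr hL.1) L.lineEnd_lineEnd (Link.lineEnd_lineEnd _) ?_ ?_ ?_ ?_ ?_ ?_ ?_
    · rintro ⟨x, m⟩ (rfl | rfl) <;> simp [g, hne.symm]
    · rintro ⟨x, m⟩ (rfl | rfl) <;> simp [g, hne.symm]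
    · rintro ⟨x, m⟩ (rfl | rfl) Q n1 n2
      · simp only [g, if_true] at n2 ⊢
        exact hadj m Q n1 n2
      · simp only [g, if_neg hne.symm] at n2 ⊢
        have := hadj (m - s) Q n2 (by rwa [sub_add_cancel])
        rw [sub_add_cancel] at this
        exact this.symm
    · rintro ⟨x, m⟩ (rfl | rfl)
      · simp [g, lineEnd, AffineTL.cup, Link.join, hs]
      · simp [g, lineEnd, AffineTL.cup, Link.join, hs, hne.symm]
        ring
    · rintro ⟨x, m⟩ hx hx'
      simp only [not_or] at hx
      simp only [lineEnd] at hx'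
      simp only [lineEnd, AffineTL.cup, Link.join, g, if_neg hx.1, if_neg hx.2]
      rcases hx' with e | e
      · simp only [e, if_true, Prod.mk.injEq, true_and]
        ring
      · simp only [e, if_true, if_neg hne.symm, Prod.mk.injEq, true_and]
        ring
    · rintro ⟨x, m⟩ hx hx'
      simp only [not_or] at hx
      simp only [lineEnd, not_or] at hx'
      simp only [lineEnd, AffineTL.cup, Link.join, if_neg hx.1, if_neg hx.2, if_neg hx'.1,
        if_neg hx'.2]
    · rintro ⟨x, m⟩ hx hx'
      simp only [not_or] at hx ⊢
      simp only [lineEnd] at hx' ⊢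
      have := hp x
      rcases hx' with e | e
      · simp only [g, e, if_true]
        grind
      · simp only [g, e, if_neg hne.symm]
        grind
  · intro hl j
    -- If the loop is new, it was closed by the cup, and `isLeft_of_loop` excludes through lines;
    -- otherwise a loop was already there.
    have key : ∀ j, (L.p (.inl j)).isLeft := by
      by_cases h1 : L.loops = 0
      · have h2 : L.p (.inl i) = .inl (i + 1) ∧ L.n (.inl i) ≠ s := by
          by_contra h2
          refine hl ?_
          simp only [AffineTL.cup, Link.join]
          rw [if_neg h2, h1]
        exact hL.isLeft_of_loop h h2.1 h2.2
      · exact hL.2 h1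
    simp only [AffineTL.cup, Link.join]
    split_ifs
    · rfl
    · rfl
    · exact key _
    · exact key _
    · exact key _

end Link

end AffineTL

namespace AffineTL

/-! ### Windings of lines and the finiteness of reduced diagrams. -/

namespace Link

variable {N d : ℕ}

/-- A diagram without loops whose lines pass through the top and bottom sides at most once. -/
def IsReduced (L : Link N d) : Prop := L.loops = 0 ∧ ∀ x, L.n x ∈ Set.Icc (-1) 1

theorem finite_isReduced [NeZero N] : {L : Link N d | L.IsReduced}.Finite := by
  refine Set.Finite.of_injOn (f := fun L : Link N d => (L.p, L.n))
    (t := Set.univ ×ˢ Set.univ.pi fun _ => Set.Icc (-1) 1) (fun L hL => ⟨trivial, fun x _ => hL.2 x⟩)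
    (fun L hL L' hL' h => ?_) (Set.finite_univ.prod (Set.Finite.pi fun _ => Set.finite_Icc _ _))
  rw [Prod.mk.injEq] at h
  exact Link.ext h.1 h.2 (hL.1.trans hL'.1.symm)

/-- The total winding of the through lines. -/
def winding (L : Link N d) : ℤ := ∑ a, L.n (.inr a)

theorem IsMonic.mulOmega {L : Link N d} (hL : L.IsMonic) : L.mulOmega.IsMonic := by
  intro a
  obtain ⟨a, rfl⟩ := (finRotate d).surjective a
  have := L.relabel_p 1 (Equiv.sumCongr (Equiv.refl _) (finRotate d))
    (Sum.elim 0 fun a => if (a : ℕ) + 1 = d then 1 else 0) (.inr a)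
  obtain ⟨i, hi⟩ := Sum.isLeft_iff.mp (hL a)
  rw [hi] at this
  rw [Link.mulOmega]
  exact (congrArg Sum.isLeft this).trans rfl

theorem IsMonic.mulOmegaInv {L : Link N d} (hL : L.IsMonic) : L.mulOmegaInv.IsMonic := by
  intro a
  obtain ⟨a, rfl⟩ := (finRotate d).symm.surjective a
  have := L.relabel_p 1 (Equiv.sumCongr (Equiv.refl _) (finRotate d).symm)
    (Sum.elim 0 fun a => if ((finRotate d).symm a : ℕ) + 1 = d then -1 else 0) (.inr a)
  obtain ⟨i, hi⟩ := Sum.isLeft_iff.mp (hL a)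
  rw [hi] at this
  rw [Link.mulOmegaInv]
  exact (congrArg Sum.isLeft this).trans rfl

/-- Only the right end at the last site passes to the next copy, and since L is monic, no other end
of that line moves. -/
theorem winding_mulOmega {L : Link N d} (hL : L.IsMonic) (hd : d ≠ 0) :
    L.mulOmega.winding = L.winding - 1 := by
  have key : ∀ a, L.mulOmega.n (.inr (finRotate d a)) =
      L.n (.inr a) - if (a : ℕ) + 1 = d then 1 else 0 := by
    intro a
    have := L.relabel_n 1 (Equiv.sumCongr (Equiv.refl _) (finRotate d))
      (Sum.elim 0 fun a => if (a : ℕ) + 1 = d then 1 else 0) (.inr a)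
    obtain ⟨i, hi⟩ := Sum.isLeft_iff.mp (hL a)
    rw [hi] at this
    rw [mulOmega]
    refine Eq.trans this ?_
    simp
  rw [winding, ← Equiv.sum_comp (finRotate d)]
  simp only [key]
  rw [Finset.sum_sub_distrib, winding]
  congr 1
  rw [Finset.sum_eq_single ⟨d - 1, by omega⟩]
  · rw [if_pos (by simp; omega)]
  · intro a _ ha
    rw [if_neg fun h => ha (Fin.ext (by simp; omega))]
  · simp

variable [NeZero N]

/-- A line between left sites that winds at least twice crosses its own translate by one period. -/
theorem IsPlanar.n_le_one {L : Link N d} (hL : L.IsPlanar) {i j : ZMod N}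
    (h : L.p (.inl i) = .inl j) : L.n (.inl i) ≤ 1 := by
  by_contra! hn
  have hN : (0 : ℤ) < N := by exact_mod_cast NeZero.pos N
  have hi : ((i - 1).val : ℤ) < N := by exact_mod_cast (i - 1).val_lt
  refine hL.1 (.inl i, 0) (.inl i, 1) ⟨?_, ?_, ?_⟩
  · rw [position_inl_lt]
    unfold leftHeight
    linarith
  · simp only [lineEnd, h, position_inl_lt]
    unfold leftHeight
    nlinarith
  · simp only [lineEnd, h, position_inl_lt]
    unfold leftHeight
    linarith

theorem IsPlanar.n_mem_of_left {L : Link N d} (hL : L.IsPlanar) {i j : ZMod N}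
    (h : L.p (.inl i) = .inl j) : L.n (.inl i) ∈ Set.Icc (-1) 1 := by
  refine ⟨?_, hL.n_le_one h⟩
  have h1 : L.p (.inl j) = .inl i := by rw [← h, L.p_p]
  have := hL.n_le_one h1
  rw [← h, L.n_p] at this
  linarith

/-- If the windings of two through lines differed by two or more, suitable copies of these lines
would have their left ends in one order and their right ends in the other. -/
theorem IsPlanar.n_through_le {L : Link N d} (hL : L.IsPlanar) (hm : L.IsMonic) (a b : Fin d) :
    L.n (.inr b) ≤ L.n (.inr a) + 1 := by
  by_contra! hn
  obtain ⟨i, hi⟩ := Sum.isLeft_iff.mp (hm a)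
  obtain ⟨j, hj⟩ := Sum.isLeft_iff.mp (hm b)
  have hi' : L.p (.inl i) = .inr a := by rw [← hi, L.p_p]
  have hj' : L.p (.inl j) = .inr b := by rw [← hj, L.p_p]
  have ni : L.n (.inl i) = -L.n (.inr a) := by rw [← hi, L.n_p]
  have nj : L.n (.inl j) = -L.n (.inr b) := by rw [← hj, L.n_p]
  have hN : (0 : ℤ) < N := by exact_mod_cast NeZero.pos N
  have hlt : ((i - 1).val : ℤ) < N := by exact_mod_cast (i - 1).val_lt
  refine hL.1 (.inl i, L.n (.inr a) + 1) (.inl j, L.n (.inr b)) ⟨?_, ?_, ?_⟩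
  · rw [position_inl_lt]
    unfold leftHeight
    nlinarith
  · simp only [lineEnd, hi']
    exact position_inl_lt_inr
  · simp only [lineEnd, hi', hj', ni, nj, position_inr_lt]
    have hb : (b : ℤ) < d := by exact_mod_cast b.isLt
    have ha : (0 : ℤ) ≤ (a : ℕ) := by positivity
    ring_nf
    linarith

/-- The windings of the through lines differ by at most one. If one of them were outside [-1, 1],
all would have the same strict sign and could not add up to zero. -/
theorem IsPlanar.isReduced {L : Link N d} (hL : L.IsPlanar) (hm : L.IsMonic) (hl : L.loops = 0)
    (hw : L.winding = 0) : L.IsReduced := by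
  have hr : ∀ a, L.n (.inr a) ∈ Set.Icc (-1) 1 := by
    intro a
    constructor
    · by_contra! h
      refine hw.not_lt (Finset.sum_neg (fun b _ => ?_) ⟨a, Finset.mem_univ a⟩)
      have := hL.n_through_le hm a b
      linarith
    · by_contra! h
      refine hw.not_gt (Finset.sum_pos (fun b _ => ?_) ⟨a, Finset.mem_univ a⟩)
      have := hL.n_through_le hm b a
      linarith
  refine ⟨hl, fun x => ?_⟩
  rcases x with i | a
  · rcases h : L.p (.inl i) with j | a
    · exact hL.n_mem_of_left h
    · have := hr a
      rw [← h, L.n_p, Set.mem_Icc] at this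
      exact ⟨by linarith, by linarith⟩
  · exact hr a

omit [NeZero N] in
theorem IsPlanar.loops_eq_zero {L : Link N d} (hL : L.IsPlanar) (hm : L.IsMonic) (hd : d ≠ 0) :
    L.loops = 0 := by
  by_contra h
  obtain ⟨i, hi⟩ := Sum.isLeft_iff.mp (hm ⟨0, Nat.pos_of_ne_zero hd⟩)
  have := hL.2 h i
  rw [← hi, L.p_p] at this
  exact absurd this (by simp)

end Link

/-! ### Finite dimension of the cellular modules. -/

section Finite

variable {N d : ℕ} {β : ℂ}

theorem om_smul_diag (L : Link N d) : ATL.gen N β .om • diag β L = diag β (rotUp L) := by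
  refine LinkSpace.vec.injective ?_
  rw [LinkSpace.vec_smul, ATL.lift_om, diag, diag, LinearEquiv.apply_symm_apply,
    LinearEquiv.apply_symm_apply, linkOm, wop_single]
  simp

theorem omInv_smul_diag (L : Link N d) : ATL.gen N β .omInv • diag β L = diag β (rotDown L) := by
  refine LinkSpace.vec.injective ?_
  rw [LinkSpace.vec_smul, ATL.lift_omInv, diag, diag, LinearEquiv.apply_symm_apply,
    LinearEquiv.apply_symm_apply, linkOmInv, wop_single]
  simp

theorem e_smul_diag (h : 2 ≤ N) (i : ZMod N) (L : Link N d) :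
    ATL.gen N β (.e h i) • diag β L = (if Pops i L then β else 1) • diag β (cup h i L) := by
  refine LinkSpace.vec.injective ?_
  rw [LinkSpace.vec_smul, ATL.lift_e, map_smul, diag, diag, LinearEquiv.apply_symm_apply,
    LinearEquiv.apply_symm_apply, linkE, wop_single, Finsupp.smul_single, smul_eq_mul]

variable (N d β)

/-- The linear span of the planar diagrams. -/
noncomputable def planarLinearSpan : Submodule ℂ (LinkSpace N d β) :=
  Submodule.span ℂ {v | ∃ L : Link N d, L.IsPlanar ∧ v = diag β L}

variable {N d β}

/-- Each generator maps a planar diagram to a multiple of a planar diagram. So the submodule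
generated by the planar diagrams is no larger than their linear span. -/
theorem smul_mem_planarLinearSpan [NeZero N] (a : ATL N β) {v : LinkSpace N d β}
    (hv : v ∈ planarLinearSpan N d β) : a • v ∈ planarLinearSpan N d β := by
  induction a using ATL.induction generalizing v with
  | hc c => rw [algebraMap_smul]; exact Submodule.smul_mem _ c hv
  | ha a b iha ihb => rw [add_smul]; exact Submodule.add_mem _ (iha hv) (ihb hv)
  | hm a b iha ihb => rw [mul_smul]; exact iha (ihb hv)
  | hg g =>
    induction hv using Submodule.span_induction with
    | zero => rw [smul_zero]; exact Submodule.zero_mem _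
    | add v w _ _ hv hw => rw [smul_add]; exact Submodule.add_mem _ hv hw
    | smul c v _ hv => rw [smul_comm]; exact Submodule.smul_mem _ c hv
    | mem v hv =>
      obtain ⟨L, hL, rfl⟩ := hv
      cases g with
      | om => rw [om_smul_diag]; exact Submodule.subset_span ⟨_, hL.rotUp, rfl⟩
      | omInv => rw [omInv_smul_diag]; exact Submodule.subset_span ⟨_, hL.rotDown, rfl⟩
      | e h i =>
        rw [e_smul_diag]
        exact Submodule.smul_mem _ _ (Submodule.subset_span ⟨_, hL.cup h i, rfl⟩)

/-- The linear span of the planar diagrams is stable under the algebra. -/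
theorem planarSpan_le [NeZero N] {v : LinkSpace N d β} (hv : v ∈ planarSpan N d β) :
    v ∈ planarLinearSpan N d β := by
  induction hv using Submodule.span_induction with
  | zero => exact Submodule.zero_mem _
  | add v w _ _ hv hw => exact Submodule.add_mem _ hv hw
  | smul a v _ hv => exact smul_mem_planarLinearSpan a hv
  | mem v hv => exact Submodule.subset_span hv

/-- Modulo the relations of the cellular module, every planar diagram is a combination of reduced
ones. -/
theorem diag_mem_reduced [NeZero N] (z : ℂˣ) {L : Link N d} (hL : L.IsPlanar) :
    diag β L ∈ Submodule.span ℂ (diag β '' {L : Link N d | L.IsReduced}) ⊔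
      (cellRelations N d β z).restrictScalars ℂ := by
  set T := Submodule.span ℂ (diag β '' {L : Link N d | L.IsReduced}) ⊔
      (cellRelations N d β z).restrictScalars ℂ with hT
  have hK : ∀ v ∈ cellRelations N d β z, v ∈ T := fun v hv => Submodule.mem_sup_right hv
  have hF : ∀ L : Link N d, L.IsReduced → diag β L ∈ T := fun L hL =>
    Submodule.mem_sup_left (Submodule.subset_span ⟨L, hL, rfl⟩)
  by_cases hm : L.IsMonic
  swap
  · exact hK _ (Submodule.subset_span ⟨L, hL, Or.inl ⟨hm, rfl⟩⟩)
  by_cases hd : d = 0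
  · subst hd
    obtain ⟨l, hl⟩ : ∃ l, L.loops = l := ⟨_, rfl⟩
    -- Each non-contractible loop is traded for the factor z + z⁻¹. Without right sites, removing a
    -- loop preserves planarity, and the winding is an empty sum.
    induction l generalizing L with
    | zero => exact hF L (hL.isReduced hm hl (by simp [Link.winding]))
    | succ l ih =>
      let L' : Link N 0 := { L with loops := l }
      have hl' : ∀ i, (L'.p (.inl i)).isLeft := by
        intro i
        rcases L'.p (.inl i) with j | a
        · rfl
        · exact a.elim0
      have hL' : L'.IsPlanar := ⟨hL.1, fun _ => hl'⟩
      have e : L'.addLoop = L := Link.ext rfl rfl hl.symm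
      have h1 := ih hL' hm rfl
      have h2 := hK _ (Submodule.subset_span ⟨L', hL', Or.inr (Or.inr ⟨rfl, rfl⟩)⟩)
      rw [e] at h2
      have := T.add_mem h2 (T.smul_mem ((z : ℂ) + (z : ℂ)⁻¹) h1)
      rwa [sub_add_cancel] at this
  · have hz : (z : ℂ) ≠ 0 := z.ne_zero
    have hrel : ∀ L : Link N d, L.IsPlanar → diag β L.mulOmega - (z : ℂ) • diag β L ∈ T :=
      fun L hL => hK _ (Submodule.subset_span ⟨L, hL, Or.inr (Or.inl ⟨hd, rfl⟩)⟩)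
    obtain ⟨k, hk⟩ : ∃ k, L.winding.natAbs = k := ⟨_, rfl⟩
    -- Multiplying by Ω_d or its inverse brings the total winding one step closer to zero, at the
    -- cost of a factor z⁻¹ or z.
    induction k generalizing L with
    | zero =>
      exact hF L (hL.isReduced hm (hL.loops_eq_zero hm hd) (Int.natAbs_eq_zero.mp hk))
    | succ k ih =>
      rcases lt_or_ge 0 L.winding with h | h
      · have h1 := ih hL.mulOmega hm.mulOmega (by rw [Link.winding_mulOmega hm hd]; omega)
        have := T.smul_mem (z : ℂ)⁻¹ (T.sub_mem h1 (hrel L hL))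
        rwa [sub_sub_cancel, smul_smul, inv_mul_cancel₀ hz, one_smul] at this
      · have hw := Link.winding_mulOmega hm.mulOmegaInv hd
        rw [L.mulOmega_mulOmegaInv] at hw
        have h1 := ih hL.mulOmegaInv hm.mulOmegaInv (by omega)
        have := T.add_mem (hrel _ hL.mulOmegaInv) (T.smul_mem (z : ℂ) h1)
        rwa [L.mulOmega_mulOmegaInv, sub_add_cancel] at this

/-- The cellular modules are finite-dimensional. -/
theorem finite_cell (N d : ℕ) [NeZero N] (β : ℂ) (z : ℂˣ) :
    FiniteDimensional ℂ (Cell N d β z) := by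
  let K := cellRelations N d β z
  let F := Submodule.span ℂ (diag β '' {L : Link N d | L.IsReduced})
  have hF : FiniteDimensional ℂ F :=
    FiniteDimensional.span_of_finite ℂ (Link.finite_isReduced.image _)
  let π : LinkSpace N d β →ₗ[ℂ] LinkSpace N d β ⧸ K := K.mkQ.restrictScalars ℂ
  -- The cellular module embeds into the span of all diagrams modulo the relations, where its image
  -- lies in the span of the finitely many reduced diagrams. Reduced diagrams need not be planar for
  -- this bound.
  let ι : Cell N d β z →ₗ[ATL N β] LinkSpace N d β ⧸ K :=
    Submodule.mapQ _ K (planarSpan N d β).subtype le_rfl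
  have hι : Function.Injective ι := by
    refine (injective_iff_map_eq_zero _).mpr fun v hv => ?_
    obtain ⟨v, rfl⟩ := Submodule.mkQ_surjective _ v
    change Submodule.Quotient.mk (v : LinkSpace N d β) = 0 at hv
    rw [Submodule.Quotient.mk_eq_zero] at hv
    rw [Submodule.mkQ_apply, Submodule.Quotient.mk_eq_zero]
    exact hv
  have hle : ∀ v, ι v ∈ F.map π := by
    intro v
    obtain ⟨v, rfl⟩ := Submodule.mkQ_surjective _ v
    have hv : (v : LinkSpace N d β) ∈ F ⊔ K.restrictScalars ℂ := by
      refine (Submodule.span_le.mpr ?_ : planarLinearSpan N d β ≤ _) (planarSpan_le v.2)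
      rintro _ ⟨L, hL, rfl⟩
      exact diag_mem_reduced z hL
    obtain ⟨f, hf, k, hk, hfk⟩ := Submodule.mem_sup.mp hv
    refine ⟨f, hf, ?_⟩
    change Submodule.Quotient.mk f = Submodule.Quotient.mk (v : LinkSpace N d β)
    refine (Submodule.Quotient.eq K).mpr ?_
    rw [← hfk, sub_add_cancel_left]
    exact K.neg_mem hk
  exact FiniteDimensional.of_injective
    (LinearMap.codRestrict (F.map π) (ι.restrictScalars ℂ) hle) fun v w h =>
      hι (congrArg Subtype.val h)

end Finite

end AffineTL

namespace AffineTL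

/-! ### The quotient by the radical. -/

section Assembly

variable {N : ℕ} [NeZero N]

/-- The quotient of a finite-dimensional module by its radical is self-dual. -/
theorem isDual_quotient_jacobson {β : ℂ} (M : Type*) [AddCommGroup M] [Module ℂ M]
    [Module (ATL N β) M] [IsScalarTower ℂ (ATL N β) M] [FiniteDimensional ℂ M] :
    IsDual (ATL.sigma N β) (M ⧸ Module.jacobson (ATL N β) M)
      (M ⧸ Module.jacobson (ATL N β) M) := by
  have : IsArtinian (ATL N β) (M ⧸ Module.jacobson (ATL N β) M) :=
    isArtinian_of_tower ℂ inferInstance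
  -- An Artinian module is semisimple exactly when its radical vanishes, and dividing by the radical
  -- achieves this.
  have : IsSemisimpleModule (ATL N β) (M ⧸ Module.jacobson (ATL N β) M) :=
    (IsArtinian.isSemisimpleModule_iff_jacobson _ _).mpr (Module.jacobson_quotient_jacobson _ _)
  refine isDual_of_isSemisimple fun S hS => ?_
  have := finite_submodule S
  exact isDual_of_isSimple S

end Assembly

end AffineTL

theorem proposition2p3 (N : ℕ) [NeZero N] (q : ℂˣ) :
    (∀ (ε : ℤˣ) (d : ℤ) (z : ℂˣ),
      (∃ f : XXZd N q z ε d ≃ₗ[ATL N (beta q)] XXZd N q z⁻¹ (-ε) (-d),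
        ∀ v, XXZ.vec (f v : XXZ N q z⁻¹ (-ε)) = spinFlip N (XXZ.vec (v : XXZ N q z ε))) ∧
      Nonempty (StarDual (XXZd N q z ε d) ≃ₗ[ATL N (beta q)] XXZd N q z⁻¹ ε d) ∧
      Nonempty (CircTwist (XXZd N q z ε d) ≃ₗ[ATL N (beta q)] XXZd N q z⁻¹ (-ε) d)) ∧
    (∀ (d : ℕ) (z : ℂˣ), d ≤ N → d % 2 = N % 2 →
      ¬ (d = 0 ∧ (q : ℂ) + (q : ℂ)⁻¹ = 0 ∧ (z = q ∨ z = q⁻¹)) →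
      Nonempty (CircTwist (StarDual (Irr N d (beta q) z)) ≃ₗ[ATL N (beta q)]
        Irr N d (beta q) z)) ∧
    ∀ (d : ℤ) (z : ℂˣ),
      LoewyReciprocal (ATL N (beta q)) (XXZd N q z 1 d) (XXZd N q z (-1) d) := by
  refine ⟨fun ε d z => ⟨⟨spinFlipEquiv N q z ε d, fun v => rfl⟩, ?_, ⟨reflectEquiv N q z ε d⟩⟩,
    fun d z _ _ _ => ?_, fun d z => loewyReciprocal_XXZd N q z d⟩
  -- Both isomorphisms that remain come from the uniqueness of duals: two modules dual to the same
  -- finite-dimensional one, here with respect to † and below with respect to σ, are isomorphic.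
  · exact (isDual_starDual _).nonempty_equiv (isDual_dagger_XXZd d)
  · have := finite_cell N d (beta q) z
    exact (isDual_circTwist_starDual _).nonempty_equiv (isDual_quotient_jacobson _)
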